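/- Write $\log_+x:=\max\{1,\log x\}$ for $x\ge 1$. Let $G$ be a finite group of order $N$ and let $S\subseteq G$ be symmetric ($S=S^{-1}$). A symmetric weight function on $S$ is a map $w:S\to\mathbb R_{\ge 0}$ with $w(s)=w(s^{-1})$ for all $s\in S$; let $\operatorname{supp}(w)=\{s\in S: w(s)\ne 0\}$. The Laplacian of the weighted Cayley graph $\mathrm{Cay}(G,S,w)$ is the $G\times G$ real matrix $$L_w=\sum_{s\in S}w(s)\Bigl(\mathrm{Id}-\tfrac12\bigl(R(s)+R(s)^{*}\bigr)\Bigr),$$ where $R(s)$ is the permutation matrix that sends the basis vector of $g$ to that of $gs$. For symmetric matrices, $A\preceq B$ means that $B-A$ is positive semidefinite, and $A\approx_\varepsilon B$ means $(1-\varepsilon)B\preceq A\preceq(1+\varepsilon)B$. **Theorem.** There is an absolute constant $C>0$ such that the following holds. Let $G$ be a finite group of order $N$, let $S\subseteq G$ be a symmetric subset that generates $G$, let $\nu:S\to\mathbb R_{\ge0}$ be a non-zero symmetric weight function, let $$W=\frac{\max_{s\in\operatorname{supp}(\nu)}\nu(s)}{\min_{s\in\operatorname{supp}(\nu)}\nu(s)},$$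 and let $\varepsilon>0$. Then there is a symmetric weight function $\mu:S\to\mathbb R_{\ge0}$ with $L_\mu\approx_\varepsilon L_\nu$, with $$|\operatorname{supp}(\mu)|\le C\,\varepsilon^{-2}\,\log_+^3\! N\;\log_+|S|\;\log_+W ,$$ and consequently also with $$|\operatorname{supp}(\mu)|\le C\,\varepsilon^{-2}\,\log_+^4\! N\;\log_+W .$$ Furthermore, such a $\mu$, with the same constant $C$, can be computed in randomized polynomial time: for every $k\in\mathbb N$ there are one randomized real-RAM program (unit-cost exact arithmetic $+,-,\times,\div$ and comparison of real numbers, indirectly addressed memory, addition, truncated subtraction and comparison of indices, fair coin flips, only natural numbers as program constants) and one polynomial $p$ such that, for all $G,S,\nu,\varepsilon$ as above and every numbering of the elements of $G$, the program, given $N$, the multiplication table of $G$, the indicator of $S$, the values of $\nu$ (extended by $0$ to $G$) and $\varepsilon$, halts after at most $p(N)$ steps for all outcomes of the coin flips, and with probability at least $1-N^{-k}$ its output is a $\mu$ with all the properties above. -/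

import Mathlib

universe u

namespace CayleySparsification

/-! ## Weighted Cayley graphs and their Laplacians -/

section Cayley

variable {G : Type u} [Group G] [Fintype G] [DecidableEq G]

/-- A set `S` of group elements is symmetric if it is closed under inversion. -/
def IsSymmetricSet (S : Finset G) : Prop := ∀ s ∈ S, s⁻¹ ∈ S

/-- A symmetric weight function `S → ℝ≥0`, encoded through its extension by zero to `G`. -/
structure IsSymmetricWeight (S : Finset G) (w : G → ℝ) : Prop where
  nonneg : ∀ g, 0 ≤ w g
  eq_zero_of_notMem : ∀ g, g ∉ S → w g = 0
  symm : ∀ g, w g⁻¹ = w g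

/-- The support of a weight function. -/
noncomputable def supp (w : G → ℝ) : Finset G := Finset.univ.filter fun g => w g ≠ 0

/-- The right regular representation `R(s)`, sending the basis vector `g` to `g * s`, as a real
matrix with rows and columns indexed by `G`. -/
def rightRegular (s : G) : Matrix G G ℝ := Matrix.of fun h g => if h = g * s then 1 else 0

/-- `L_s = Id - (R(s) + R(s)ᵀ) / 2`. -/
noncomputable def generatorLaplacian (s : G) : Matrix G G ℝ :=
  1 - (1 / 2 : ℝ) • (rightRegular s + (rightRegular s).transpose)

/-- The Laplacian `∑_{s ∈ S} w(s) L_s` of the weighted Cayley graph `Cay(G, S, w)`. -/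
noncomputable def cayleyLaplacian (S : Finset G) (w : G → ℝ) : Matrix G G ℝ :=
  ∑ s ∈ S, w s • generatorLaplacian s

/-- The entries of the Laplacian: degree matrix minus weighted adjacency matrix, where `g` and `h`
are joined by an edge of weight `w (g⁻¹ * h)` (a loop contributes zero). -/
theorem cayleyLaplacian_apply {S : Finset G} {w : G → ℝ} (hw : IsSymmetricWeight S w) (g h : G) :
    cayleyLaplacian S w g h = (if g = h then ∑ s ∈ S, w s else 0) - w (g⁻¹ * h) := by
  have hS : ∀ x : G, ∑ s ∈ S, w s * (if s = x then (1 : ℝ) else 0) = w x := by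
    intro x
    by_cases hx : x ∈ S
    · simp [hx]
    · simp [hx, hw.eq_zero_of_notMem x hx]
  have h1 : ∀ s : G, (g = h * s) ↔ s = h⁻¹ * g := fun s => by
    constructor
    · rintro rfl
      simp
    · rintro rfl
      simp
  have h2 : ∀ s : G, (h = g * s) ↔ s = g⁻¹ * h := fun s => by
    constructor
    · rintro rfl
      simp
    · rintro rfl
      simp
  have h3 : w (h⁻¹ * g) = w (g⁻¹ * h) := by
    rw [← hw.symm (g⁻¹ * h)]
    simp
  have h4 : cayleyLaplacian S w g h = ∑ s ∈ S, (w s * (if g = h then (1 : ℝ) else 0)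
      - (1 / 2 : ℝ) * (w s * (if s = h⁻¹ * g then (1 : ℝ) else 0)
        + w s * (if s = g⁻¹ * h then (1 : ℝ) else 0))) := by
    simp only [cayleyLaplacian, generatorLaplacian, rightRegular, Matrix.sum_apply,
      Matrix.smul_apply, Matrix.sub_apply, Matrix.add_apply, Matrix.transpose_apply,
      Matrix.of_apply, Matrix.one_apply, smul_eq_mul, h1, h2]
    refine Finset.sum_congr rfl fun s _ => ?_
    ring
  rw [h4, Finset.sum_sub_distrib, ← Finset.mul_sum, Finset.sum_add_distrib, hS, hS, h3]
  rw [← Finset.sum_mul]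
  split_ifs <;> ring

/-- `A ≈_ε B`: the Loewner inequalities `(1 - ε) B ⪯ A ⪯ (1 + ε) B`. -/
def SpectralApprox (ε : ℝ) (A B : Matrix G G ℝ) : Prop :=
  (A - (1 - ε) • B).PosSemidef ∧ ((1 + ε) • B - A).PosSemidef

/-- `log₊ x = max {1, log x}`, the reading of `log` inside `O(·)`. -/
noncomputable def logPlus (x : ℝ) : ℝ := max 1 (Real.log x)

/-- The ratio of the largest to the smallest positive weight (`G` is finite, so that supremum and
infimum are a maximum and a minimum as soon as `w ≠ 0`). -/
noncomputable def weightRatio (w : G → ℝ) : ℝ :=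
  sSup (w '' Function.support w) / sInf (w '' Function.support w)

/-- `μ` is a symmetric weight function on `S` for which the Laplacian of `Cay(G, S, μ)`
`ε`-approximates that of `Cay(G, S, ν)`, with the claimed support sizes with constant `C`. -/
structure IsCayleySparsifier (C : ℝ) (S : Finset G) (ν : G → ℝ) (ε : ℝ) (μ : G → ℝ) : Prop where
  isSymmetricWeight : IsSymmetricWeight S μ
  card_supp_le : ((supp μ).card : ℝ) ≤
    C * (logPlus (Fintype.card G) ^ 3 * logPlus S.card * logPlus (weightRatio ν) / ε ^ 2)
  card_supp_le' : ((supp μ).card : ℝ) ≤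
    C * (logPlus (Fintype.card G) ^ 4 * logPlus (weightRatio ν) / ε ^ 2)
  approx : SpectralApprox ε (cayleyLaplacian S μ) (cayleyLaplacian S ν)

end Cayley

/-! ## Randomized real random access machines

Programs over finitely many named two-dimensional arrays of natural numbers (for indices and
control) and of real numbers, with unit-cost exact real arithmetic and comparisons and a fair coin.
The only constants in a program are natural numbers. -/

/-- Index expressions; `get a i j` reads entry `(i, j)` of the integer array `a`. -/
inductive NExp : Type
  | const (n : ℕ)
  | get (a : ℕ) (i j : NExp)
  | add (x y : NExp)
  | sub (x y : NExp)

/-- Real expressions; `get a i j` reads entry `(i, j)` of the real array `a`. -/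
inductive RExp : Type
  | cast (x : NExp)
  | get (a : ℕ) (i j : NExp)
  | add (x y : RExp)
  | sub (x y : RExp)
  | mul (x y : RExp)
  | div (x y : RExp)

/-- Tests. -/
inductive BExp : Type
  | natLt (x y : NExp)
  | realLt (x y : RExp)
  | not (b : BExp)
  | and (b c : BExp)

/-- Commands; `flip a i j` stores a fair random bit in entry `(i, j)` of the integer array `a`. -/
inductive Cmd : Type
  | skip
  | setNat (a : ℕ) (i j : NExp) (x : NExp)
  | setReal (a : ℕ) (i j : NExp) (x : RExp)
  | flip (a : ℕ) (i j : NExp)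
  | seq (c d : Cmd)
  | ite (b : BExp) (c d : Cmd)
  | loop (b : BExp) (c : Cmd)

/-- Memory contents, and the number of coins flipped so far. -/
structure Store : Type where
  nat : ℕ → ℕ → ℕ → ℕ
  real : ℕ → ℕ → ℕ → ℝ
  used : ℕ

/-- Writing `v` into entry `(i, j)` of the array `a`. -/
def write {α : Type} (m : ℕ → ℕ → ℕ → α) (a i j : ℕ) (v : α) : ℕ → ℕ → ℕ → α :=
  fun a' i' j' => if a' = a ∧ i' = i ∧ j' = j then v else m a' i' j'

/-- Value of an index expression (subtraction is truncated at zero). -/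
def NExp.eval (σ : Store) : NExp → ℕ
  | .const n => n
  | .get a i j => σ.nat a (i.eval σ) (j.eval σ)
  | .add x y => x.eval σ + y.eval σ
  | .sub x y => x.eval σ - y.eval σ

/-- Value of a real expression (with the convention `x / 0 = 0`). -/
noncomputable def RExp.eval (σ : Store) : RExp → ℝ
  | .cast x => (x.eval σ : ℝ)
  | .get a i j => σ.real a (i.eval σ) (j.eval σ)
  | .add x y => x.eval σ + y.eval σ
  | .sub x y => x.eval σ - y.eval σ
  | .mul x y => x.eval σ * y.eval σ
  | .div x y => x.eval σ / y.eval σ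

/-- Truth of a test. -/
def BExp.holds (σ : Store) : BExp → Prop
  | .natLt x y => x.eval σ < y.eval σ
  | .realLt x y => x.eval σ < y.eval σ
  | .not b => ¬ b.holds σ
  | .and b c => b.holds σ ∧ c.holds σ

/-- `Exec coin c σ τ t`: with the random bits `coin 0, coin 1, …`, the command `c` started in `σ`
halts in `τ` after `t` steps. Every assignment, coin flip and evaluation of a test is one step; as
the expressions in a fixed program have bounded size, this counts the elementary operations up to
a constant factor. -/
inductive Exec (coin : ℕ → Bool) : Cmd → Store → Store → ℕ → Prop
  | skip (σ : Store) : Exec coin .skip σ σ 1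
  | setNat (σ : Store) (a : ℕ) (i j x : NExp) :
      Exec coin (.setNat a i j x) σ
        { σ with nat := write σ.nat a (i.eval σ) (j.eval σ) (x.eval σ) } 1
  | setReal (σ : Store) (a : ℕ) (i j : NExp) (x : RExp) :
      Exec coin (.setReal a i j x) σ
        { σ with real := write σ.real a (i.eval σ) (j.eval σ) (x.eval σ) } 1
  | flip (σ : Store) (a : ℕ) (i j : NExp) :
      Exec coin (.flip a i j) σ
        { σ with
          nat := write σ.nat a (i.eval σ) (j.eval σ) (coin σ.used).toNat
          used := σ.used + 1 } 1
  | seq {c d : Cmd} {σ τ ρ : Store} {s t : ℕ} :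
      Exec coin c σ τ s → Exec coin d τ ρ t → Exec coin (.seq c d) σ ρ (s + t)
  | iteTrue {b : BExp} {c d : Cmd} {σ τ : Store} {t : ℕ} :
      b.holds σ → Exec coin c σ τ t → Exec coin (.ite b c d) σ τ (t + 1)
  | iteFalse {b : BExp} {c d : Cmd} {σ τ : Store} {t : ℕ} :
      ¬ b.holds σ → Exec coin d σ τ t → Exec coin (.ite b c d) σ τ (t + 1)
  | loopDone {b : BExp} {c : Cmd} {σ : Store} :
      ¬ b.holds σ → Exec coin (.loop b c) σ σ 1
  | loopStep {b : BExp} {c : Cmd} {σ τ ρ : Store} {s t : ℕ} :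
      b.holds σ → Exec coin c σ τ s → Exec coin (.loop b c) τ ρ t →
      Exec coin (.loop b c) σ ρ (s + t + 1)

/-- For given random bits the result and the number of steps are unique. -/
theorem Exec.deterministic {coin : ℕ → Bool} {c : Cmd} {σ τ τ' : Store} {t t' : ℕ}
    (h : Exec coin c σ τ t) (h' : Exec coin c σ τ' t') : τ = τ' ∧ t = t' := by
  induction h generalizing τ' t' with
  | skip => cases h'; exact ⟨rfl, rfl⟩
  | setNat => cases h'; exact ⟨rfl, rfl⟩
  | setReal => cases h'; exact ⟨rfl, rfl⟩
  | flip => cases h'; exact ⟨rfl, rfl⟩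
  | seq _ _ ih1 ih2 =>
    cases h' with
    | seq h1 h2 =>
      obtain ⟨rfl, rfl⟩ := ih1 h1
      obtain ⟨rfl, rfl⟩ := ih2 h2
      exact ⟨rfl, rfl⟩
  | iteTrue hb _ ih =>
    cases h' with
    | iteTrue _ h1 =>
      obtain ⟨rfl, rfl⟩ := ih h1
      exact ⟨rfl, rfl⟩
    | iteFalse hb' _ => exact absurd hb hb'
  | iteFalse hb _ ih =>
    cases h' with
    | iteTrue hb' _ => exact absurd hb' hb
    | iteFalse _ h1 =>
      obtain ⟨rfl, rfl⟩ := ih h1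
      exact ⟨rfl, rfl⟩
  | loopDone hb =>
    cases h' with
    | loopDone _ => exact ⟨rfl, rfl⟩
    | loopStep hb' _ _ => exact absurd hb' hb
  | loopStep hb _ _ ih1 ih2 =>
    cases h' with
    | loopDone hb' => exact absurd hb hb'
    | loopStep _ h1 h2 =>
      obtain ⟨rfl, rfl⟩ := ih1 h1
      obtain ⟨rfl, rfl⟩ := ih2 h2
      exact ⟨rfl, rfl⟩

/-- A string of `T` random bits, continued by `false`. -/
def coinsOf {T : ℕ} (r : Fin T → Bool) : ℕ → Bool :=
  fun i => if h : i < T then r ⟨i, h⟩ else false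

open Classical in
/-- The probability of the event `E` for `T` independent fair coins. It is only used for events
that depend on the first `T` coins. -/
noncomputable def coinProb (T : ℕ) (E : Set (ℕ → Bool)) : ℝ :=
  ((Finset.univ.filter fun r : Fin T → Bool => coinsOf r ∈ E).card : ℝ) / 2 ^ T

section Encoding

variable {G : Type u} [Group G] [Fintype G] [DecidableEq G]

/-- The input `(G, S, ν, ε)`, for a numbering `e` of the elements of `G`: integer arrays `0`, `1`,
`2` hold the order of `G`, its multiplication table and the indicator of `S`, real arrays `0` and
`1` hold `ν` and `ε`; everything else is zero. -/
noncomputable def inputStore (e : G ≃ Fin (Fintype.card G)) (S : Finset G) (ν : G → ℝ) (ε : ℝ) :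
    Store where
  nat a i j :=
    if a = 0 ∧ i = 0 ∧ j = 0 then Fintype.card G
    else if a = 1 then
      if h : i < Fintype.card G ∧ j < Fintype.card G then
        (e (e.symm ⟨i, h.1⟩ * e.symm ⟨j, h.2⟩) : ℕ)
      else 0
    else if a = 2 ∧ j = 0 then
      if h : i < Fintype.card G then (if e.symm ⟨i, h⟩ ∈ S then 1 else 0) else 0
    else 0
  real a i j :=
    if a = 0 ∧ j = 0 then
      if h : i < Fintype.card G then ν (e.symm ⟨i, h⟩) else 0
    else if a = 1 ∧ i = 0 ∧ j = 0 then ε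
    else 0
  used := 0

/-- The output weights are read off from real array `2`. -/
def outputWeight (e : G ≃ Fin (Fintype.card G)) (τ : Store) : G → ℝ :=
  fun g => τ.real 2 (e g) 0

end Encoding

end CayleySparsification

open CayleySparsification

/-! The proof derandomizes importance sampling of generators by a greedy argument that uses only
exact field operations. Write L for the Laplacian of `ν` and take a matrix C with C L Cᵀ = 1. The
whitened matrices ν(s) C L_s Cᵀ are positive semidefinite with sum 1. Choose an integer K(s) between
1 and N such that Y_s = K(s) ν(s) C L_s Cᵀ is at most 2. Then ∑ Y_s / K(s) = 1, so with Z = ∑ 1 /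
K(s) the average of Y_s for the probabilities 1 / (K(s) Z) is 1 / Z. After m steps, m being about Z
(log N) / η², a sum X of matrices Y_s should be close to (m / Z) · 1, and the weights scaled by Z /
m form the sparsifier.

Existence of X: the potential Tr (1 + aX)^q / U^t + Tr (1 - aX)^q / V^t, with a = η / q, does not
increase on average when some Y_s is added to X, so some s does not increase it
(`GreedyParams.exists_potential_le`). The analytic input is `trace_add_pow_le`, a second order
estimate for traces of powers. If the potential is still at most 2N at time m, both traces confine
the eigenvalues of X to the interval from (m / Z)(1 - 8η) to (m / Z)(1 + 6η)
(`GreedySetup.lap_bounds`).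

Size of Z: in any set B of generators, a list picked greedily with pairwise distinct subproducts has
length at most log₂ N, and each element of B is a quotient of two subproducts
(`exists_covering_list`). By the triangle inequality and Cauchy–Schwarz the list dominates the
Dirichlet form of every element of B. Peeling off many such lists shows that, among generators with
weights within a factor 2, only O(j log² N) have K(s) < j (`card_important_le`). Summation over j
costs log |S| and summation over the dyadic weight classes costs log W
(`sum_one_div_importance_le`).

Computability: the algorithm sees C only through B = Cᵀ C, a generalized inverse of L obtained by
Gram–Schmidt without square roots. The traces of (C L_w Cᵀ)^q equal those of (B L_w)^q, so both the
choice of K(s) and the potential can be evaluated exactly; this is why powers replace matrix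
exponentials. No coin is flipped, so the success probability is 1. The cases ε ≥ 1 and ε² N ≤ 1 are
settled by μ = 0 and μ = ν, and otherwise q and m are polynomial in N. -/

set_option linter.unusedSectionVars false

namespace CayleySparsification

open Matrix
open scoped MatrixOrder

/-! ### Traces of powers of positive semidefinite matrices -/

section TracePower

variable {ι : Type*} [Fintype ι] [DecidableEq ι]

theorem exists_orthogonal_diagonal {P : Matrix ι ι ℝ} (hP : P.IsHermitian) :
    ∃ (U : Matrix ι ι ℝ) (d : ι → ℝ), U * Uᵀ = 1 ∧ Uᵀ * U = 1 ∧ P = U * diagonal d * Uᵀ := by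
  refine ⟨hP.eigenvectorUnitary, hP.eigenvalues, ?_, ?_, ?_⟩
  · have := Unitary.coe_mul_star_self hP.eigenvectorUnitary
    rwa [Unitary.coe_star, star_eq_conjTranspose, conjTranspose_eq_transpose_of_trivial] at this
  · have := Unitary.coe_star_mul_self hP.eigenvectorUnitary
    rwa [star_eq_conjTranspose, conjTranspose_eq_transpose_of_trivial] at this
  · have := hP.spectral_theorem
    rw [Unitary.conjStarAlgAut_apply, star_eq_conjTranspose,
      conjTranspose_eq_transpose_of_trivial] at this
    exact this

theorem diag_pow {P U : Matrix ι ι ℝ} {d : ι → ℝ} (h1 : U * Uᵀ = 1) (h2 : Uᵀ * U = 1)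
    (h : P = U * diagonal d * Uᵀ) (n : ℕ) :
    P ^ n = U * diagonal (fun i => d i ^ n) * Uᵀ := by
  induction n with
  | zero => simp [h1]
  | succ n ih =>
    rw [pow_succ, ih, h]
    calc _ = U * (diagonal (fun i => d i ^ n) * (Uᵀ * U) * diagonal d) * Uᵀ := by
          simp only [Matrix.mul_assoc]
      _ = _ := by rw [h2, Matrix.mul_one, diagonal_mul_diagonal]; simp only [pow_succ]

theorem posSemidef_diag_nonneg {P U : Matrix ι ι ℝ} {d : ι → ℝ} (hP : P.PosSemidef)
    (h2 : Uᵀ * U = 1) (h : P = U * diagonal d * Uᵀ) (i : ι) : 0 ≤ d i := by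
  have h3 : diagonal d = Uᵀ * P * U := by
    rw [h]
    calc _ = (Uᵀ * U) * diagonal d * (Uᵀ * U) := by rw [h2]; simp
      _ = _ := by simp only [Matrix.mul_assoc]
  have h4 := hP.conjTranspose_mul_mul_same U
  rw [conjTranspose_eq_transpose_of_trivial, ← h3] at h4
  simpa using h4.diag_nonneg (i := i)

theorem trace_mul_nonneg {A B : Matrix ι ι ℝ} (hA : A.PosSemidef) (hB : B.PosSemidef) :
    0 ≤ trace (A * B) := by
  obtain ⟨U, d, h1, h2, h⟩ := exists_orthogonal_diagonal hA.isHermitian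
  have h4 := hB.conjTranspose_mul_mul_same U
  rw [conjTranspose_eq_transpose_of_trivial] at h4
  have : trace (A * B) = trace (diagonal d * (Uᵀ * B * U)) := by
    rw [h, Matrix.mul_assoc, Matrix.mul_assoc, trace_mul_comm]
    simp only [Matrix.mul_assoc]
  rw [this]
  simp only [trace, diag_apply, diagonal_mul]
  exact Finset.sum_nonneg fun i _ => mul_nonneg (posSemidef_diag_nonneg hA h2 h i) h4.diag_nonneg

theorem trace_mul_le {A B C : Matrix ι ι ℝ} (hA : A.PosSemidef) (h : B ≤ C) :
    trace (A * B) ≤ trace (A * C) := by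
  have := trace_mul_nonneg hA (le_iff.1 h)
  rw [Matrix.mul_sub, trace_sub] at this
  linarith

/-- A positive semidefinite matrix whose `q`-th power has trace at most `c ^ q` is at most `c`. -/
theorem le_smul_one_of_trace_pow_le {P : Matrix ι ι ℝ} (hP : P.PosSemidef) {q : ℕ} (hq : q ≠ 0)
    {c : ℝ} (hc : 0 ≤ c) (h : trace (P ^ q) ≤ c ^ q) : P ≤ c • (1 : Matrix ι ι ℝ) := by
  obtain ⟨U, d, h1, h2, hd⟩ := exists_orthogonal_diagonal hP.isHermitian
  have hd0 := posSemidef_diag_nonneg hP h2 hd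
  rw [diag_pow h1 h2 hd, Matrix.mul_assoc, trace_mul_comm, Matrix.mul_assoc, h2, Matrix.mul_one,
    trace_diagonal] at h
  have h3 : ∀ i, d i ≤ c := fun i => by
    refine le_of_pow_le_pow_left₀ hq hc (le_trans ?_ h)
    exact Finset.single_le_sum (f := fun i => d i ^ q) (fun j _ => pow_nonneg (hd0 j) q)
      (Finset.mem_univ i)
  have h4 : c • (1 : Matrix ι ι ℝ) - P = U * diagonal (fun i => c - d i) * Uᵀ := by
    have : diagonal (fun i => c - d i) = c • (1 : Matrix ι ι ℝ) - diagonal d := by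
      ext i j; by_cases hij : i = j <;> simp [hij, one_apply]
    rw [this, Matrix.mul_sub, Matrix.sub_mul, ← hd, Matrix.mul_smul, Matrix.mul_one,
      Matrix.smul_mul, h1]
  rw [le_iff, h4]
  have h5 : (diagonal (fun i => c - d i)).PosSemidef :=
    PosSemidef.diagonal fun i => sub_nonneg.2 (h3 i)
  simpa [conjTranspose_eq_transpose_of_trivial] using h5.mul_mul_conjTranspose_same U

theorem trace_pow_le_card {P : Matrix ι ι ℝ} (hP : P.PosSemidef) (q : ℕ) (h : P ≤ 1) :
    trace (P ^ q) ≤ Fintype.card ι := by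
  obtain ⟨U, d, h1, h2, hd⟩ := exists_orthogonal_diagonal hP.isHermitian
  have hd0 := posSemidef_diag_nonneg hP h2 hd
  have hd1 : ∀ i, d i ≤ 1 := fun i => by
    have h4 : (1 : Matrix ι ι ℝ) - P = U * diagonal (fun i => 1 - d i) * Uᵀ := by
      have : diagonal (fun i => 1 - d i) = (1 : Matrix ι ι ℝ) - diagonal d := by
        ext i j; by_cases hij : i = j <;> simp [hij, one_apply]
      rw [this, Matrix.mul_sub, Matrix.sub_mul, ← hd, Matrix.mul_one, h1]
    exact sub_nonneg.1 (posSemidef_diag_nonneg (le_iff.1 h) h2 h4 i)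
  rw [diag_pow h1 h2 hd, Matrix.mul_assoc, trace_mul_comm, Matrix.mul_assoc, h2, Matrix.mul_one,
    trace_diagonal]
  calc _ ≤ ∑ _i : ι, (1 : ℝ) := Finset.sum_le_sum fun i _ => pow_le_one₀ (hd0 i) (hd1 i)
    _ = _ := by simp

/-- Pair the index i with n - i: since powers are monotone, (a^i - b^i)(a^(n-i) - b^(n-i)) ≥ 0,
which bounds each pair by a^n + b^n. -/
theorem sum_pow_mul_pow_le {a b : ℝ} (ha : 0 ≤ a) (hb : 0 ≤ b) (n : ℕ) :
    2 * ∑ i ∈ Finset.range (n + 1), a ^ (n - i) * b ^ i ≤ (n + 1) * (a ^ n + b ^ n) := by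
  have h1 : ∑ i ∈ Finset.range (n + 1), a ^ (n - i) * b ^ i =
      ∑ i ∈ Finset.range (n + 1), a ^ i * b ^ (n - i) := by
    rw [← Finset.sum_range_reflect]
    refine Finset.sum_congr rfl fun i hi => ?_
    have : i ≤ n := by simpa [Nat.lt_succ_iff] using hi
    congr 2; omega
  have h2 : ∀ i ∈ Finset.range (n + 1),
      a ^ (n - i) * b ^ i + a ^ i * b ^ (n - i) ≤ a ^ n + b ^ n := fun i hi => by
    have hi' : i ≤ n := by simpa [Nat.lt_succ_iff] using hi
    have e : ∀ x : ℝ, x ^ n = x ^ i * x ^ (n - i) := fun x => by rw [← pow_add]; congr 1; omega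
    have : 0 ≤ (a ^ i - b ^ i) * (a ^ (n - i) - b ^ (n - i)) := by
      rcases le_total a b with h | h
      · exact mul_nonneg_of_nonpos_of_nonpos (sub_nonpos.2 (pow_le_pow_left₀ ha h _))
          (sub_nonpos.2 (pow_le_pow_left₀ ha h _))
      · exact mul_nonneg (sub_nonneg.2 (pow_le_pow_left₀ hb h _))
          (sub_nonneg.2 (pow_le_pow_left₀ hb h _))
    rw [e a, e b]; linarith
  calc 2 * ∑ i ∈ Finset.range (n + 1), a ^ (n - i) * b ^ i
      = ∑ i ∈ Finset.range (n + 1), (a ^ (n - i) * b ^ i + a ^ i * b ^ (n - i)) := by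
        rw [Finset.sum_add_distrib, ← h1]; ring
    _ ≤ ∑ i ∈ Finset.range (n + 1), (a ^ n + b ^ n) := Finset.sum_le_sum h2
    _ = _ := by simp only [Finset.sum_const, Finset.card_range, nsmul_eq_mul]; push_cast; ring

/-- The second derivative of `t ↦ Tr (P + t Y) ^ (n + 2)` is at most what it would be if `P` and `Y`
commuted. -/
theorem sum_trace_pow_mul_pow_le {P Y : Matrix ι ι ℝ} (hP : P.PosSemidef) (hY : Y.IsHermitian)
    (n : ℕ) :
    ∑ i ∈ Finset.range (n + 1), trace (Y * (P ^ (n - i) * Y * P ^ i)) ≤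
      (n + 1) * trace (Y * Y * P ^ n) := by
  obtain ⟨U, d, h1, h2, hd⟩ := exists_orthogonal_diagonal hP.isHermitian
  have hd0 := posSemidef_diag_nonneg hP h2 hd
  obtain ⟨Z, hZ⟩ : ∃ Z, Z = Uᵀ * Y * U := ⟨_, rfl⟩
  have hZs : ∀ i j, Z i j = Z j i := fun i j => by
    have : Zᵀ = Z := by
      have hY' : Yᵀ = Y := by simpa [IsHermitian, conjTranspose_eq_transpose_of_trivial] using hY
      rw [hZ]; simp [Matrix.transpose_mul, hY', Matrix.mul_assoc]
    exact congrFun (congrFun this j) i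
  -- In an eigenbasis of P, where Y becomes the symmetric matrix Z, every trace is a combination of
  -- the squares Z i j ^ 2, and the claim reduces to the scalar inequality for the eigenvalues d i,
  -- d j.
  have key : ∀ a b : ℕ, trace (Y * (P ^ a * Y * P ^ b)) =
      ∑ i, ∑ j, Z i j ^ 2 * (d j ^ a * d i ^ b) := fun a b => by
    have : trace (Y * (P ^ a * Y * P ^ b)) =
        trace (Z * diagonal (fun i => d i ^ a) * (Z * diagonal (fun i => d i ^ b))) := by
      rw [diag_pow h1 h2 hd, diag_pow h1 h2 hd, hZ]
      calc _ = trace ((Y * U * diagonal (fun i => d i ^ a) * Uᵀ * Y * U *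
            diagonal (fun i => d i ^ b)) * Uᵀ) := by simp only [Matrix.mul_assoc]
        _ = _ := by rw [trace_mul_comm]; simp only [Matrix.mul_assoc]
    rw [this]
    simp only [trace, diag_apply, Matrix.mul_apply (M := Z * _), mul_diagonal]
    refine Finset.sum_congr rfl fun i _ => Finset.sum_congr rfl fun j _ => ?_
    rw [hZs j i]; ring
  have key2 : trace (Y * Y * P ^ n) = ∑ i, ∑ j, Z i j ^ 2 * d i ^ n := by
    have := key 0 n
    simpa [Matrix.mul_assoc] using this
  have key3 : trace (Y * Y * P ^ n) = ∑ i, ∑ j, Z i j ^ 2 * d j ^ n := by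
    rw [key2, Finset.sum_comm]
    exact Finset.sum_congr rfl fun i _ => Finset.sum_congr rfl fun j _ => by rw [hZs]
  have key4 : (n + 1) * (2 * trace (Y * Y * P ^ n)) =
      ∑ i, ∑ j, Z i j ^ 2 * ((n + 1) * (d j ^ n + d i ^ n)) := by
    rw [two_mul]
    nth_rewrite 1 [key3]
    rw [key2, ← Finset.sum_add_distrib, Finset.mul_sum]
    refine Finset.sum_congr rfl fun i _ => ?_
    rw [← Finset.sum_add_distrib, Finset.mul_sum]
    exact Finset.sum_congr rfl fun j _ => by ring
  have key5 : 2 * ∑ i ∈ Finset.range (n + 1), trace (Y * (P ^ (n - i) * Y * P ^ i)) =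
      ∑ i, ∑ j, Z i j ^ 2 * (2 * ∑ k ∈ Finset.range (n + 1), d j ^ (n - k) * d i ^ k) := by
    simp only [key]
    rw [Finset.sum_comm, Finset.mul_sum]
    refine Finset.sum_congr rfl fun i _ => ?_
    rw [Finset.sum_comm, Finset.mul_sum]
    refine Finset.sum_congr rfl fun j _ => ?_
    rw [← Finset.mul_sum]; ring
  have : ∑ i, ∑ j, Z i j ^ 2 * (2 * ∑ k ∈ Finset.range (n + 1), d j ^ (n - k) * d i ^ k) ≤
      ∑ i, ∑ j, Z i j ^ 2 * ((n + 1) * (d j ^ n + d i ^ n)) :=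
    Finset.sum_le_sum fun i _ => Finset.sum_le_sum fun j _ =>
      mul_le_mul_of_nonneg_left (sum_pow_mul_pow_le (hd0 j) (hd0 i) n) (sq_nonneg _)
  linarith

section Calculus

-- The norm only gives a meaning to derivatives of matrix polynomials; its choice is irrelevant.
attribute [local instance] Matrix.linftyOpNormedRing Matrix.linftyOpNormedAlgebra

theorem hasDerivAt_trace_mul_pow (A P Y : Matrix ι ι ℝ) (n : ℕ) (t : ℝ) :
    HasDerivAt (fun t : ℝ => trace (A * (P + t • Y) ^ n))
      (∑ i ∈ Finset.range n, trace (A * ((P + t • Y) ^ (n - 1 - i) * Y * (P + t • Y) ^ i))) t := by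
  have h1 : HasDerivAt (fun t : ℝ => P + t • Y) Y t := by
    have := ((hasDerivAt_id t).smul_const Y).const_add P
    rwa [one_smul] at this
  have h2 := (h1.fun_pow' n).const_mul A
  let T : Matrix ι ι ℝ →L[ℝ] ℝ := LinearMap.toContinuousLinearMap (traceLinearMap ι ℝ ℝ)
  have h3 := T.hasFDerivAt.comp_hasDerivAt t h2
  have h4 : T (A * ∑ i ∈ Finset.range n, (P + t • Y) ^ (n.pred - i) * Y * (P + t • Y) ^ i) =
      ∑ i ∈ Finset.range n, trace (A * ((P + t • Y) ^ (n - 1 - i) * Y * (P + t • Y) ^ i)) := by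
    rw [Finset.mul_sum, map_sum]; rfl
  exact h3.congr_deriv h4

end Calculus

/-- By cyclicity of the trace all n + 1 terms of the noncommutative product rule coincide. -/
theorem hasDerivAt_trace_pow (P Y : Matrix ι ι ℝ) (n : ℕ) (t : ℝ) :
    HasDerivAt (fun t : ℝ => trace ((P + t • Y) ^ (n + 1)))
      ((n + 1) * trace (Y * (P + t • Y) ^ n)) t := by
  have h := hasDerivAt_trace_mul_pow 1 P Y (n + 1) t
  simp only [Matrix.one_mul] at h
  have : ∀ i ∈ Finset.range (n + 1),
      trace ((P + t • Y) ^ (n + 1 - 1 - i) * Y * (P + t • Y) ^ i) =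
        trace (Y * (P + t • Y) ^ n) := fun i hi => by
    have hi : i ≤ n := by simpa [Nat.lt_succ_iff] using hi
    rw [Matrix.mul_assoc, trace_mul_comm, Matrix.mul_assoc, ← pow_add]
    congr 3; omega
  rw [Finset.sum_congr rfl this] at h
  simpa using h

/-- Grönwall's inequality: exp(-ct) g(t) is nonincreasing. -/
theorem le_exp_mul_of_deriv_le {g g' : ℝ → ℝ} {c : ℝ} (hg : ∀ t, HasDerivAt g (g' t) t)
    (h : ∀ t ∈ Set.Icc (0 : ℝ) 1, g' t ≤ c * g t) {t : ℝ} (ht : t ∈ Set.Icc (0 : ℝ) 1) :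
    g t ≤ Real.exp (c * t) * g 0 := by
  have hd : ∀ t, HasDerivAt (fun t => Real.exp (-(c * t)) * g t)
      (Real.exp (-(c * t)) * (g' t - c * g t)) t := fun t => by
    have h1 : HasDerivAt (fun t : ℝ => Real.exp (-(c * t))) (Real.exp (-(c * t)) * (-c)) t := by
      have := ((hasDerivAt_id t).const_mul c).neg.exp
      simpa using this
    exact (h1.mul (hg t)).congr_deriv (by ring)
  have ha : AntitoneOn (fun t => Real.exp (-(c * t)) * g t) (Set.Icc 0 1) := by
    refine antitoneOn_of_deriv_nonpos (convex_Icc 0 1)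
      (fun t _ => (hd t).continuousAt.continuousWithinAt)
      (fun t _ => (hd t).differentiableAt.differentiableWithinAt) fun t ht => ?_
    rw [(hd t).deriv]
    exact mul_nonpos_of_nonneg_of_nonpos (Real.exp_pos _).le
      (sub_nonpos.2 (h t (interior_subset ht)))
  have h2 := ha (Set.left_mem_Icc.2 zero_le_one) ht ht.1
  simp only [mul_zero, neg_zero, Real.exp_zero, one_mul] at h2
  calc g t = Real.exp (c * t) * (Real.exp (-(c * t)) * g t) := by
        rw [← mul_assoc, ← Real.exp_add]; simp
    _ ≤ _ := mul_le_mul_of_nonneg_left h2 (Real.exp_pos _).le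

/-- The first derivative of Tr (P + tY)^(n+2) is (n + 2) g(t) with g(t) = Tr Y (P + tY)^(n+1). The
hypothesis together with `sum_trace_pow_mul_pow_le` gives g' ≤ c g, so Grönwall and the mean value
theorem apply. The constant c may have either sign, which allows both increments and decrements Y.
-/
theorem trace_add_pow_le {P Y : Matrix ι ι ℝ} (hY : Y.IsHermitian) (n : ℕ) (c : ℝ)
    (hP : ∀ t ∈ Set.Icc (0 : ℝ) 1, (P + t • Y).PosSemidef)
    (h : ∀ t ∈ Set.Icc (0 : ℝ) 1,
      (n + 1) * trace (Y * Y * (P + t • Y) ^ n) ≤ c * trace (Y * (P + t • Y) ^ (n + 1))) :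
    trace ((P + Y) ^ (n + 2)) ≤
      trace (P ^ (n + 2)) + (n + 2) * (Real.exp c * trace (Y * P ^ (n + 1))) := by
  have h0 : (0 : ℝ) ∈ Set.Icc (0 : ℝ) 1 := by simp
  have hg := fun t => hasDerivAt_trace_mul_pow Y P Y (n + 1) t
  have hc : 0 ≤ c * trace (Y * P ^ (n + 1)) := by
    have h1 := h 0 h0
    have h2 := hP 0 h0
    simp only [zero_smul, add_zero] at h1 h2
    refine le_trans (mul_nonneg (by positivity) ?_) h1
    have h3 : (Y * Y).PosSemidef := by
      have := posSemidef_conjTranspose_mul_self Y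
      rwa [hY.eq] at this
    exact trace_mul_nonneg h3 (h2.pow n)
  have hb : ∀ t ∈ Set.Icc (0 : ℝ) 1,
      trace (Y * (P + t • Y) ^ (n + 1)) ≤ Real.exp c * trace (Y * P ^ (n + 1)) := fun t ht => by
    have h1 := le_exp_mul_of_deriv_le hg (c := c) (fun s hs => ?_) ht
    · simp only [zero_smul, add_zero] at h1
      refine h1.trans ?_
      -- Since c g(0) ≥ 0, the numbers c and g(0) have the same sign, and in both cases exp(ct) g(0)
      -- ≤ exp(c) g(0) for t ≤ 1.
      rcases le_total 0 c with h2 | h2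
      · rcases h2.eq_or_lt with rfl | h2
        · simp
        · exact mul_le_mul_of_nonneg_right (Real.exp_le_exp.2 (mul_le_of_le_one_right h2.le ht.2))
            (nonneg_of_mul_nonneg_right hc h2)
      · rcases h2.eq_or_lt with rfl | h2
        · simp
        · exact mul_le_mul_of_nonpos_right (Real.exp_le_exp.2 (by nlinarith [ht.1, ht.2]))
            (by nlinarith)
    · exact (sum_trace_pow_mul_pow_le (hP s hs) hY n).trans (h s hs)
  have hf := fun t => hasDerivAt_trace_pow P Y (n + 1) t
  obtain ⟨t, ht, h1⟩ := exists_hasDerivAt_eq_slope _ _ (zero_lt_one' ℝ)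
    (fun t _ => (hf t).continuousAt.continuousWithinAt) fun t _ => hf t
  have h2 := hb t (Set.Ioo_subset_Icc_self ht)
  simp only [one_smul, zero_smul, add_zero, sub_zero, div_one] at h1
  have h3 : ((n + 1 : ℕ) + 1 : ℝ) * trace (Y * (P + t • Y) ^ (n + 1)) ≤
      (n + 2) * (Real.exp c * trace (Y * P ^ (n + 1))) := by
    push_cast
    rw [add_assoc, one_add_one_eq_two]
    exact mul_le_mul_of_nonneg_left h2 (by positivity)
  linarith

/-- The difference is P^n Q with Q = P - b. According to the parity of n it is P^k Q P^k or P^k (P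
Q) P^k, and P Q = Q² + bQ is positive semidefinite, so no square root of P is needed. -/
theorem posSemidef_pow_mul_sub {P : Matrix ι ι ℝ} {b : ℝ} (hb : 0 ≤ b) (hP : P.PosSemidef)
    (h : b • (1 : Matrix ι ι ℝ) ≤ P) (n : ℕ) : b • P ^ n ≤ P ^ (n + 1) := by
  obtain ⟨Q, hQ⟩ : ∃ Q, Q = P - b • (1 : Matrix ι ι ℝ) := ⟨_, rfl⟩
  have hQp : Q.PosSemidef := hQ ▸ le_iff.1 h
  have hPQ : P = Q + b • 1 := by rw [hQ]; abel
  have h1 : (P * Q).PosSemidef := by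
    have : P * Q = Q ^ 2 + b • Q := by rw [hPQ, Matrix.add_mul, sq]; simp
    rw [this]
    exact (hQp.pow 2).add (hQp.smul hb)
  have hcomm : Commute P Q := by
    rw [hQ]; exact (Commute.refl P).sub_right ((Commute.one_right P).smul_right b)
  have h2 : P ^ (n + 1) - b • P ^ n = P ^ n * Q := by
    rw [hQ, Matrix.mul_sub, pow_succ]; simp
  rw [le_iff, h2]
  have hs : ∀ k, (P ^ k)ᴴ = P ^ k := fun k => (hP.pow k).isHermitian.eq
  rcases Nat.even_or_odd' n with ⟨k, rfl | rfl⟩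
  · have := hQp.conjTranspose_mul_mul_same (P ^ k)
    rw [hs, Matrix.mul_assoc, ← (hcomm.pow_left k).eq, ← Matrix.mul_assoc, ← pow_add] at this
    rwa [two_mul]
  · have := h1.conjTranspose_mul_mul_same (P ^ k)
    rw [hs, Matrix.mul_assoc, Matrix.mul_assoc, ← (hcomm.pow_left k).eq, ← Matrix.mul_assoc,
      ← Matrix.mul_assoc, ← pow_succ, ← pow_add] at this
    rwa [show k + 1 + k = 2 * k + 1 by ring] at this

/-- With Q = 2 - Y, the matrix 2(2Y - Y²) equals YQY + QYQ, a sum of two congruences of positive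
semidefinite matrices. -/
theorem mul_self_le_two_smul {Y : Matrix ι ι ℝ} (hY : Y.PosSemidef)
    (h : Y ≤ (2 : ℝ) • (1 : Matrix ι ι ℝ)) : Y * Y ≤ (2 : ℝ) • Y := by
  obtain ⟨Q, hQ⟩ : ∃ Q, Q = (2 : ℝ) • (1 : Matrix ι ι ℝ) - Y := ⟨_, rfl⟩
  have hQp : Q.PosSemidef := hQ ▸ le_iff.1 h
  have h1 := (hQp.conjTranspose_mul_mul_same Y).add (hY.conjTranspose_mul_mul_same Q)
  rw [hY.isHermitian.eq, hQp.isHermitian.eq] at h1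
  have h2 : Y * Q * Y + Q * Y * Q = (2 : ℝ) • ((2 : ℝ) • Y - Y * Y) := by
    rw [hQ]
    simp only [Matrix.mul_sub, Matrix.sub_mul, Matrix.mul_smul, Matrix.smul_mul, Matrix.mul_one,
      Matrix.one_mul, smul_sub]
    rw [two_smul ℝ (Y * Y)]
    abel
  rw [h2] at h1
  rw [le_iff]
  have := h1.smul (show (0 : ℝ) ≤ 1 / 2 by norm_num)
  rwa [smul_smul, show (1 / 2 : ℝ) * 2 = 1 by norm_num, one_smul] at this

/-- Along the segment Q = P + t a Y ≥ 1, so Tr Y²Qⁿ ≤ 2 Tr YQⁿ ≤ 2 Tr YQⁿ⁺¹; this is the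
differential inequality with c = 2a(n + 1). -/
theorem trace_add_smul_pow_le {P Y : Matrix ι ι ℝ} (hP : 1 ≤ P) (hY : Y.PosSemidef)
    (hY2 : Y ≤ (2 : ℝ) • (1 : Matrix ι ι ℝ)) {a : ℝ} (ha : 0 ≤ a) (n : ℕ) :
    trace ((P + a • Y) ^ (n + 2)) ≤ trace (P ^ (n + 2)) +
      (n + 2) * (Real.exp (2 * a * (n + 1)) * (a * trace (Y * P ^ (n + 1)))) := by
  have hPt : ∀ t ∈ Set.Icc (0 : ℝ) 1, 1 ≤ P + t • a • Y := fun t ht =>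
    le_add_of_le_of_nonneg hP (nonneg_iff_posSemidef.2 ((hY.smul ha).smul ht.1))
  have hPp : ∀ t ∈ Set.Icc (0 : ℝ) 1, (P + t • a • Y).PosSemidef := fun t ht =>
    nonneg_iff_posSemidef.1 (le_trans (nonneg_iff_posSemidef.2 PosSemidef.one) (hPt t ht))
  have := trace_add_pow_le (P := P) (Y := a • Y) (hY.smul ha).isHermitian n (2 * a * (n + 1))
    hPp fun t ht => ?_
  · simpa using this
  · set Q := P + t • a • Y
    have h1 : trace (Y * Y * Q ^ n) ≤ 2 * trace (Y * Q ^ n) := by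
      have := trace_mul_le ((hPp t ht).pow n) (mul_self_le_two_smul hY hY2)
      rw [trace_mul_comm, trace_mul_comm _ ((2 : ℝ) • Y)] at this
      simpa using this
    have h2 : trace (Y * Q ^ n) ≤ trace (Y * Q ^ (n + 1)) := by
      refine trace_mul_le hY ?_
      have := posSemidef_pow_mul_sub zero_le_one (hPp t ht) (by simpa using hPt t ht) n
      simpa using this
    simp only [Matrix.smul_mul, Matrix.mul_smul, trace_smul, smul_eq_mul]
    have : trace (Y * Y * Q ^ n) ≤ 2 * trace (Y * Q ^ (n + 1)) := by linarith
    have := mul_le_mul_of_nonneg_left this (show 0 ≤ (n + 1) * (a * a) by positivity)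
    linarith

/-- The same estimate for a decrement. Now only Q ≥ 1/2 holds along the segment, so lowering the
exponent costs another factor 2 and c = -4a(n + 1). -/
theorem trace_sub_smul_pow_le {P Y : Matrix ι ι ℝ} (hY : Y.PosSemidef)
    (hY2 : Y ≤ (2 : ℝ) • (1 : Matrix ι ι ℝ)) {a : ℝ} (ha : 0 ≤ a) (n : ℕ)
    (hP : (1 / 2 : ℝ) • (1 : Matrix ι ι ℝ) ≤ P - a • Y) :
    trace ((P - a • Y) ^ (n + 2)) ≤ trace (P ^ (n + 2)) -
      (n + 2) * (Real.exp (-(4 * a * (n + 1))) * (a * trace (Y * P ^ (n + 1)))) := by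
  have hPt : ∀ t ∈ Set.Icc (0 : ℝ) 1, (1 / 2 : ℝ) • (1 : Matrix ι ι ℝ) ≤ P + t • -(a • Y) :=
    fun t ht => by
      have h1 := nonneg_iff_posSemidef.2 ((hY.smul ha).smul (sub_nonneg.2 ht.2))
      have h2 := le_add_of_le_of_nonneg hP h1
      convert h2 using 1
      module
  have hPp : ∀ t ∈ Set.Icc (0 : ℝ) 1, (P + t • -(a • Y)).PosSemidef := fun t ht =>
    nonneg_iff_posSemidef.1 (le_trans (nonneg_iff_posSemidef.2
      (PosSemidef.one.smul (by norm_num))) (hPt t ht))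
  have := trace_add_pow_le (P := P) (Y := -(a • Y)) (hY.smul ha).isHermitian.neg n
    (-(4 * a * (n + 1))) hPp fun t ht => ?_
  · rw [← sub_eq_add_neg] at this
    refine this.trans_eq ?_
    simp only [Matrix.neg_mul, Matrix.smul_mul, trace_neg, trace_smul, smul_eq_mul]
    ring
  · have hQp := hPp t ht
    have hQt := hPt t ht
    generalize P + t • -(a • Y) = Q at hQp hQt ⊢
    have h1 : trace (Y * Y * Q ^ n) ≤ 2 * trace (Y * Q ^ n) := by
      have := trace_mul_le ((hQp).pow n) (mul_self_le_two_smul hY hY2)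
      rw [trace_mul_comm, trace_mul_comm _ ((2 : ℝ) • Y)] at this
      simpa using this
    have h2 : 1 / 2 * trace (Y * Q ^ n) ≤ trace (Y * Q ^ (n + 1)) := by
      have := trace_mul_le hY
        (posSemidef_pow_mul_sub (by norm_num) (hQp) hQt n)
      simpa using this
    simp only [Matrix.smul_mul, Matrix.mul_smul, Matrix.neg_mul, Matrix.mul_neg,
      trace_neg, trace_smul, smul_eq_mul]
    have : trace (Y * Y * Q ^ n) ≤ 4 * trace (Y * Q ^ (n + 1)) := by linarith
    have := mul_le_mul_of_nonneg_left this (show 0 ≤ (n + 1) * (a * a) by positivity)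
    linarith

end TracePower

end CayleySparsification

namespace CayleySparsification

open Matrix
open scoped MatrixOrder

/-! ### The potential argument for sums of whitened matrices -/

section Greedy

theorem exp_two_mul_le {x : ℝ} (h0 : 0 ≤ x) (h1 : x ≤ 1 / 10) : Real.exp (2 * x) ≤ 1 + 4 * x := by
  have h2 := Real.exp_bound_div_one_sub_of_interval (x := 2 * x) (by linarith) (by linarith)
  refine h2.trans ?_
  rw [div_le_iff₀ (by linarith)]
  nlinarith

/-- The left side is at most exp(ηR(1 + 5η)). On the right, log(1 + x) ≥ 2x / (x + 2) with x = ηR(1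
+ 6η) / q; the condition q ≥ 4R makes x ≤ 2η/5, so the loss to second order is covered by the
remaining ηR · η. -/
theorem mul_pow_le_one_add_pow {N η Z R : ℝ} {m q : ℕ} (hN : N ≤ Real.exp (η ^ 2 * R)) (hη : 0 < η)
    (hη1 : η ≤ 1 / 10) (hZ : 0 < Z) (hR : R = m / Z) (hR0 : 0 < R) (hq : 4 * R ≤ q) :
    N * (1 + η * (1 + 4 * η) / Z) ^ m ≤ (1 + η / q * (R * (1 + 6 * η))) ^ q := by
  have hq0 : (0 : ℝ) < q := by linarith
  have h1 : (1 + η * (1 + 4 * η) / Z) ^ m ≤ Real.exp (η * (1 + 4 * η) * R) := by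
    have : η * (1 + 4 * η) * R = m * (η * (1 + 4 * η) / Z) := by rw [hR]; ring
    rw [this, Real.exp_nat_mul]
    refine pow_le_pow_left₀ (by positivity) ?_ m
    rw [add_comm]; exact Real.add_one_le_exp _
  set x := η / q * (R * (1 + 6 * η)) with hx
  have hx0 : 0 < x := by positivity
  have hqx : q * x = η * R * (1 + 6 * η) := by rw [hx]; field_simp
  have hx1 : x ≤ 2 / 5 * η := by
    have h3 : q * x ≤ q * (2 / 5 * η) := by
      rw [hqx]
      have : R * (1 + 6 * η) ≤ R * (8 / 5) := by gcongr; linarith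
      nlinarith
    exact le_of_mul_le_mul_left h3 hq0
  have h2 : (1 + x) ^ q = Real.exp (q * Real.log (1 + x)) := by
    rw [Real.exp_nat_mul, Real.exp_log (by linarith)]
  have h4 := Real.le_log_one_add_of_nonneg hx0.le
  have h5 : η * R * (1 + 5 * η) ≤ q * (2 * x / (x + 2)) := by
    rw [mul_div_assoc', le_div_iff₀ (by linarith), mul_left_comm, hqx]
    have : (1 + 5 * η) * (x + 2) ≤ 2 * (1 + 6 * η) := by nlinarith
    have := mul_le_mul_of_nonneg_left this (show 0 ≤ η * R by positivity)
    linarith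
  calc N * (1 + η * (1 + 4 * η) / Z) ^ m
      ≤ Real.exp (η ^ 2 * R) * Real.exp (η * (1 + 4 * η) * R) := by
        gcongr
    _ = Real.exp (η * R * (1 + 5 * η)) := by rw [← Real.exp_add]; ring_nf
    _ ≤ _ := by
        rw [h2]
        exact Real.exp_le_exp.2 (h5.trans (mul_le_mul_of_nonneg_left h4 hq0.le))

/-- The lower counterpart: the left side is at most exp(-ηR(1 - 5η)), and log(1 - x) ≥ 1 - 1/(1 - x)
with x ≤ η/4 turns 1 - 8η into at most 1 - 5η. -/
theorem mul_pow_le_one_sub_pow {N η Z R : ℝ} {m q : ℕ} (hN : N ≤ Real.exp (η ^ 2 * R)) (hη : 0 < η)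
    (hη1 : η ≤ 1 / 10) (hZ : 1 ≤ Z) (hR : R = m / Z) (hR0 : 0 < R) (hq : 4 * R ≤ q) :
    N * (1 - η * (1 - 4 * η) / Z) ^ m ≤ (1 - η / q * (R * (1 - 8 * η))) ^ q := by
  have hq0 : (0 : ℝ) < q := by linarith
  have hV : 0 ≤ 1 - η * (1 - 4 * η) / Z := by
    rw [sub_nonneg, div_le_one (by linarith)]
    nlinarith
  have h1 : (1 - η * (1 - 4 * η) / Z) ^ m ≤ Real.exp (-(η * (1 - 4 * η) * R)) := by
    have : -(η * (1 - 4 * η) * R) = m * (-(η * (1 - 4 * η) / Z)) := by rw [hR]; ring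
    rw [this, Real.exp_nat_mul]
    refine pow_le_pow_left₀ hV ?_ m
    have := Real.add_one_le_exp (-(η * (1 - 4 * η) / Z))
    linarith
  set x := η / q * (R * (1 - 8 * η)) with hx
  have hx0 : 0 < x := by
    have : 0 < 1 - 8 * η := by linarith
    positivity
  have hqx : q * x = η * R * (1 - 8 * η) := by rw [hx]; field_simp
  have hx1 : x ≤ 1 / 4 * η := by
    have h3 : q * x ≤ q * (1 / 4 * η) := by
      rw [hqx]
      have : R * (1 - 8 * η) ≤ R := mul_le_of_le_one_right hR0.le (by linarith)
      nlinarith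
    exact le_of_mul_le_mul_left h3 hq0
  have hy : 0 < 1 - x := by linarith
  have h2 : (1 - x) ^ q = Real.exp (q * Real.log (1 - x)) := by
    rw [Real.exp_nat_mul, Real.exp_log hy]
  have h4 := Real.one_sub_inv_le_log_of_pos hy
  have h5 : -(η * R * (1 - 5 * η)) ≤ q * (1 - (1 - x)⁻¹) := by
    have : q * (1 - (1 - x)⁻¹) = -(q * x / (1 - x)) := by field_simp; ring
    rw [this, neg_le_neg_iff, div_le_iff₀ hy, hqx]
    have : (1 - 8 * η) ≤ (1 - 5 * η) * (1 - x) := by nlinarith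
    have := mul_le_mul_of_nonneg_left this (show 0 ≤ η * R by positivity)
    linarith
  calc N * (1 - η * (1 - 4 * η) / Z) ^ m
      ≤ Real.exp (η ^ 2 * R) * Real.exp (-(η * (1 - 4 * η) * R)) := by
        gcongr
    _ = Real.exp (-(η * R * (1 - 5 * η))) := by rw [← Real.exp_add]; ring_nf
    _ ≤ _ := by
        rw [h2]
        exact Real.exp_le_exp.2 (h5.trans (mul_le_mul_of_nonneg_left h4 hq0.le))

variable {ι G : Type*} [Fintype ι] [DecidableEq ι] [Fintype G]

theorem trace_pow_le_trace_pow_succ {P : Matrix ι ι ℝ} (hP : 1 ≤ P) (n : ℕ) :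
    trace (P ^ n) ≤ trace (P ^ (n + 1)) := by
  have h0 : P.PosSemidef := nonneg_iff_posSemidef.1
    (le_trans (nonneg_iff_posSemidef.2 PosSemidef.one) hP)
  have := trace_mul_nonneg (h0.pow n) (le_iff.1 hP)
  rw [Matrix.mul_sub, Matrix.mul_one, trace_sub, ← pow_succ] at this
  linarith

theorem trace_pow_succ_le_trace_pow {P : Matrix ι ι ℝ} (h0 : P.PosSemidef) (hP : P ≤ 1) (n : ℕ) :
    trace (P ^ (n + 1)) ≤ trace (P ^ n) := by
  have := trace_mul_nonneg (h0.pow n) (le_iff.1 hP)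
  rw [Matrix.mul_sub, Matrix.mul_one, trace_sub, ← pow_succ] at this
  linarith

theorem sum_mul_trace_mul {Y : G → Matrix ι ι ℝ} {k : G → ℝ} (h : ∑ s, k s • Y s = 1)
    (Q : Matrix ι ι ℝ) : ∑ s, k s * trace (Y s * Q) = trace Q := by
  have : ∑ s, k s * trace (Y s * Q) = trace ((∑ s, k s • Y s) * Q) := by
    rw [Finset.sum_mul, trace_sum]
    simp
  rw [this, h, Matrix.one_mul]

/-- One averaged step of the upper half. The first order terms add up to Tr P^(n+1) because ∑ k_s
Y_s = 1, and this is at most Tr P^(n+2) because P ≥ 1. The factor 1 + 4η bounds exp(2η), as a(n + 2)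
= η. -/
theorem sum_trace_one_add_pow_le {Y : G → Matrix ι ι ℝ} {k : G → ℝ} (hk : ∀ s, 0 ≤ k s)
    (hY : ∀ s, (Y s).PosSemidef) (hY2 : ∀ s, Y s ≤ (2 : ℝ) • (1 : Matrix ι ι ℝ))
    (hs : ∑ s, k s • Y s = 1) (hZ : 0 < ∑ s, k s) {X : Matrix ι ι ℝ} (hX : X.PosSemidef) {η : ℝ}
    (hη : 0 < η) (hη1 : η ≤ 1 / 10) (n : ℕ) :
    ∑ s, k s * trace ((1 + (η / (n + 2 : ℕ)) • (X + Y s)) ^ (n + 2)) ≤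
      (∑ s, k s) * ((1 + η * (1 + 4 * η) / ∑ s, k s) *
        trace ((1 + (η / (n + 2 : ℕ)) • X) ^ (n + 2))) := by
  set a := η / (n + 2 : ℕ) with ha
  have ha0 : 0 < a := by positivity
  have haq : (n + 2) * a = η := by rw [ha]; push_cast; field_simp
  set P := 1 + a • X with hP
  have hP1 : 1 ≤ P := le_add_of_nonneg_right (nonneg_iff_posSemidef.2 (hX.smul ha0.le))
  have he : Real.exp (2 * a * (n + 1)) ≤ 1 + 4 * η := by
    refine le_trans (Real.exp_le_exp.2 ?_) (exp_two_mul_le hη.le hη1)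
    nlinarith
  have h1 : ∀ s, trace ((1 + a • (X + Y s)) ^ (n + 2)) ≤
      trace (P ^ (n + 2)) + η * (1 + 4 * η) * trace (Y s * P ^ (n + 1)) := fun s => by
    have h2 := trace_add_smul_pow_le hP1 (hY s) (hY2 s) ha0.le n
    have h3 : 0 ≤ trace (Y s * P ^ (n + 1)) := trace_mul_nonneg (hY s)
      ((nonneg_iff_posSemidef.1 (le_trans (nonneg_iff_posSemidef.2 PosSemidef.one) hP1)).pow _)
    rw [smul_add, ← add_assoc]
    refine h2.trans ?_
    have : (n + 2) * (Real.exp (2 * a * (n + 1)) * (a * trace (Y s * P ^ (n + 1)))) =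
        η * Real.exp (2 * a * (n + 1)) * trace (Y s * P ^ (n + 1)) := by rw [← haq]; ring
    rw [this]
    gcongr
  calc _ ≤ ∑ s, k s * (trace (P ^ (n + 2)) + η * (1 + 4 * η) * trace (Y s * P ^ (n + 1))) :=
        Finset.sum_le_sum fun s _ => mul_le_mul_of_nonneg_left (h1 s) (hk s)
    _ = (∑ s, k s) * trace (P ^ (n + 2)) + η * (1 + 4 * η) * trace (P ^ (n + 1)) := by
        rw [← sum_mul_trace_mul hs (P ^ (n + 1)), Finset.sum_mul, Finset.mul_sum, ← Finset.sum_add_distrib]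
        exact Finset.sum_congr rfl fun s _ => by ring
    _ ≤ (∑ s, k s) * trace (P ^ (n + 2)) + η * (1 + 4 * η) * trace (P ^ (n + 2)) := by
        have := trace_pow_le_trace_pow_succ hP1 (n + 1)
        gcongr
    _ = _ := by field_simp

/-- One averaged step of the lower half. Here P ≤ 1, so Tr P^(n+1) is at least Tr P^(n+2), the
direction needed for a decrease. -/
theorem sum_trace_one_sub_pow_le {Y : G → Matrix ι ι ℝ} {k : G → ℝ} (hk : ∀ s, 0 ≤ k s)
    (hY : ∀ s, (Y s).PosSemidef) (hY2 : ∀ s, Y s ≤ (2 : ℝ) • (1 : Matrix ι ι ℝ))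
    (hs : ∑ s, k s • Y s = 1) (hZ : 0 < ∑ s, k s) {X : Matrix ι ι ℝ} (hX : X.PosSemidef) {η : ℝ}
    (hη : 0 < η) (hη1 : η ≤ 1 / 10) (n : ℕ)
    (hXY : ∀ s, (1 / 2 : ℝ) • (1 : Matrix ι ι ℝ) ≤ 1 - (η / (n + 2 : ℕ)) • (X + Y s))
    (hXP : (1 - (η / (n + 2 : ℕ)) • X).PosSemidef) :
    ∑ s, k s * trace ((1 - (η / (n + 2 : ℕ)) • (X + Y s)) ^ (n + 2)) ≤
      (∑ s, k s) * ((1 - η * (1 - 4 * η) / ∑ s, k s) *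
        trace ((1 - (η / (n + 2 : ℕ)) • X) ^ (n + 2))) := by
  set a := η / (n + 2 : ℕ) with ha
  have ha0 : 0 < a := by positivity
  have haq : (n + 2) * a = η := by rw [ha]; push_cast; field_simp
  set P := 1 - a • X with hP
  have hP1 : P ≤ 1 := sub_le_self _ (nonneg_iff_posSemidef.2 (hX.smul ha0.le))
  have he : 1 - 4 * η ≤ Real.exp (-(4 * a * (n + 1))) := by
    have := Real.add_one_le_exp (-(4 * a * (n + 1)))
    nlinarith
  have h1 : ∀ s, trace ((1 - a • (X + Y s)) ^ (n + 2)) ≤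
      trace (P ^ (n + 2)) - η * (1 - 4 * η) * trace (Y s * P ^ (n + 1)) := fun s => by
    have hXs := hXY s
    rw [smul_add, ← sub_sub] at hXs ⊢
    have h2 := trace_sub_smul_pow_le (hY s) (hY2 s) ha0.le n hXs
    have h3 : 0 ≤ trace (Y s * P ^ (n + 1)) := trace_mul_nonneg (hY s) (hXP.pow _)
    refine h2.trans ?_
    have : (n + 2) * (Real.exp (-(4 * a * (n + 1))) * (a * trace (Y s * P ^ (n + 1)))) =
        η * Real.exp (-(4 * a * (n + 1))) * trace (Y s * P ^ (n + 1)) := by rw [← haq]; ring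
    rw [this]
    gcongr
  calc _ ≤ ∑ s, k s * (trace (P ^ (n + 2)) - η * (1 - 4 * η) * trace (Y s * P ^ (n + 1))) :=
        Finset.sum_le_sum fun s _ => mul_le_mul_of_nonneg_left (h1 s) (hk s)
    _ = (∑ s, k s) * trace (P ^ (n + 2)) - η * (1 - 4 * η) * trace (P ^ (n + 1)) := by
        rw [← sum_mul_trace_mul hs (P ^ (n + 1)), Finset.sum_mul, Finset.mul_sum, ← Finset.sum_sub_distrib]
        exact Finset.sum_congr rfl fun s _ => by ring
    _ ≤ (∑ s, k s) * trace (P ^ (n + 2)) - η * (1 - 4 * η) * trace (P ^ (n + 2)) := by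
        have := trace_pow_succ_le_trace_pow hXP hP1 (n + 1)
        have h2 : 0 ≤ η * (1 - 4 * η) := mul_nonneg hη.le (by linarith)
        gcongr
    _ = _ := by field_simp

/-- The potential of the greedy algorithm after `t` steps. -/
noncomputable def potential (q : ℕ) (η Z : ℝ) (t : ℕ) (X : Matrix ι ι ℝ) : ℝ :=
  trace ((1 + (η / q) • X) ^ q) / (1 + η * (1 + 4 * η) / Z) ^ t +
    trace ((1 - (η / q) • X) ^ q) / (1 - η * (1 - 4 * η) / Z) ^ t

/-- The relations between the parameters of the greedy algorithm: exponent `q`, accuracy `η`,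
sum of importances `Z`, number of steps `m`. -/
structure GreedyParams (N : ℝ) (q : ℕ) (η Z : ℝ) (m : ℕ) : Prop where
  eta_pos : 0 < η
  eta_le : η ≤ 1 / 10
  one_le : 1 ≤ Z
  le_exp : N ≤ Real.exp (η ^ 2 * (m / Z))
  pos : 0 < (m : ℝ) / Z
  le_q : 4 * ((m : ℝ) / Z) + 4 ≤ q

namespace GreedyParams

variable {N : ℝ} {q : ℕ} {η Z : ℝ} {m : ℕ}

theorem q_pos (h : GreedyParams N q η Z m) : (0 : ℝ) < q := by linarith [h.le_q, h.pos]

theorem a_pos (h : GreedyParams N q η Z m) : 0 < η / q := div_pos h.eta_pos h.q_pos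

theorem one_le_up (h : GreedyParams N q η Z m) : 1 ≤ 1 + η * (1 + 4 * η) / Z := by
  have h1 := h.eta_pos
  have h2 := h.one_le
  have : 0 ≤ η * (1 + 4 * η) / Z := by positivity
  linarith

theorem lo_pos (h : GreedyParams N q η Z m) : 0 < 1 - η * (1 - 4 * η) / Z := by
  have h1 := h.eta_pos
  have h2 := h.one_le
  have h3 := h.eta_le
  rw [sub_pos, div_lt_one (by linarith)]
  nlinarith

/-- The bound for time m holds at every earlier time because U ≥ 1. It is needed along the way, to
keep 1 - aX positive. -/
theorem le_of_trace_le (h : GreedyParams N q η Z m) {t : ℕ} (ht : t ≤ m) (hN : 0 ≤ N)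
    {X : Matrix ι ι ℝ} (hX : X.PosSemidef)
    (hup : trace ((1 + (η / q) • X) ^ q) / (1 + η * (1 + 4 * η) / Z) ^ t ≤ N) :
    X ≤ ((m : ℝ) / Z * (1 + 6 * η)) • (1 : Matrix ι ι ℝ) := by
  have hη := h.eta_pos
  have hR := h.pos
  have ha := h.a_pos
  have hU := h.one_le_up
  have h1 := mul_pow_le_one_add_pow h.le_exp hη h.eta_le (by linarith [h.one_le]) rfl hR
    (by linarith [h.le_q])
  rw [div_le_iff₀ (by positivity)] at hup
  have h2 := le_smul_one_of_trace_pow_le (P := 1 + (η / q) • X)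
    (PosSemidef.one.add (hX.smul ha.le)) (q := q) (by exact_mod_cast h.q_pos.ne')
    (c := 1 + η / q * ((m : ℝ) / Z * (1 + 6 * η))) (by positivity)
    (hup.trans (le_trans (mul_le_mul_of_nonneg_left (pow_le_pow_right₀ hU ht) hN) h1))
  rw [add_smul, one_smul, mul_smul] at h2
  have h3 := le_of_add_le_add_left h2
  exact le_of_smul_le_smul_left h3 ha

/-- The lower bound is needed at the final time only. A large trace power of 1 - aX would be forced
by a small eigenvalue of X. -/
theorem ge_of_trace_le (h : GreedyParams N q η Z m) {X : Matrix ι ι ℝ}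
    (hX : (1 - (η / q) • X).PosSemidef)
    (hlo : trace ((1 - (η / q) • X) ^ q) / (1 - η * (1 - 4 * η) / Z) ^ m ≤ N) :
    ((m : ℝ) / Z * (1 - 8 * η)) • (1 : Matrix ι ι ℝ) ≤ X := by
  have hη := h.eta_pos
  have hR := h.pos
  have ha := h.a_pos
  have hV := h.lo_pos
  have h1 := mul_pow_le_one_sub_pow h.le_exp hη h.eta_le h.one_le rfl hR
    (by linarith [h.le_q])
  rw [div_le_iff₀ (by positivity)] at hlo
  have hc : 0 ≤ 1 - η / q * ((m : ℝ) / Z * (1 - 8 * η)) := by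
    have h3 : (m : ℝ) / Z * (1 - 8 * η) ≤ q := by nlinarith [h.le_q]
    have h4 : η / q * ((m : ℝ) / Z * (1 - 8 * η)) ≤ η / q * q :=
      mul_le_mul_of_nonneg_left h3 ha.le
    rw [div_mul_cancel₀ _ h.q_pos.ne'] at h4
    linarith [h.eta_le]
  have h2 := le_smul_one_of_trace_pow_le (P := 1 - (η / q) • X) hX (q := q)
    (by exact_mod_cast h.q_pos.ne') hc (hlo.trans h1)
  rw [sub_smul, one_smul, mul_smul] at h2
  have h3 := (sub_le_sub_iff_left 1).1 h2
  exact le_of_smul_le_smul_left h3 ha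

/-- Since X ≤ 1.6 m / Z and Y ≤ 2, the condition 4m / Z + 4 ≤ q gives X + Y ≤ q / 2, hence a(X + Y)
≤ η / 2. The summand 4 in that condition is the room for one more Y. -/
theorem half_le (h : GreedyParams N q η Z m) {X Y : Matrix ι ι ℝ}
    (hX : X ≤ ((m : ℝ) / Z * (1 + 6 * η)) • (1 : Matrix ι ι ℝ))
    (hY : Y ≤ (2 : ℝ) • (1 : Matrix ι ι ℝ)) :
    (1 / 2 : ℝ) • (1 : Matrix ι ι ℝ) ≤ 1 - (η / q) • (X + Y) := by
  have ha := h.a_pos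
  have hη := h.eta_le
  have hη0 := h.eta_pos
  have hR := h.pos
  have h1 : X + Y ≤ (q / 2 : ℝ) • (1 : Matrix ι ι ℝ) := by
    refine (add_le_add hX hY).trans ?_
    rw [← add_smul]
    refine smul_le_smul_of_nonneg_right ?_ (nonneg_iff_posSemidef.2 PosSemidef.one)
    nlinarith [h.le_q]
  have h2 : (η / q) • (X + Y) ≤ (1 / 2 : ℝ) • (1 : Matrix ι ι ℝ) := by
    refine (smul_le_smul_of_nonneg_left h1 ha.le).trans ?_
    rw [smul_smul]
    refine smul_le_smul_of_nonneg_right ?_ (nonneg_iff_posSemidef.2 PosSemidef.one)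
    have := h.q_pos
    field_simp
    linarith
  have h3 : (1 / 2 : ℝ) • (1 : Matrix ι ι ℝ) = 1 - (1 / 2 : ℝ) • (1 : Matrix ι ι ℝ) := by
    module
  rw [h3]
  exact sub_le_sub_left h2 1

/-- Both halves of the potential are bounded by the potential. -/
theorem bounds_of_potential_le (h : GreedyParams N q η Z m) {t : ℕ} (ht : t ≤ m)
    {X : Matrix ι ι ℝ} (hX : X.PosSemidef) (hX2 : (1 - (η / q) • X).PosSemidef)
    (hp : potential q η Z t X ≤ N) :
    X ≤ ((m : ℝ) / Z * (1 + 6 * η)) • (1 : Matrix ι ι ℝ) ∧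
      trace ((1 - (η / q) • X) ^ q) / (1 - η * (1 - 4 * η) / Z) ^ t ≤ N := by
  have h1 : 0 ≤ trace ((1 + (η / q) • X) ^ q) / (1 + η * (1 + 4 * η) / Z) ^ t :=
    div_nonneg (((PosSemidef.one.add (hX.smul h.a_pos.le)).pow q).trace_nonneg)
      (pow_nonneg (by linarith [h.one_le_up]) _)
  have h2 : 0 ≤ trace ((1 - (η / q) • X) ^ q) / (1 - η * (1 - 4 * η) / Z) ^ t :=
    div_nonneg ((hX2.pow q).trace_nonneg) (pow_nonneg h.lo_pos.le _)
  unfold potential at hp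
  refine ⟨h.le_of_trace_le ht (by linarith) hX (by linarith), by linarith⟩

/-- Some step of the greedy algorithm does not increase the potential. -/
theorem exists_potential_le (h : GreedyParams N q η Z m) {Y : G → Matrix ι ι ℝ} {k : G → ℝ}
    (hk : ∀ s, 0 ≤ k s) (hY : ∀ s, (Y s).PosSemidef)
    (hY2 : ∀ s, Y s ≤ (2 : ℝ) • (1 : Matrix ι ι ℝ)) (hs : ∑ s, k s • Y s = 1)
    (hZ : ∑ s, k s = Z) {t : ℕ} (ht : t ≤ m)
    {X : Matrix ι ι ℝ} (hX : X.PosSemidef) (hX2 : (1 - (η / q) • X).PosSemidef)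
    (hp : potential q η Z t X ≤ N) :
    ∃ s, potential q η Z (t + 1) (X + Y s) ≤ N := by
  obtain ⟨n, rfl⟩ : ∃ n, q = n + 2 := ⟨q - 2, by
    have : (2 : ℝ) ≤ q := by linarith [h.le_q, h.pos]
    have : 2 ≤ q := by exact_mod_cast this
    omega⟩
  have hZ0 : 0 < Z := by linarith [h.one_le]
  have hb := (h.bounds_of_potential_le ht hX hX2 hp).1
  have h1 := sum_trace_one_add_pow_le hk hY hY2 hs (hZ ▸ hZ0) hX h.eta_pos h.eta_le n
  have h2 := sum_trace_one_sub_pow_le hk hY hY2 hs (hZ ▸ hZ0) hX h.eta_pos h.eta_le n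
    (fun s => h.half_le hb (hY2 s)) hX2
  rw [hZ] at h1 h2
  have hU : 0 < 1 + η * (1 + 4 * η) / Z := by linarith [h.one_le_up]
  have hV := h.lo_pos
  by_contra! hc
  -- If all candidates exceeded N, so would their weighted average, contradicting the two averaged
  -- estimates.
  have h3 : Z * N < ∑ s, k s * potential (n + 2) η Z (t + 1) (X + Y s) := by
    have h4 : ∃ s, 0 < k s := by
      by_contra! h5
      have : ∑ s, k s ≤ 0 := Finset.sum_nonpos fun s _ => h5 s
      linarith
    obtain ⟨s, hs0⟩ := h4
    nth_rewrite 1 [← hZ]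
    rw [Finset.sum_mul]
    exact Finset.sum_lt_sum (fun s _ => mul_le_mul_of_nonneg_left (hc s).le (hk s))
      ⟨s, Finset.mem_univ s, mul_lt_mul_of_pos_left (hc s) hs0⟩
  have h4 : ∑ s, k s * potential (n + 2) η Z (t + 1) (X + Y s) ≤
      Z * potential (n + 2) η Z t X := by
    unfold potential
    simp only [mul_add, Finset.sum_add_distrib, ← mul_div_assoc, ← Finset.sum_div]
    simp only [mul_add] at h1 h2 hU hV
    generalize 1 + (η * 1 + η * (4 * η)) / Z = U at h1 hU ⊢
    generalize 1 - η * (1 - 4 * η) / Z = V at h2 hV ⊢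
    have e : ∀ W A B : ℝ, 0 < W → A ≤ Z * (W * B) → A / W ^ (t + 1) ≤ Z * B / W ^ t :=
      fun W A B hW hAB => by
        rw [div_le_div_iff₀ (by positivity) (by positivity), pow_succ]
        refine (mul_le_mul_of_nonneg_right hAB (by positivity)).trans_eq ?_
        ring
    exact add_le_add (e _ _ _ hU h1) (e _ _ _ hV h2)
  have := mul_le_mul_of_nonneg_left hp hZ0.le
  linarith

end GreedyParams

end Greedy

end CayleySparsification

namespace CayleySparsification

open Matrix
open scoped MatrixOrder

/-! ### Covering generators by quotients of short products -/

section Words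

variable {G : Type*} [Group G] [Fintype G] [DecidableEq G]

/-- The vector `x - R(s)ᵀ x`. -/
noncomputable def shiftDiff (s : G) (x : G → ℝ) : EuclideanSpace ℝ G :=
  WithLp.toLp 2 fun g => x g - x (g * s)

theorem norm_shiftDiff_sq (s : G) (x : G → ℝ) :
    ‖shiftDiff s x‖ ^ 2 = ∑ g, (x g - x (g * s)) ^ 2 := by
  simp [EuclideanSpace.norm_sq_eq, shiftDiff]

/-- Turns Loewner inequalities between Laplacians into inequalities between the squared norms of
`shiftDiff`, which behave like a length on the group. -/
theorem dotProduct_generatorLaplacian_mulVec (s : G) (x : G → ℝ) :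
    x ⬝ᵥ generatorLaplacian s *ᵥ x = ‖shiftDiff s x‖ ^ 2 / 2 := by
  have h1 : ∀ h : G, (rightRegular s *ᵥ x) h = x (h * s⁻¹) := fun h => by
    simp only [mulVec, dotProduct, rightRegular, of_apply, ite_mul, one_mul, zero_mul]
    have : ∀ g, (h = g * s) ↔ (h * s⁻¹ = g) := fun g => by rw [mul_inv_eq_iff_eq_mul]
    simp [this]
  have h2 : ∀ h : G, ((rightRegular s)ᵀ *ᵥ x) h = x (h * s) := fun h => by
    simp [mulVec, dotProduct, rightRegular]
  have h3 : ∑ h, x h * x (h * s⁻¹) = ∑ h, x h * x (h * s) := by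
    rw [← Equiv.sum_comp (Equiv.mulRight s)]
    exact Finset.sum_congr rfl fun h _ => by simp [mul_comm]
  have h4 : ∑ h, x (h * s) ^ 2 = ∑ h, x h ^ 2 :=
    Equiv.sum_comp (Equiv.mulRight s) fun h => x h ^ 2
  have h5 : ∑ g, (x g - x (g * s)) ^ 2 = 2 * (∑ h, x h ^ 2 - ∑ h, x h * x (h * s)) := by
    have : ∀ g, (x g - x (g * s)) ^ 2 = x g ^ 2 + x (g * s) ^ 2 - 2 * (x g * x (g * s)) :=
      fun g => by ring
    simp only [this, Finset.sum_sub_distrib, Finset.sum_add_distrib, h4, ← Finset.mul_sum]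
    ring
  rw [norm_shiftDiff_sq, h5]
  have h6 : ∀ h, (generatorLaplacian s *ᵥ x) h =
      x h - (1 / 2) * (x (h * s⁻¹) + x (h * s)) := fun h => by
    simp only [generatorLaplacian, sub_mulVec, one_mulVec, smul_mulVec, add_mulVec, Pi.sub_apply,
      Pi.smul_apply, Pi.add_apply, h1, h2, smul_eq_mul]
  simp only [dotProduct, h6]
  have : ∀ h, x h * (x h - (1 / 2) * (x (h * s⁻¹) + x (h * s))) =
      x h ^ 2 - 1 / 2 * (x h * x (h * s⁻¹)) - 1 / 2 * (x h * x (h * s)) := fun h => by ring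
  simp only [this, Finset.sum_sub_distrib, ← Finset.mul_sum, h3]
  ring

theorem norm_shift (p : G) (y : G → ℝ) :
    ‖(WithLp.toLp 2 fun g => y (g * p) : EuclideanSpace ℝ G)‖ =
      ‖(WithLp.toLp 2 y : EuclideanSpace ℝ G)‖ := by
  rw [EuclideanSpace.norm_eq, EuclideanSpace.norm_eq]
  congr 1
  exact Equiv.sum_comp (Equiv.mulRight p) fun g => ‖y g‖ ^ 2

/-- The difference along p q is the difference along p plus a translate by p of the difference along
q, and translations are isometries. -/
theorem norm_shiftDiff_mul_le (p q : G) (x : G → ℝ) :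
    ‖shiftDiff (p * q) x‖ ≤ ‖shiftDiff p x‖ + ‖shiftDiff q x‖ := by
  have h1 : shiftDiff (p * q) x = shiftDiff p x +
      (WithLp.toLp 2 fun g => (fun h => x h - x (h * q)) (g * p) : EuclideanSpace ℝ G) := by
    ext g; simp [shiftDiff, mul_assoc]
  rw [h1]
  exact (norm_add_le _ _).trans_eq (by rw [norm_shift p fun h => x h - x (h * q)]; rfl)

theorem norm_shiftDiff_inv (p : G) (x : G → ℝ) : ‖shiftDiff p⁻¹ x‖ = ‖shiftDiff p x‖ := by
  have h1 : shiftDiff p x =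
      -(WithLp.toLp 2 fun g => (fun h => x h - x (h * p⁻¹)) (g * p) : EuclideanSpace ℝ G) := by
    ext g; simp [shiftDiff]
  rw [h1, norm_neg, norm_shift p fun h => x h - x (h * p⁻¹)]; rfl

/-- The products of the sublists of a list. -/
def subproducts : List G → Finset G
  | [] => {1}
  | s :: l => subproducts l ∪ (subproducts l).image (s * ·)

theorem norm_shiftDiff_le_sum {l : List G} {p : G} (hp : p ∈ subproducts l) (x : G → ℝ) :
    ‖shiftDiff p x‖ ≤ (l.map fun s => ‖shiftDiff s x‖).sum := by
  induction l generalizing p with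
  | nil =>
    simp only [subproducts, Finset.mem_singleton] at hp
    subst hp
    have : shiftDiff (1 : G) x = 0 := by ext g; simp [shiftDiff]
    simp [this]
  | cons s l ih =>
    simp only [subproducts, Finset.mem_union, Finset.mem_image] at hp
    simp only [List.map_cons, List.sum_cons]
    rcases hp with hp | ⟨q, hq, rfl⟩
    · exact (ih hp).trans (le_add_of_nonneg_left (norm_nonneg _))
    · exact (norm_shiftDiff_mul_le s q x).trans (add_le_add_right (ih hq) _)

theorem one_mem_subproducts (l : List G) : (1 : G) ∈ subproducts l := by
  induction l with
  | nil => simp [subproducts]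
  | cons s l ih => simp [subproducts, ih]

/-- Every set `B` of group elements contains a list with pairwise distinct subproducts whose
quotients cover `B`. -/
theorem exists_covering_list (B : Finset G) :
    ∃ l : List G, l.Nodup ∧ l.toFinset ⊆ B ∧ (subproducts l).card = 2 ^ l.length ∧
      ∀ s ∈ B, ∃ p ∈ subproducts l, ∃ q ∈ subproducts l, s = p * q⁻¹ := by
  induction B using Finset.induction_on with
  | empty => exact ⟨[], by simp [subproducts]⟩
  | insert a B ha ih =>
    obtain ⟨l, h1, h2, h3, h4⟩ := ih
    -- Either a is already a quotient of two subproducts, or the subproducts of l and their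
    -- translates by a are disjoint, so prepending a doubles their number.
    by_cases h : ∃ p ∈ subproducts l, ∃ q ∈ subproducts l, a = p * q⁻¹
    · refine ⟨l, h1, h2.trans (Finset.subset_insert a B), h3, fun s hs => ?_⟩
      rcases Finset.mem_insert.1 hs with rfl | hs
      · exact h
      · exact h4 s hs
    · have hal : a ∉ l := fun hal => ha (h2 (by simpa using hal))
      refine ⟨a :: l, List.nodup_cons.2 ⟨hal, h1⟩, ?_, ?_, ?_⟩
      · rw [List.toFinset_cons]
        exact Finset.insert_subset_insert a h2
      · have hd : Disjoint (subproducts l) ((subproducts l).image (a * ·)) := by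
          rw [Finset.disjoint_left]
          intro p hp hp'
          obtain ⟨q, hq, rfl⟩ := Finset.mem_image.1 hp'
          exact h ⟨_, hp, q, hq, by simp⟩
        rw [subproducts, Finset.card_union_of_disjoint hd,
          Finset.card_image_of_injective _ (mul_right_injective a), h3, List.length_cons]
        ring
      · intro s hs
        rcases Finset.mem_insert.1 hs with rfl | hs
        · refine ⟨s, ?_, 1, one_mem_subproducts _, by simp⟩
          simp only [subproducts, Finset.mem_union, Finset.mem_image]
          exact Or.inr ⟨1, one_mem_subproducts _, by simp⟩
        · obtain ⟨p, hp, q, hq, h5⟩ := h4 s hs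
          exact ⟨p, Finset.mem_union_left _ hp, q, Finset.mem_union_left _ hq, h5⟩

/-- Every set `B` of group elements has a subset `T` of logarithmic size that dominates it. -/
theorem exists_dominating_subset (B : Finset G) :
    ∃ T ⊆ B, T.card ≤ Nat.log 2 (Fintype.card G) ∧ ∀ s ∈ B, ∀ x : G → ℝ,
      ‖shiftDiff s x‖ ^ 2 ≤
        4 * Nat.log 2 (Fintype.card G) * ∑ t ∈ T, ‖shiftDiff t x‖ ^ 2 := by
  obtain ⟨l, h1, h2, h3, h4⟩ := exists_covering_list B
  -- The 2 ^ length distinct subproducts all lie in G.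
  have hc : l.toFinset.card ≤ Nat.log 2 (Fintype.card G) := by
    rw [List.toFinset_card_of_nodup h1]
    refine Nat.le_log_of_pow_le (by norm_num) ?_
    rw [← h3]
    exact Finset.card_le_univ _
  refine ⟨l.toFinset, h2, hc, fun s hs x => ?_⟩
  obtain ⟨p, hp, q, hq, rfl⟩ := h4 s hs
  have h5 := norm_shiftDiff_mul_le p q⁻¹ x
  rw [norm_shiftDiff_inv] at h5
  have h6 := norm_shiftDiff_le_sum hp x
  have h7 := norm_shiftDiff_le_sum hq x
  rw [← List.sum_toFinset _ h1] at h6 h7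
  have h8 : ‖shiftDiff (p * q⁻¹) x‖ ≤ 2 * ∑ t ∈ l.toFinset, ‖shiftDiff t x‖ := by linarith
  calc ‖shiftDiff (p * q⁻¹) x‖ ^ 2 ≤ (2 * ∑ t ∈ l.toFinset, ‖shiftDiff t x‖) ^ 2 :=
        pow_le_pow_left₀ (norm_nonneg _) h8 2
    _ = 4 * (∑ t ∈ l.toFinset, ‖shiftDiff t x‖) ^ 2 := by ring
    _ ≤ 4 * (l.toFinset.card * ∑ t ∈ l.toFinset, ‖shiftDiff t x‖ ^ 2) := by
        gcongr; exact sq_sum_le_card_mul_sum_sq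
    _ ≤ 4 * (Nat.log 2 (Fintype.card G) * ∑ t ∈ l.toFinset, ‖shiftDiff t x‖ ^ 2) := by
        gcongr
    _ = _ := by ring

/-- Remove a dominating subset M times. An element that survives is dominated by each of the M
disjoint layers, and adding these inequalities gains the factor M. -/
theorem exists_layers (B : Finset G) (M : ℕ) :
    ∃ R ⊆ B, R.card ≤ M * Nat.log 2 (Fintype.card G) ∧ ∀ s ∈ B, s ∉ R → ∀ x : G → ℝ,
      M * ‖shiftDiff s x‖ ^ 2 ≤
        4 * Nat.log 2 (Fintype.card G) * ∑ t ∈ R, ‖shiftDiff t x‖ ^ 2 := by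
  induction M with
  | zero => exact ⟨∅, by simp⟩
  | succ M ih =>
    obtain ⟨R, h1, h2, h3⟩ := ih
    obtain ⟨T, h4, h5, h6⟩ := exists_dominating_subset (B \ R)
    have hd : Disjoint R T := by
      rw [Finset.disjoint_left]
      exact fun a ha ha' => (Finset.mem_sdiff.1 (h4 ha')).2 ha
    refine ⟨R ∪ T, Finset.union_subset h1 (h4.trans Finset.sdiff_subset), ?_, ?_⟩
    · rw [Finset.card_union_of_disjoint hd, add_mul, one_mul]; omega
    · intro s hs hs' x
      rw [Finset.mem_union, not_or] at hs'
      have h7 := h3 s hs hs'.1 x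
      have h8 := h6 s (Finset.mem_sdiff.2 ⟨hs, hs'.1⟩) x
      rw [Finset.sum_union hd]
      push_cast
      linarith

/-- In a set of generators with comparable weights few are important. -/
theorem card_important_le {ν : G → ℝ} (hν : ∀ s, 0 ≤ ν s) {w : ℝ} {B : Finset G}
    (hB : ∀ s ∈ B, w ≤ ν s ∧ ν s ≤ 2 * w) (hN : 2 ≤ Fintype.card G) (j : ℕ) (K : G → ℕ)
    (hK : ∀ s, (∀ x : G → ℝ, j * ν s * ‖shiftDiff s x‖ ^ 2 ≤
      ∑ t, ν t * ‖shiftDiff t x‖ ^ 2) → j ≤ K s) :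
    (B.filter fun s => K s < j).card ≤ 8 * Nat.log 2 (Fintype.card G) ^ 2 * j := by
  set l := Nat.log 2 (Fintype.card G) with hl
  have hl0 : 0 < l := Nat.log_pos (by norm_num) hN
  -- With 8lj layers, the constant 4l of domination and the factor 2 between the weights leave
  -- exactly j. An s outside R thus passes the test for j, so all s with K s < j lie in R.
  obtain ⟨R, h1, h2, h3⟩ := exists_layers B (8 * l * j)
  rw [← hl] at h2 h3
  refine le_trans (Finset.card_le_card fun s hs => ?_) (h2.trans_eq (by ring))
  obtain ⟨hsB, hsj⟩ := Finset.mem_filter.1 hs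
  by_contra hsR
  refine absurd (hK s fun x => ?_) (not_le.2 hsj)
  have h4 := h3 s hsB hsR x
  have h5 : w * ∑ t ∈ R, ‖shiftDiff t x‖ ^ 2 ≤ ∑ t, ν t * ‖shiftDiff t x‖ ^ 2 := by
    rw [Finset.mul_sum]
    refine le_trans (Finset.sum_le_sum fun t ht => ?_) (Finset.sum_le_sum_of_subset_of_nonneg
      (Finset.subset_univ R) fun t _ _ => mul_nonneg (hν t) (sq_nonneg _))
    exact mul_le_mul_of_nonneg_right (hB t (h1 ht)).1 (sq_nonneg _)
  have h6 := mul_le_mul_of_nonneg_left h4 (hν s)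
  have h7 : ν s * ∑ t ∈ R, ‖shiftDiff t x‖ ^ 2 ≤ 2 * w * ∑ t ∈ R, ‖shiftDiff t x‖ ^ 2 :=
    mul_le_mul_of_nonneg_right (hB s hsB).2 (Finset.sum_nonneg fun t _ => sq_nonneg _)
  have hl1 : (0 : ℝ) < l := by exact_mod_cast hl0
  push_cast at h6
  have h8 : (8 * l : ℝ) * (j * ν s * ‖shiftDiff s x‖ ^ 2) ≤
      (8 * l) * ∑ t, ν t * ‖shiftDiff t x‖ ^ 2 := by
    calc _ = ν s * (8 * l * j * ‖shiftDiff s x‖ ^ 2) := by ring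
      _ ≤ ν s * (4 * l * ∑ t ∈ R, ‖shiftDiff t x‖ ^ 2) := h6
      _ = 4 * l * (ν s * ∑ t ∈ R, ‖shiftDiff t x‖ ^ 2) := by ring
      _ ≤ 4 * l * (2 * ∑ t, ν t * ‖shiftDiff t x‖ ^ 2) := by
          refine mul_le_mul_of_nonneg_left ?_ (by positivity)
          linarith
      _ = _ := by ring
  exact le_of_mul_le_mul_left h8 (by positivity)

end Words

/-- Summation by parts: 1 / k is at most 1 / D plus the telescoping terms 1 / (j(j + 1)) over k ≤ j
< D. The counts c(j + 1) then leave a harmonic sum up to D, and the terms 1 / D contribute at most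
1. -/
theorem sum_one_div_le {α : Type*} (B : Finset α) (K : α → ℕ) (hK : ∀ s ∈ B, 1 ≤ K s) {D : ℕ}
    (hBD : B.card ≤ D) (hD : 1 ≤ D) {c : ℝ} (hc : 0 ≤ c)
    (h : ∀ j, 1 ≤ j → j ≤ D → ((B.filter fun s => K s < j).card : ℝ) ≤ c * j) :
    ∑ s ∈ B, (1 : ℝ) / K s ≤ 1 + c * (1 + Real.log D) := by
  have h1 : ∀ d : ℕ, ∀ k : ℕ, 1 ≤ k → 1 ≤ d → (1 : ℝ) / k ≤
      1 / d + ∑ j ∈ Finset.Ico 1 d, if k < j + 1 then (1 : ℝ) / (j * (j + 1)) else 0 := by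
    intro d k hk hd
    induction d, hd using Nat.le_induction with
    | base =>
      simp only [Nat.cast_one, div_one, Finset.Ico_self, Finset.sum_empty, add_zero]
      rw [div_le_one (by exact_mod_cast hk)]
      exact_mod_cast hk
    | succ d hd ih =>
      rw [Finset.sum_Ico_succ_top hd]
      have hd0 : (0 : ℝ) < d := by exact_mod_cast hd
      have e : (1 : ℝ) / d = 1 / (d + 1 : ℕ) + 1 / (d * (d + 1)) := by
        push_cast; field_simp
      split_ifs with hkd
      · linarith
      · have hkd : d + 1 ≤ k := by omega
        have h0 : (0 : ℝ) ≤ ∑ j ∈ Finset.Ico 1 d, if k < j + 1 then (1 : ℝ) / (j * (j + 1)) else 0 :=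
          Finset.sum_nonneg fun j _ => by split_ifs <;> positivity
        have : (1 : ℝ) / k ≤ 1 / (d + 1 : ℕ) :=
          one_div_le_one_div_of_le (by positivity) (by exact_mod_cast hkd)
        linarith
  have hD0 : (0 : ℝ) < D := by exact_mod_cast hD
  have h2 : ∑ j ∈ Finset.Ico 1 D, (1 : ℝ) / j ≤ 1 + Real.log D := by
    refine le_trans ?_ (harmonic_le_one_add_log D)
    rw [harmonic_eq_sum_Icc]
    push_cast
    simp only [one_div]
    refine Finset.sum_le_sum_of_subset_of_nonneg (fun j hj => ?_) fun j _ _ => by positivity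
    rw [Finset.mem_Ico] at hj; rw [Finset.mem_Icc]; omega
  calc ∑ s ∈ B, (1 : ℝ) / K s ≤ ∑ s ∈ B, ((1 : ℝ) / D +
          ∑ j ∈ Finset.Ico 1 D, if K s < j + 1 then (1 : ℝ) / (j * (j + 1)) else 0) :=
        Finset.sum_le_sum fun s hs => h1 D (K s) (hK s hs) hD
    _ = B.card / D + ∑ j ∈ Finset.Ico 1 D,
          (B.filter fun s => K s < j + 1).card * ((1 : ℝ) / (j * (j + 1))) := by
        rw [Finset.sum_add_distrib, Finset.sum_const, nsmul_eq_mul, mul_one_div, Finset.sum_comm]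
        congr 1
        refine Finset.sum_congr rfl fun j _ => ?_
        rw [← Finset.sum_filter, Finset.sum_const, nsmul_eq_mul]
    _ ≤ 1 + ∑ j ∈ Finset.Ico 1 D, c * (1 / j) := by
        refine add_le_add ?_ (Finset.sum_le_sum fun j hj => ?_)
        · rw [div_le_one hD0]; exact_mod_cast hBD
        · obtain ⟨hj1, hj2⟩ := Finset.mem_Ico.1 hj
          have hj0 : (0 : ℝ) < j := by exact_mod_cast hj1
          have := h (j + 1) (by omega) hj2
          refine (mul_le_mul_of_nonneg_right this (by positivity)).trans_eq ?_
          push_cast; field_simp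
    _ ≤ _ := by
        rw [← Finset.mul_sum]
        gcongr

/-! ### The total importance -/

section Importance

variable {G : Type*} [Group G] [Fintype G] [DecidableEq G]

theorem one_le_logPlus (x : ℝ) : 1 ≤ logPlus x := le_max_left _ _

theorem log_le_logPlus (x : ℝ) : Real.log x ≤ logPlus x := le_max_right _ _

theorem natLog_two_le (n : ℕ) : (Nat.log 2 n : ℝ) ≤ 3 / 2 * logPlus n := by
  have h1 : (Nat.log 2 n : ℝ) * Real.log 2 ≤ logPlus n := by
    rcases Nat.eq_zero_or_pos n with rfl | hn
    · simpa using zero_le_one.trans (one_le_logPlus 0)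
    · refine le_trans ?_ (log_le_logPlus n)
      rw [← Real.log_pow]
      refine Real.log_le_log (by positivity) ?_
      exact_mod_cast Nat.pow_log_le_self 2 hn.ne'
  have h2 := Real.log_two_gt_d9
  have h3 : (0 : ℝ) ≤ Nat.log 2 n := by positivity
  nlinarith

/-- The support of `ν` splits into O(log W) classes of weights within a factor 2. In each class
`card_important_le` and `sum_one_div_le`, cut off at |S|, bound the sum. -/
theorem sum_one_div_importance_le {S : Finset G} {ν : G → ℝ} (hν : IsSymmetricWeight S ν)
    (hν0 : ν ≠ 0) (hN : 2 ≤ Fintype.card G) (K : G → ℕ) (hK1 : ∀ s, 1 ≤ K s)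
    (hK : ∀ s, ∀ j ≤ Fintype.card G, (∀ x : G → ℝ, j * ν s * ‖shiftDiff s x‖ ^ 2 ≤
      ∑ t, ν t * ‖shiftDiff t x‖ ^ 2) → j ≤ K s) :
    ∑ s, (1 : ℝ) / K s ≤ 200 * (logPlus (Fintype.card G) ^ 2 * logPlus S.card *
      logPlus (weightRatio ν)) := by
  set N := Fintype.card G with hNdef
  set l := Nat.log 2 N with hl
  have hT : supp ν ⊆ S := fun s hs => by
    by_contra h
    exact (Finset.mem_filter.1 hs).2 (hν.eq_zero_of_notMem s h)
  have hne : (supp ν).Nonempty := by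
    obtain ⟨s, hs⟩ := Function.ne_iff.1 hν0
    exact ⟨s, Finset.mem_filter.2 ⟨Finset.mem_univ s, hs⟩⟩
  have hS1 : 1 ≤ S.card := Finset.card_pos.2 (hne.mono hT)
  have hSN : S.card ≤ N := Finset.card_le_univ S
  have him : (ν '' Function.support ν).Finite := Set.toFinite _
  have himne : (ν '' Function.support ν).Nonempty := by
    obtain ⟨s, hs⟩ := hne
    exact ⟨ν s, s, (Finset.mem_filter.1 hs).2, rfl⟩
  set a := sInf (ν '' Function.support ν) with ha
  set b := sSup (ν '' Function.support ν) with hb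
  have ha0 : 0 < a := by
    obtain ⟨s, hs, hsa⟩ := himne.csInf_mem him
    rw [ha, ← hsa]
    exact lt_of_le_of_ne (hν.nonneg s) (Ne.symm hs)
  have hab : ∀ s ∈ supp ν, a ≤ ν s ∧ ν s ≤ b := fun s hs => by
    have : ν s ∈ ν '' Function.support ν := ⟨s, (Finset.mem_filter.1 hs).2, rfl⟩
    exact ⟨csInf_le him.bddBelow this, le_csSup him.bddAbove this⟩
  have hW : weightRatio ν = b / a := rfl
  -- The dyadic class of a weight relative to the smallest positive weight a.
  let f : G → ℕ := fun s => ⌊Real.logb 2 (ν s / a)⌋₊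
  have hfB : ∀ s ∈ supp ν, f s ∈ Finset.range (⌊Real.logb 2 (b / a)⌋₊ + 1) := fun s hs => by
    rw [Finset.mem_range, Nat.lt_succ_iff]
    refine Nat.floor_le_floor (Real.logb_le_logb_of_le (by norm_num) ?_ ?_)
    · exact div_pos (ha0.trans_le (hab s hs).1) ha0
    · exact div_le_div_of_nonneg_right (hab s hs).2 ha0.le
  have hf : ∀ i, ∀ s ∈ (supp ν).filter (fun s => f s = i),
      2 ^ i * a ≤ ν s ∧ ν s ≤ 2 * (2 ^ i * a) := fun i s hs => by
    obtain ⟨hs', rfl⟩ := Finset.mem_filter.1 hs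
    have h1 : 1 ≤ ν s / a := by rw [le_div_iff₀ ha0, one_mul]; exact (hab s hs').1
    have h0 : 0 < ν s / a := by linarith
    have h2 : 0 ≤ Real.logb 2 (ν s / a) := Real.logb_nonneg (by norm_num) h1
    have h3 : (2 : ℝ) ^ f s ≤ ν s / a := by
      rw [← Real.rpow_natCast, ← Real.le_logb_iff_rpow_le (by norm_num) h0]
      exact Nat.floor_le h2
    have h4 : ν s / a ≤ (2 : ℝ) ^ (f s + 1) := by
      rw [← Real.rpow_natCast, ← Real.logb_le_iff_le_rpow (by norm_num) h0]
      push_cast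
      exact (Nat.lt_floor_add_one _).le
    constructor
    · rwa [le_div_iff₀ ha0] at h3
    · rw [div_le_iff₀ ha0, pow_succ] at h4
      linarith
  have hbucket : ∀ i, ∑ s ∈ (supp ν).filter (fun s => f s = i), (1 : ℝ) / K s ≤
      1 + 8 * l ^ 2 * (1 + Real.log S.card) := fun i => by
    refine sum_one_div_le _ K (fun s _ => hK1 s)
      ((Finset.card_le_card ((Finset.filter_subset _ _).trans hT))) hS1 (by positivity)
      fun j _ hj => ?_
    exact_mod_cast card_important_le hν.nonneg (hf i) hN j K fun s => hK s j (hj.trans hSN)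
  have h1 : ∑ s ∈ supp ν, (1 : ℝ) / K s ≤
      (⌊Real.logb 2 (b / a)⌋₊ + 1) * (1 + 8 * l ^ 2 * (1 + Real.log S.card)) := by
    rw [← Finset.sum_fiberwise_of_maps_to hfB]
    refine (Finset.sum_le_sum fun i _ => hbucket i).trans_eq ?_
    rw [Finset.sum_const, Finset.card_range, nsmul_eq_mul]
    push_cast; ring
  -- An element of weight zero passes every test, so K s is at least N there; at most N such terms
  -- contribute at most 1.
  have h2 : ∑ s ∈ (supp ν)ᶜ, (1 : ℝ) / K s ≤ 1 := by
    have hN0 : (0 : ℝ) < N := by positivity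
    calc _ ≤ ∑ _s ∈ (supp ν)ᶜ, (1 : ℝ) / N := Finset.sum_le_sum fun s hs => by
          have h0 : ν s = 0 := by
            by_contra h
            exact (Finset.mem_compl.1 hs) (Finset.mem_filter.2 ⟨Finset.mem_univ s, h⟩)
          refine one_div_le_one_div_of_le hN0 ?_
          refine Nat.cast_le.2 (hK s N le_rfl fun x => ?_)
          rw [h0]
          simpa using Finset.sum_nonneg fun t _ =>
            mul_nonneg (hν.nonneg t) (sq_nonneg ‖shiftDiff t x‖)
      _ ≤ 1 := by
          rw [Finset.sum_const, nsmul_eq_mul, mul_one_div, div_le_one hN0]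
          exact_mod_cast Finset.card_le_univ _
  have h3 : (⌊Real.logb 2 (b / a)⌋₊ : ℝ) + 1 ≤ 5 / 2 * logPlus (weightRatio ν) := by
    have hba : 1 ≤ b / a := by
      obtain ⟨s, hs⟩ := hne
      rw [le_div_iff₀ ha0, one_mul]
      exact (hab s hs).1.trans (hab s hs).2
    have h4 := Nat.floor_le (Real.logb_nonneg (b := 2) (by norm_num) hba)
    have h5 : Real.logb 2 (b / a) ≤ 3 / 2 * logPlus (weightRatio ν) := by
      rw [hW, Real.logb, div_le_iff₀ (Real.log_pos (by norm_num))]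
      have h6 := log_le_logPlus (b / a)
      have h7 := one_le_logPlus (b / a)
      nlinarith [Real.log_two_gt_d9]
    linarith [one_le_logPlus (weightRatio ν)]
  have h4 : (l : ℝ) ^ 2 ≤ 9 / 4 * logPlus N ^ 2 := by
    have := pow_le_pow_left₀ (by positivity) (natLog_two_le N) 2
    rw [← hl] at this
    linarith
  have hA := one_le_logPlus N
  have hB := one_le_logPlus S.card
  have hC := one_le_logPlus (weightRatio ν)
  have h5 : 1 + 8 * (l : ℝ) ^ 2 * (1 + Real.log S.card) ≤
      37 * (logPlus N ^ 2 * logPlus S.card) := by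
    have h6 : 1 + Real.log S.card ≤ 2 * logPlus S.card := by linarith [log_le_logPlus (S.card)]
    have h7 : 8 * (l : ℝ) ^ 2 * (1 + Real.log S.card) ≤
        8 * (9 / 4 * logPlus N ^ 2) * (2 * logPlus S.card) := by
      have : 0 ≤ 1 + Real.log S.card := by
        have := Real.log_nonneg (x := S.card) (by exact_mod_cast hS1)
        linarith
      gcongr
    have h8 : 1 ≤ logPlus N ^ 2 * logPlus S.card := one_le_mul_of_one_le_of_one_le
      (one_le_pow₀ hA) hB
    linarith
  rw [← Finset.sum_add_sum_compl (supp ν)]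
  have h6 : 1 ≤ logPlus N ^ 2 * logPlus S.card * logPlus (weightRatio ν) :=
    one_le_mul_of_one_le_of_one_le (one_le_mul_of_one_le_of_one_le (one_le_pow₀ hA) hB) hC
  have h7 : ((⌊Real.logb 2 (b / a)⌋₊ : ℝ) + 1) * (1 + 8 * l ^ 2 * (1 + Real.log S.card)) ≤
      (5 / 2 * logPlus (weightRatio ν)) * (37 * (logPlus N ^ 2 * logPlus S.card)) := by
    refine mul_le_mul h3 h5 ?_ (by positivity)
    have := Real.log_nonneg (x := S.card) (by exact_mod_cast hS1)
    positivity
  linarith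

end Importance

end CayleySparsification

namespace CayleySparsification

open Matrix
open scoped MatrixOrder

/-! ### Laplacians as functions of the weights -/

section Laplacian

variable {G : Type*} [Group G] [Fintype G] [DecidableEq G]

theorem generatorLaplacian_isHermitian (s : G) : (generatorLaplacian s).IsHermitian := by
  rw [IsHermitian, conjTranspose_eq_transpose_of_trivial, generatorLaplacian]
  simp [transpose_sub, transpose_add, transpose_smul, add_comm]

theorem generatorLaplacian_posSemidef (s : G) : (generatorLaplacian s).PosSemidef :=
  PosSemidef.of_dotProduct_mulVec_nonneg (generatorLaplacian_isHermitian s) fun x => by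
    rw [star_trivial, dotProduct_generatorLaplacian_mulVec]; positivity

theorem generatorLaplacian_inv (s : G) : generatorLaplacian s⁻¹ = generatorLaplacian s := by
  have : rightRegular s⁻¹ = (rightRegular s)ᵀ := by
    ext h g
    simp only [rightRegular, of_apply, transpose_apply]
    congr 1
    rw [eq_mul_inv_iff_mul_eq, eq_comm (a := g)]
  rw [generatorLaplacian, this, transpose_transpose, generatorLaplacian, add_comm]

/-- The Laplacian of a weight function on the whole group. -/
noncomputable def lap (w : G → ℝ) : Matrix G G ℝ := ∑ s, w s • generatorLaplacian s

theorem cayleyLaplacian_eq_lap {S : Finset G} {w : G → ℝ} (h : ∀ g, g ∉ S → w g = 0) :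
    cayleyLaplacian S w = lap w := by
  refine Finset.sum_subset (Finset.subset_univ S) fun s _ hs => ?_
  rw [h s hs, zero_smul]

theorem lap_add (v w : G → ℝ) : lap (v + w) = lap v + lap w := by
  simp [lap, add_smul, Finset.sum_add_distrib]

theorem lap_sub (v w : G → ℝ) : lap (v - w) = lap v - lap w := by
  simp [lap, sub_smul, Finset.sum_sub_distrib]

theorem lap_smul (c : ℝ) (w : G → ℝ) : lap (c • w) = c • lap w := by
  simp [lap, mul_smul, Finset.smul_sum]

theorem lap_zero : lap (0 : G → ℝ) = 0 := by simp [lap]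

theorem lap_single (s : G) (c : ℝ) : lap (Pi.single s c) = c • generatorLaplacian s := by
  rw [lap, Finset.sum_eq_single s]
  · simp
  · intro t _ ht; simp [Pi.single_eq_of_ne ht]
  · simp

/-- The greedy phase chooses s without s⁻¹; as both have the same Laplacian, its result can be
symmetrized for free. -/
theorem lap_symm (w : G → ℝ) : lap (fun g => (w g + w g⁻¹) / 2) = lap w := by
  have h1 : ∑ s, w s⁻¹ • generatorLaplacian s = lap w := by
    rw [← Equiv.sum_comp (Equiv.inv G)]
    exact Finset.sum_congr rfl fun s _ => by simp [generatorLaplacian_inv]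
  have : ∀ s, ((w s + w s⁻¹) / 2) • generatorLaplacian s =
      (1 / 2 : ℝ) • (w s • generatorLaplacian s + w s⁻¹ • generatorLaplacian s) := fun s => by
    module
  simp only [lap, this, ← Finset.smul_sum, Finset.sum_add_distrib]
  rw [h1]
  unfold lap
  module

theorem lap_posSemidef {w : G → ℝ} (hw : ∀ g, 0 ≤ w g) : (lap w).PosSemidef :=
  posSemidef_sum _ fun s _ => (generatorLaplacian_posSemidef s).smul (hw s)

theorem lap_isHermitian (w : G → ℝ) : (lap w).IsHermitian := by
  rw [IsHermitian, lap, conjTranspose_sum]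
  exact Finset.sum_congr rfl fun s _ => by
    rw [conjTranspose_smul, (generatorLaplacian_isHermitian s).eq, star_trivial]

theorem dotProduct_lap_mulVec (w x : G → ℝ) :
    x ⬝ᵥ lap w *ᵥ x = ∑ s, w s * (‖shiftDiff s x‖ ^ 2 / 2) := by
  rw [lap, sum_mulVec, dotProduct_sum]
  exact Finset.sum_congr rfl fun s _ => by
    rw [smul_mulVec, dotProduct_smul, dotProduct_generatorLaplacian_mulVec, smul_eq_mul]

/-- A kernel vector of L_ν is annihilated by each term of the Dirichlet form with positive weight.
This makes whitening by a generalized inverse lossless for weights supported where `ν` is. -/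
theorem lap_mulVec_eq_zero {ν y : G → ℝ} (hν : ∀ g, 0 ≤ ν g) (hy : ∀ g, 0 ≤ y g)
    (h : ∀ g, ν g = 0 → y g = 0) {x : G → ℝ} (hx : lap ν *ᵥ x = 0) : lap y *ᵥ x = 0 := by
  rw [← (lap_posSemidef hy).dotProduct_mulVec_zero_iff, star_trivial, dotProduct_lap_mulVec]
  have h1 : x ⬝ᵥ lap ν *ᵥ x = 0 := by rw [hx, dotProduct_zero]
  rw [dotProduct_lap_mulVec, Finset.sum_eq_zero_iff_of_nonneg fun s _ =>
    mul_nonneg (hν s) (by positivity)] at h1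
  refine Finset.sum_eq_zero fun s _ => ?_
  rcases mul_eq_zero.1 (h1 s (Finset.mem_univ s)) with h2 | h2
  · rw [h s h2, zero_mul]
  · rw [h2, mul_zero]

end Laplacian

/-! ### Whitening by Gram–Schmidt orthogonalization -/

section Whitening

variable {G : Type*} [Fintype G] [DecidableEq G]

/-- `B = Cᵀ C` for a matrix `C` with `C L Cᵀ = 1`. -/
def IsPartialInverse (L B : Matrix G G ℝ) : Prop :=
  ∃ (ι : Type) (_ : Fintype ι) (_ : DecidableEq ι) (C : Matrix ι G ℝ),
    B = Cᵀ * C ∧ C * L * Cᵀ = 1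

theorem isPartialInverse_zero (L : Matrix G G ℝ) : IsPartialInverse L 0 :=
  ⟨Empty, inferInstance, inferInstance, 0, by simp, by ext i; exact i.elim⟩

/-- One step of Gram–Schmidt orthogonalization with respect to `L`. -/
noncomputable def gramSchmidtVec (L B : Matrix G G ℝ) (k : G) : G → ℝ :=
  fun i => (if i = k then 1 else 0) - (B * L) i k

/-- The rank one update by the component of the k-th basis vector orthogonal to the earlier ones,
normalized in the form L. Dividing by the squared norm avoids the square root that a new row of C
itself would contain. -/
noncomputable def gramSchmidtStep (L B : Matrix G G ℝ) (k : G) : Matrix G G ℝ :=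
  of fun i j => B i j + gramSchmidtVec L B k i * gramSchmidtVec L B k j /
    ∑ g, gramSchmidtVec L B k g * ∑ h, L g h * gramSchmidtVec L B k h

theorem gramSchmidtVec_eq (L B : Matrix G G ℝ) (k : G) :
    gramSchmidtVec L B k = Pi.single k 1 - B *ᵥ (L *ᵥ Pi.single k 1) := by
  ext i
  rw [mulVec_mulVec, mulVec_single_one]
  simp [gramSchmidtVec, Pi.single_apply]

theorem gramSchmidtStep_eq (L B : Matrix G G ℝ) (k : G) :
    gramSchmidtStep L B k = B + (gramSchmidtVec L B k ⬝ᵥ L *ᵥ gramSchmidtVec L B k)⁻¹ •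
      vecMulVec (gramSchmidtVec L B k) (gramSchmidtVec L B k) := by
  ext i j
  simp only [gramSchmidtStep, of_apply, Matrix.add_apply, Matrix.smul_apply, vecMulVec_apply, smul_eq_mul,
    dotProduct, mulVec]
  rw [div_eq_inv_mul]

/-- The invariant says that B acts as an inverse of L on the images under L of the basis vectors
treated so far. The vector v satisfies C L v = 0, so the update keeps C L Cᵀ = 1 and does not
disturb the earlier vectors. -/
theorem IsPartialInverse.step {L B : Matrix G G ℝ} (hL : L.PosSemidef) (hB : IsPartialInverse L B)
    {P : Finset G} (hP : ∀ j ∈ P, L *ᵥ (B *ᵥ (L *ᵥ Pi.single j 1)) = L *ᵥ Pi.single j 1) (k : G) :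
    IsPartialInverse L (gramSchmidtStep L B k) ∧
      ∀ j ∈ insert k P, L *ᵥ (gramSchmidtStep L B k *ᵥ (L *ᵥ Pi.single j 1)) =
        L *ᵥ Pi.single j 1 := by
  obtain ⟨ι, _, _, C, hBC, hC⟩ := hB
  obtain ⟨v, hv⟩ : ∃ v, v = gramSchmidtVec L B k := ⟨_, rfl⟩
  have hv2 := hv.trans (gramSchmidtVec_eq L B k)
  rw [gramSchmidtStep_eq, ← hv]
  have hLs : Lᵀ = L := by
    rw [← conjTranspose_eq_transpose_of_trivial]; exact hL.isHermitian.eq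
  have hCLv : C *ᵥ (L *ᵥ v) = 0 := by
    rw [hv2, hBC]
    simp only [mulVec_sub, mulVec_mulVec, ← Matrix.mul_assoc]
    rw [hC, Matrix.one_mul, sub_self]
  have hBLv : B *ᵥ (L *ᵥ v) = 0 := by
    rw [hBC, ← mulVec_mulVec, hCLv, mulVec_zero]
  have hBs : Bᵀ = B := by rw [hBC]; simp [transpose_mul]
  have horth : ∀ x, v ⬝ᵥ L *ᵥ (B *ᵥ x) = 0 := fun x => by
    have : v ⬝ᵥ L *ᵥ (B *ᵥ x) = (B *ᵥ (L *ᵥ v)) ⬝ᵥ x := by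
      rw [dotProduct_mulVec, dotProduct_mulVec, ← mulVec_transpose, ← mulVec_transpose, hBs, hLs]
    rw [this, hBLv, zero_dotProduct]
  have hBv : ∀ x, (vecMulVec v v) *ᵥ x = (v ⬝ᵥ x) • v := fun x => by
    ext i
    simp [mulVec, vecMulVec_apply, dotProduct, Finset.mul_sum, mul_comm, mul_left_comm]
  set d := v ⬝ᵥ L *ᵥ v with hd
  have hLk : L *ᵥ v = L *ᵥ Pi.single k 1 - L *ᵥ (B *ᵥ (L *ᵥ Pi.single k 1)) := by
    rw [hv2, mulVec_sub]
  have hd0 : 0 ≤ d := by simpa using hL.dotProduct_mulVec_nonneg v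
  rcases hd0.eq_or_lt with hd0 | hd0
  · have hLv : L *ᵥ v = 0 := by
      rw [← hL.dotProduct_mulVec_zero_iff, star_trivial]; exact hd0.symm
    -- If v has L-norm zero then L v = 0 and the k-th vector adds nothing; the convention x / 0 = 0
    -- makes the update vanish, as required.
    rw [← hd0, _root_.inv_zero, zero_smul, add_zero]
    refine ⟨⟨ι, _, _, C, hBC, hC⟩, fun j hj => ?_⟩
    rcases Finset.mem_insert.1 hj with rfl | hj
    · rw [hLv] at hLk
      exact (sub_eq_zero.1 hLk.symm).symm
    · exact hP j hj
  -- Otherwise C receives the L-normalized vector v as a new row.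
  · refine ⟨⟨ι ⊕ Unit, inferInstance, inferInstance,
      fromRows C (replicateRow Unit ((Real.sqrt d)⁻¹ • v)), ?_, ?_⟩, fun j hj => ?_⟩
    · rw [transpose_fromRows, fromCols_mul_fromRows, ← hBC]
      congr 1
      ext i j
      simp only [Matrix.smul_apply, vecMulVec_apply, mul_apply, transpose_apply, replicateRow_apply,
        Pi.smul_apply, smul_eq_mul, Finset.univ_unique, Finset.sum_const, Finset.card_singleton,
        one_smul]
      have : d⁻¹ = (Real.sqrt d)⁻¹ * (Real.sqrt d)⁻¹ := by
        rw [← mul_inv, Real.mul_self_sqrt hd0.le]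
      rw [this]; ring
    · have e1 : C * L * (replicateRow Unit ((Real.sqrt d)⁻¹ • v))ᵀ = 0 := by
        ext i j
        have := congrFun hCLv i
        rw [mulVec_mulVec] at this
        simp only [mulVec, dotProduct, Pi.zero_apply] at this
        simp only [mul_apply (M := C * L), transpose_apply, replicateRow_apply, Pi.smul_apply,
          smul_eq_mul, mul_left_comm _ (Real.sqrt d)⁻¹, ← Finset.mul_sum]
        rw [this]; simp
      have e2 : replicateRow Unit ((Real.sqrt d)⁻¹ • v) * L * Cᵀ = 0 := by
        have := congrArg transpose e1
        simpa [transpose_mul, hLs, Matrix.mul_assoc] using this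
      have e3 : replicateRow Unit ((Real.sqrt d)⁻¹ • v) * L *
          (replicateRow Unit ((Real.sqrt d)⁻¹ • v))ᵀ = 1 := by
        ext i j
        have : (replicateRow Unit ((Real.sqrt d)⁻¹ • v) * L *
          (replicateRow Unit ((Real.sqrt d)⁻¹ • v))ᵀ) i j =
            ((Real.sqrt d)⁻¹ • v) ⬝ᵥ L *ᵥ ((Real.sqrt d)⁻¹ • v) := by
          rw [Matrix.mul_assoc]; rfl
        rw [this, mulVec_smul, dotProduct_smul, smul_dotProduct, ← hd]
        have h1 := Real.mul_self_sqrt hd0.le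
        have h2 : Real.sqrt d ≠ 0 := (Real.sqrt_pos.2 hd0).ne'
        simp only [smul_eq_mul, one_apply, Subsingleton.elim i j, if_true]
        field_simp
        rw [sq, h1]
      rw [transpose_fromRows, fromRows_mul, fromRows_mul_fromCols, hC, e1, e2, e3,
        fromBlocks_one]
    · rw [add_mulVec, smul_mulVec, hBv, mulVec_add, mulVec_smul, mulVec_smul]
      rcases Finset.mem_insert.1 hj with rfl | hj
      · have h1 : v ⬝ᵥ L *ᵥ Pi.single j 1 = d := by
          have h2 : (Pi.single j 1 : G → ℝ) = v + B *ᵥ (L *ᵥ Pi.single j 1) := by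
            rw [hv2]; abel
          rw [h2, mulVec_add, dotProduct_add, horth, add_zero]
        rw [h1, smul_smul, inv_mul_cancel₀ hd0.ne', one_smul, hLk]
        abel
      · have h1 : v ⬝ᵥ L *ᵥ Pi.single j 1 = 0 := by
          rw [← hP j hj, horth]
        rw [h1, zero_smul, smul_zero, add_zero, hP j hj]

theorem mul_mul_eq_of_forall_single {L B : Matrix G G ℝ}
    (h : ∀ j, L *ᵥ (B *ᵥ (L *ᵥ Pi.single j 1)) = L *ᵥ Pi.single j 1) : L * B * L = L := by
  ext i j
  have := congrFun (h j) i
  rw [mulVec_mulVec, mulVec_mulVec, mulVec_single_one, mulVec_single_one] at this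
  exact this

/-- Cyclicity of the trace. It lets spectral data of the whitened matrix be computed from B = Cᵀ C
alone. -/
theorem trace_transpose_mul_pow {ι : Type*} [Fintype ι] [DecidableEq ι] (C : Matrix ι G ℝ)
    (M : Matrix G G ℝ) {q : ℕ} (hq : q ≠ 0) :
    trace ((Cᵀ * C * M) ^ q) = trace ((C * M * Cᵀ) ^ q) := by
  obtain ⟨q, rfl⟩ := Nat.exists_eq_succ_of_ne_zero hq
  have : (Cᵀ * C * M) ^ (q + 1) = Cᵀ * ((C * M * Cᵀ) ^ q * (C * M)) := by
    induction q with
    | zero => simp [Matrix.mul_assoc]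
    | succ q ih => rw [pow_succ, ih (by simp), pow_succ]; simp only [Matrix.mul_assoc]
  rw [Nat.succ_eq_add_one, this, trace_mul_comm, Matrix.mul_assoc, ← pow_succ]

/-- Compare ranks: the identity on `ι` factors through the space of functions on G. -/
theorem card_le_of_mul_mul_transpose_eq_one {ι : Type*} [Fintype ι] [DecidableEq ι]
    {C : Matrix ι G ℝ} {L : Matrix G G ℝ} (h : C * L * Cᵀ = 1) :
    Fintype.card ι ≤ Fintype.card G := by
  rw [← rank_one (R := ℝ) (n := ι), ← h, Matrix.mul_assoc]
  exact (rank_mul_le_left _ _).trans (rank_le_card_width _)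

end Whitening

end CayleySparsification

namespace CayleySparsification

open Matrix
open scoped MatrixOrder

/-! ### Correctness of the greedy algorithm for weights -/

section Algorithm

variable {G : Type*} [Group G] [Fintype G] [DecidableEq G]

/-- `Tr (B L_w) ^ q`, the only spectral quantity that the algorithm computes. -/
noncomputable def tracePower (B : Matrix G G ℝ) (q : ℕ) (w : G → ℝ) : ℝ :=
  trace ((B * lap w) ^ q)

/-- The value of the potential at the weight function `x`. -/
noncomputable def weightPotential (B : Matrix G G ℝ) (q : ℕ) (ν : G → ℝ) (η Z : ℝ) (t : ℕ)
    (x : G → ℝ) : ℝ :=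
  tracePower B q (ν + (η / q) • x) / (1 + η * (1 + 4 * η) / Z) ^ t +
    tracePower B q (ν - (η / q) • x) / (1 - η * (1 - 4 * η) / Z) ^ t

section Conj

variable {ι : Type} [Fintype ι] [DecidableEq ι] {C : Matrix ι G ℝ}

theorem conj_posSemidef {w : G → ℝ} (hw : ∀ g, 0 ≤ w g) : (C * lap w * Cᵀ).PosSemidef := by
  simpa [conjTranspose_eq_transpose_of_trivial] using (lap_posSemidef hw).mul_mul_conjTranspose_same C

theorem tracePower_eq (w : G → ℝ) {q : ℕ} (hq : q ≠ 0) :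
    tracePower (Cᵀ * C) q w = trace ((C * lap w * Cᵀ) ^ q) :=
  trace_transpose_mul_pow C _ hq

/-- The weight `ν` plays the role of the identity matrix, because C whitens its Laplacian. -/
theorem weightPotential_eq {ν : G → ℝ} (hC : C * lap ν * Cᵀ = 1) {q : ℕ} (hq : q ≠ 0) (η Z : ℝ)
    (t : ℕ) (x : G → ℝ) :
    weightPotential (Cᵀ * C) q ν η Z t x = potential q η Z t (C * lap x * Cᵀ) := by
  rw [weightPotential, potential, tracePower_eq _ hq, tracePower_eq _ hq, lap_add, lap_sub,
    lap_smul, Matrix.mul_add, Matrix.mul_sub, Matrix.add_mul, Matrix.sub_mul, hC, Matrix.mul_smul,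
    Matrix.smul_mul]

/-- Whitening can be undone: 1 - B L_ν maps into the kernel of L_ν, hence into that of L_y. Bounds
for the whitened matrix therefore transfer back to `lap y`. -/
theorem lap_eq_conj {ν y : G → ℝ} (hν : ∀ g, 0 ≤ ν g) (hy : ∀ g, 0 ≤ y g)
    (h : ∀ g, ν g = 0 → y g = 0) (hB : lap ν * (Cᵀ * C) * lap ν = lap ν) :
    lap y = (C * lap ν)ᵀ * (C * lap y * Cᵀ) * (C * lap ν) := by
  have hs : ∀ w : G → ℝ, (lap w)ᵀ = lap w := fun w => by
    rw [← conjTranspose_eq_transpose_of_trivial]; exact (lap_isHermitian w).eq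
  have h1 : lap y * (Cᵀ * C * lap ν) = lap y := by
    have h2 : lap ν * (1 - Cᵀ * C * lap ν) = 0 := by
      rw [Matrix.mul_sub, ← Matrix.mul_assoc, hB, Matrix.mul_one, sub_self]
    have h3 : lap y * (1 - Cᵀ * C * lap ν) = 0 := by
      ext i j
      have h4 := congrFun (lap_mulVec_eq_zero hν hy h
        (x := (1 - Cᵀ * C * lap ν) *ᵥ Pi.single j 1) (by rw [mulVec_mulVec, h2, zero_mulVec])) i
      rw [mulVec_mulVec, mulVec_single_one] at h4
      exact h4
    rw [Matrix.mul_sub, Matrix.mul_one] at h3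
    exact (sub_eq_zero.1 h3).symm
  have h5 : lap ν * Cᵀ * C * lap y = lap y := by
    have := congrArg transpose h1
    simpa [transpose_mul, hs, Matrix.mul_assoc] using this
  calc lap y = lap y * (Cᵀ * C * lap ν) := h1.symm
    _ = lap ν * Cᵀ * C * lap y * (Cᵀ * C * lap ν) := by rw [h5]
    _ = _ := by rw [transpose_mul, hs]; simp only [Matrix.mul_assoc]

theorem conj_smul_one {ν : G → ℝ} (hB : lap ν * (Cᵀ * C) * lap ν = lap ν) (c : ℝ) :
    (C * lap ν)ᵀ * (c • (1 : Matrix ι ι ℝ)) * (C * lap ν) = c • lap ν := by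
  have hs : (lap ν)ᵀ = lap ν := by
    rw [← conjTranspose_eq_transpose_of_trivial]; exact (lap_isHermitian ν).eq
  rw [Matrix.mul_smul, Matrix.mul_one, Matrix.smul_mul, transpose_mul, hs, ← Matrix.mul_assoc,
    Matrix.mul_assoc (lap ν), hB]

theorem conj_mono {X Y : Matrix ι ι ℝ} (h : X ≤ Y) (D : Matrix ι G ℝ) :
    Dᵀ * X * D ≤ Dᵀ * Y * D := by
  rw [le_iff] at h ⊢
  have := h.conjTranspose_mul_mul_same D
  rwa [conjTranspose_eq_transpose_of_trivial, Matrix.mul_sub, Matrix.sub_mul] at this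

end Conj

/-- The quantities computed by the algorithm before its greedy phase: a generalized inverse `B` of
the Laplacian, the inverse importances `K` and the parameters of the greedy phase. -/
structure GreedySetup (ν : G → ℝ) (B : Matrix G G ℝ) (q : ℕ) (K : G → ℕ) (η : ℝ) (m : ℕ) :
    Prop where
  nonneg : ∀ g, 0 ≤ ν g
  partialInverse : IsPartialInverse (lap ν) B
  mul_mul : lap ν * B * lap ν = lap ν
  q_ne : q ≠ 0
  card_le : Fintype.card G ≤ 2 ^ q
  one_le_K : ∀ s, 1 ≤ K s
  trace_le : ∀ s, tracePower B q (Pi.single s (K s * ν s)) ≤ Fintype.card G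
  params : GreedyParams (2 * Fintype.card G) q η (∑ s, (1 : ℝ) / K s) m

/-- Completeness of the trace test: if c L_s ≤ L_ν, the whitened matrix is at most 1, so the trace
of any power is at most its size. This makes the computed K(s) as large as the combinatorial bound
on Z requires. -/
theorem tracePower_single_le {ν : G → ℝ} {B : Matrix G G ℝ}
    (hB : IsPartialInverse (lap ν) B) {q : ℕ} (hq : q ≠ 0) {s : G} {c : ℝ} (hc : 0 ≤ c)
    (h : ∀ x : G → ℝ, c * ‖shiftDiff s x‖ ^ 2 ≤ ∑ t, ν t * ‖shiftDiff t x‖ ^ 2) :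
    tracePower B q (Pi.single s c) ≤ Fintype.card G := by
  obtain ⟨ι, _, _, C, rfl, hC⟩ := hB
  rw [tracePower_eq _ hq]
  have h0 : (C * lap (Pi.single s c) * Cᵀ).PosSemidef := conj_posSemidef fun g => by
    by_cases hg : g = s
    · subst hg; simpa using hc
    · simp [Pi.single_eq_of_ne hg]
  refine (trace_pow_le_card h0 q ?_).trans
    (by exact_mod_cast card_le_of_mul_mul_transpose_eq_one hC)
  rw [← hC]
  have h1 : lap (Pi.single s c) ≤ lap ν := by
    rw [le_iff]
    refine PosSemidef.of_dotProduct_mulVec_nonneg ((lap_isHermitian _).sub (lap_isHermitian _))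
      fun x => ?_
    rw [star_trivial, sub_mulVec, dotProduct_sub, dotProduct_lap_mulVec, lap_single, smul_mulVec,
      dotProduct_smul, dotProduct_generatorLaplacian_mulVec, smul_eq_mul, sub_nonneg]
    have := h x
    simp only [← mul_div_assoc, ← Finset.sum_div]
    linarith
  have := (le_iff.1 h1).mul_mul_conjTranspose_same C
  rw [le_iff]
  rwa [conjTranspose_eq_transpose_of_trivial, Matrix.mul_sub, Matrix.sub_mul] at this

/-- The state of the greedy phase after `t` steps. -/
structure GreedyState (ν : G → ℝ) (B : Matrix G G ℝ) (q : ℕ) (K : G → ℕ) (η : ℝ) (t : ℕ)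
    (x : G → ℝ) : Prop where
  nonneg : ∀ g, 0 ≤ x g
  eq_zero : ∀ g, ν g = 0 → x g = 0
  card_le : (supp x).card ≤ t
  sub_posSemidef : ∀ (ι : Type) [Fintype ι] [DecidableEq ι] (C : Matrix ι G ℝ), B = Cᵀ * C →
    C * lap ν * Cᵀ = 1 → ((1 : Matrix ι ι ℝ) - (η / q) • (C * lap x * Cᵀ)).PosSemidef
  potential_le : weightPotential B q ν η (∑ s, (1 : ℝ) / K s) t x ≤ 2 * Fintype.card G

namespace GreedySetup

variable {ν : G → ℝ} {B : Matrix G G ℝ} {q : ℕ} {K : G → ℕ} {η : ℝ} {m : ℕ}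

theorem state_zero (h : GreedySetup ν B q K η m) : GreedyState ν B q K η 0 0 where
  nonneg _ := le_rfl
  eq_zero _ _ := rfl
  card_le := by simp [supp]
  sub_posSemidef ι _ _ C _ _ := by simpa [lap_zero] using PosSemidef.one
  potential_le := by
    obtain ⟨ι, _, _, C, rfl, hC⟩ := h.partialInverse
    rw [weightPotential_eq hC h.q_ne, potential, lap_zero]
    have : (Fintype.card ι : ℝ) ≤ Fintype.card G := by
      exact_mod_cast card_le_of_mul_mul_transpose_eq_one hC
    simp only [Matrix.mul_zero, Matrix.zero_mul, smul_zero, add_zero, sub_zero, one_pow,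
      trace_one, pow_zero, div_one]
    linarith

theorem conj_single_posSemidef (h : GreedySetup ν B q K η m) {ι : Type} [Fintype ι]
    [DecidableEq ι] (C : Matrix ι G ℝ) (s : G) :
    (C * lap (Pi.single s (K s * ν s)) * Cᵀ).PosSemidef := conj_posSemidef fun g => by
  by_cases hg : g = s
  · subst hg; simpa using mul_nonneg (Nat.cast_nonneg (K g)) (h.nonneg g)
  · simp [Pi.single_eq_of_ne hg]

/-- Soundness of the trace test: a trace of a q-th power at most N ≤ 2^q forces the eigenvalues to
be at most 2. -/
theorem conj_single_le (h : GreedySetup ν B q K η m) {ι : Type} [Fintype ι]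
    [DecidableEq ι] {C : Matrix ι G ℝ} (hBC : B = Cᵀ * C) (s : G) :
    C * lap (Pi.single s (K s * ν s)) * Cᵀ ≤ (2 : ℝ) • (1 : Matrix ι ι ℝ) := by
  refine le_smul_one_of_trace_pow_le (h.conj_single_posSemidef C s) h.q_ne (by norm_num) ?_
  rw [← tracePower_eq _ h.q_ne, ← hBC]
  exact (h.trace_le s).trans (by exact_mod_cast h.card_le)

theorem exists_step (h : GreedySetup ν B q K η m) {t : ℕ} (ht : t < m) {x : G → ℝ}
    (hx : GreedyState ν B q K η t x) :
    ∃ s, weightPotential B q ν η (∑ s, (1 : ℝ) / K s) (t + 1) (x + Pi.single s (K s * ν s)) ≤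
      2 * Fintype.card G := by
  obtain ⟨ι, _, _, C, hBC, hC⟩ := h.partialInverse
  have hp := hx.potential_le
  rw [hBC, weightPotential_eq hC h.q_ne] at hp
  -- The factors K s cancel, leaving the decomposition of the identity into whitened generators.
  have hs : ∑ s, ((1 : ℝ) / K s) • (C * lap (Pi.single s (K s * ν s)) * Cᵀ) = 1 := by
    rw [← hC]
    conv_rhs => rw [lap, Matrix.mul_sum, Matrix.sum_mul]
    refine Finset.sum_congr rfl fun s _ => ?_
    have : (K s : ℝ) ≠ 0 := by have := h.one_le_K s; positivity
    rw [lap_single, Matrix.mul_smul, Matrix.smul_mul, Matrix.mul_smul, Matrix.smul_mul, smul_smul]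
    congr 1
    field_simp
  obtain ⟨s, hs⟩ := h.params.exists_potential_le (fun s => by positivity)
    (h.conj_single_posSemidef C) (h.conj_single_le hBC) hs rfl ht.le
    (conj_posSemidef hx.nonneg) (hx.sub_posSemidef ι C hBC hC) hp
  refine ⟨s, ?_⟩
  rw [hBC, weightPotential_eq hC h.q_ne, lap_add, Matrix.mul_add, Matrix.add_mul]
  exact hs

theorem state_succ (h : GreedySetup ν B q K η m) {t : ℕ} (ht : t < m) {x : G → ℝ}
    (hx : GreedyState ν B q K η t x) {s : G}
    (hs : weightPotential B q ν η (∑ s, (1 : ℝ) / K s) (t + 1) (x + Pi.single s (K s * ν s)) ≤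
      2 * Fintype.card G) :
    GreedyState ν B q K η (t + 1) (x + Pi.single s (K s * ν s)) where
  nonneg g := by
    by_cases hg : g = s
    · subst hg
      simpa using add_nonneg (hx.nonneg g) (mul_nonneg (Nat.cast_nonneg (K g)) (h.nonneg g))
    · simpa [Pi.single_eq_of_ne hg] using hx.nonneg g
  eq_zero g hg := by
    by_cases hgs : g = s
    · subst hgs; simp [hx.eq_zero g hg, hg]
    · simpa [Pi.single_eq_of_ne hgs] using hx.eq_zero g hg
  card_le := by
    refine le_trans (Finset.card_le_card (t := insert s (supp x)) fun g hg => ?_)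
      ((Finset.card_insert_le _ _).trans (Nat.add_le_add_right hx.card_le 1))
    by_cases hgs : g = s
    · simp [hgs]
    · refine Finset.mem_insert_of_mem (Finset.mem_filter.2 ⟨Finset.mem_univ g, ?_⟩)
      simpa [Pi.single_eq_of_ne hgs] using (Finset.mem_filter.1 hg).2
  -- Positivity of 1 - aX cannot be read off from a trace of an even power, so it is carried along:
  -- the upper half bounds the old X, and `GreedyParams.half_le` leaves room for the new summand.
  sub_posSemidef ι _ _ C hBC hC := by
    have hp := hx.potential_le
    rw [hBC, weightPotential_eq hC h.q_ne] at hp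
    have hb := (h.params.bounds_of_potential_le ht.le (conj_posSemidef hx.nonneg)
      (hx.sub_posSemidef ι C hBC hC) hp).1
    have := h.params.half_le hb (h.conj_single_le hBC s)
    rw [lap_add, Matrix.mul_add, Matrix.add_mul]
    exact nonneg_iff_posSemidef.1 (le_trans (nonneg_iff_posSemidef.2
      (PosSemidef.one.smul (by norm_num))) this)
  potential_le := hs

/-- At time m both halves of the potential are at most 2N; the resulting bounds on the whitened
matrix are conjugated back by C L_ν. -/
theorem lap_bounds (h : GreedySetup ν B q K η m) {x : G → ℝ} (hx : GreedyState ν B q K η m x) :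
    ((m : ℝ) / (∑ s, (1 : ℝ) / K s) * (1 - 8 * η)) • lap ν ≤ lap x ∧
      lap x ≤ ((m : ℝ) / (∑ s, (1 : ℝ) / K s) * (1 + 6 * η)) • lap ν := by
  obtain ⟨ι, _, _, C, hBC, hC⟩ := h.partialInverse
  have hp := hx.potential_le
  rw [hBC, weightPotential_eq hC h.q_ne] at hp
  have hps := hx.sub_posSemidef ι C hBC hC
  obtain ⟨h1, h2⟩ := h.params.bounds_of_potential_le le_rfl (conj_posSemidef hx.nonneg) hps hp
  have h3 := h.params.ge_of_trace_le hps h2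
  have hB := h.mul_mul
  rw [hBC] at hB
  have h4 := conj_mono h1 (C * lap ν)
  have h5 := conj_mono h3 (C * lap ν)
  rw [← lap_eq_conj h.nonneg hx.nonneg hx.eq_zero hB, conj_smul_one hB] at h4 h5
  exact ⟨h5, h4⟩

end GreedySetup

/-- The output of the greedy algorithm. -/
theorem GreedyState.isCayleySparsifier {S : Finset G} {ν : G → ℝ} {B : Matrix G G ℝ} {q : ℕ}
    {K : G → ℕ} {ε : ℝ} (hν : IsSymmetricWeight S ν) (hν0 : ν ≠ 0) (hε1 : ε ≤ 1)
    (hN : 2 ≤ Fintype.card G)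
    (hS : IsSymmetricSet S)
    {m : ℕ} (h : GreedySetup ν B q K (ε / 10) m)
    (hK : ∀ s, ∀ j, 1 ≤ j → j ≤ Fintype.card G →
      tracePower B q (Pi.single s (j * ν s)) ≤ Fintype.card G → j ≤ K s)
    (hm : (m : ℝ) ≤ (∑ s, (1 : ℝ) / K s) *
      ((Nat.clog 2 (Fintype.card G) + 1) / (ε / 10) ^ 2) + 1)
    {x : G → ℝ} (hx : GreedyState ν B q K (ε / 10) m x) :
    IsCayleySparsifier 1000000 S ν ε
      (fun g => (x g + x g⁻¹) / 2 * ((∑ s, (1 : ℝ) / K s) / m)) := by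
  have hε : 0 < ε := by linarith [h.params.eta_pos]
  set Z := ∑ s, (1 : ℝ) / K s with hZ
  have hZ1 := h.params.one_le
  have hR := h.params.pos
  have hxS : ∀ g, g ∉ S → x g = 0 := fun g hg => hx.eq_zero g (hν.eq_zero_of_notMem g hg)
  have hSinv : ∀ g, g ∉ S → g⁻¹ ∉ S := fun g hg hg' => hg (by simpa using hS _ hg')
  have hμS : ∀ g, g ∉ S → (x g + x g⁻¹) / 2 * (Z / m) = 0 := fun g hg => by
    rw [hxS g hg, hxS _ (hSinv g hg)]; simp
  have hm0 : (0 : ℝ) < m := by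
    by_contra hm0
    have : (m : ℝ) = 0 := le_antisymm (not_lt.1 hm0) (Nat.cast_nonneg m)
    rw [this, zero_div] at hR
    exact lt_irrefl _ hR
  set A := logPlus (Fintype.card G) ^ 2 * logPlus S.card * logPlus (weightRatio ν) with hA
  have hN1 := one_le_logPlus (Fintype.card G)
  have hS1 := one_le_logPlus S.card
  have hW1 := one_le_logPlus (weightRatio ν)
  have hZA : Z ≤ 200 * A := by
    refine sum_one_div_importance_le hν hν0 hN K h.one_le_K fun s j hj hxj => ?_
    rcases Nat.eq_zero_or_pos j with rfl | hj0
    · exact Nat.zero_le _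
    · exact hK s j hj0 hj (tracePower_single_le h.partialInverse h.q_ne
        (mul_nonneg (Nat.cast_nonneg j) (hν.nonneg s)) hxj)
  have hcard : ((supp fun g => (x g + x g⁻¹) / 2 * (Z / m)).card : ℝ) ≤
      1000000 * (A * logPlus (Fintype.card G) / ε ^ 2) := by
    have h1 : (supp fun g => (x g + x g⁻¹) / 2 * (Z / m)).card ≤ 2 * m := by
      have : (supp fun g => (x g + x g⁻¹) / 2 * (Z / m)) ⊆
          supp x ∪ (supp x).image (fun g => g⁻¹) := fun g hg => by
        by_contra hg'
        rw [Finset.mem_union, not_or, Finset.mem_image] at hg'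
        have h2 : x g = 0 := by
          by_contra h3
          exact hg'.1 (Finset.mem_filter.2 ⟨Finset.mem_univ g, h3⟩)
        have h3 : x g⁻¹ = 0 := by
          by_contra h3
          exact hg'.2 ⟨g⁻¹, Finset.mem_filter.2 ⟨Finset.mem_univ _, h3⟩, by simp⟩
        exact (Finset.mem_filter.1 hg).2 (by simp [h2, h3])
      refine (Finset.card_le_card this).trans ((Finset.card_union_le _ _).trans ?_)
      have h4 := Finset.card_image_le (s := supp x) (f := fun g : G => g⁻¹)
      have h5 := hx.card_le
      omega
    have h2 : ((supp fun g => (x g + x g⁻¹) / 2 * (Z / m)).card : ℝ) ≤ 2 * m := by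
      exact_mod_cast h1
    have h3 : (Nat.clog 2 (Fintype.card G) : ℝ) + 1 ≤ 7 / 2 * logPlus (Fintype.card G) := by
      have h4 : Nat.clog 2 (Fintype.card G) ≤ Nat.log 2 (Fintype.card G) + 1 :=
        Nat.clog_le_of_le_pow (Nat.lt_pow_succ_log_self (by norm_num) _).le
      have h5 := natLog_two_le (Fintype.card G)
      have h6 : (Nat.clog 2 (Fintype.card G) : ℝ) ≤ Nat.log 2 (Fintype.card G) + 1 := by
        exact_mod_cast h4
      linarith
    set l : ℝ := (Nat.clog 2 (Fintype.card G) : ℝ) + 1 with hl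
    have hl1 : 1 ≤ l := by rw [hl]; linarith [Nat.cast_nonneg (α := ℝ) (Nat.clog 2 (Fintype.card G))]
    -- 70000 = 200 · 100 · 7/2, from the bound on Z, from η = ε / 10 and from ⌈log₂ N⌉ + 1.
    -- Symmetrization doubles it.
    have h4 : Z * (l / (ε / 10) ^ 2) ≤ 70000 * (A * logPlus (Fintype.card G) / ε ^ 2) := by
      have : l / (ε / 10) ^ 2 = 100 * l / ε ^ 2 := by field_simp; ring
      rw [this]
      calc Z * (100 * l / ε ^ 2) ≤ (200 * A) * (100 * (7 / 2 * logPlus (Fintype.card G)) / ε ^ 2) := by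
            gcongr
        _ = _ := by ring
    -- This absorbs the rounding of m, and uses ε ≤ 1.
    have h5 : 1 ≤ A * logPlus (Fintype.card G) / ε ^ 2 := by
      rw [le_div_iff₀ (by positivity), one_mul]
      refine le_trans (pow_le_one₀ hε.le hε1) ?_
      exact one_le_mul_of_one_le_of_one_le (one_le_mul_of_one_le_of_one_le
        (one_le_mul_of_one_le_of_one_le (one_le_pow₀ hN1) hS1) hW1) hN1
    linarith
  have hcard' : ((supp fun g => (x g + x g⁻¹) / 2 * (Z / m)).card : ℝ) ≤
      1000000 * (logPlus (Fintype.card G) ^ 3 * logPlus S.card * logPlus (weightRatio ν) /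
        ε ^ 2) := by
    refine hcard.trans_eq ?_
    rw [hA]; ring
  refine ⟨⟨fun g => ?_, hμS, fun g => ?_⟩, hcard', hcard'.trans ?_, ?_⟩
  · have := hx.nonneg g
    have := hx.nonneg g⁻¹
    positivity
  · rw [inv_inv, add_comm]
  · have : logPlus S.card ≤ logPlus (Fintype.card G) := by
      refine max_le_max le_rfl ?_
      rcases Nat.eq_zero_or_pos S.card with h0 | h0
      · rw [h0]
        simpa using Real.log_nonneg (x := Fintype.card G) (by exact_mod_cast hN.trans' (by norm_num))
      · exact Real.log_le_log (by exact_mod_cast h0) (by exact_mod_cast Finset.card_le_univ S)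
    have h2 : logPlus (Fintype.card G) ^ 3 * logPlus S.card ≤ logPlus (Fintype.card G) ^ 4 := by
      rw [pow_succ _ 3]
      gcongr
    gcongr
  · have h1 : cayleyLaplacian S (fun g => (x g + x g⁻¹) / 2 * (Z / m)) = (Z / m) • lap x := by
      rw [cayleyLaplacian_eq_lap hμS, ← lap_symm x, ← lap_smul]
      congr 1
      ext g; simp [mul_comm]
    rw [cayleyLaplacian_eq_lap hν.eq_zero_of_notMem, SpectralApprox, h1, ← le_iff, ← le_iff]
    obtain ⟨h2, h3⟩ := h.lap_bounds hx
    have hZm : 0 ≤ Z / m := by positivity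
    have h4 := smul_le_smul_of_nonneg_left h2 hZm
    have h5 := smul_le_smul_of_nonneg_left h3 hZm
    rw [← hZ, smul_smul] at h4 h5
    have hL := nonneg_iff_posSemidef.2 (lap_posSemidef hν.nonneg)
    have e : ∀ y : ℝ, Z / m * (m / Z * y) = y := fun y => by
      have : Z ≠ 0 := by positivity
      field_simp
    rw [e] at h4 h5
    exact ⟨le_trans (smul_le_smul_of_nonneg_right (by linarith) hL) h4,
      le_trans h5 (smul_le_smul_of_nonneg_right (by linarith) hL)⟩

/-- For ε ≥ 1 the lower Loewner bound is vacuous, so the zero weight is admissible. -/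
theorem isCayleySparsifier_zero {S : Finset G} {ν : G → ℝ} {ε : ℝ} (hν : IsSymmetricWeight S ν)
    (hε : 1 ≤ ε) : IsCayleySparsifier 1000000 S ν ε (fun _ => 0) := by
  have h0 : (supp fun _ : G => (0 : ℝ)).card = 0 := by simp [supp]
  have hN1 := one_le_logPlus (Fintype.card G)
  have hS1 := one_le_logPlus S.card
  have hW1 := one_le_logPlus (weightRatio ν)
  have hL : (cayleyLaplacian S ν).PosSemidef := by
    rw [cayleyLaplacian_eq_lap hν.eq_zero_of_notMem]; exact lap_posSemidef hν.nonneg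
  have h1 : cayleyLaplacian S (fun _ : G => (0 : ℝ)) = 0 := by simp [cayleyLaplacian]
  refine ⟨⟨fun _ => le_rfl, fun _ _ => rfl, fun _ => rfl⟩, ?_, ?_, ?_⟩
  · rw [h0, Nat.cast_zero]; positivity
  · rw [h0, Nat.cast_zero]; positivity
  · rw [SpectralApprox, h1, zero_sub, sub_zero, ← neg_smul]
    exact ⟨hL.smul (by linarith), hL.smul (by linarith)⟩

/-- When N ≤ 1 / ε² nothing has to be removed. Excluding this case is what bounds 1 / ε² by N in the
running time. -/
theorem isCayleySparsifier_self {S : Finset G} {ν : G → ℝ} {ε : ℝ} (hν : IsSymmetricWeight S ν)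
    (hε : 0 < ε) (h : ε * ε * Fintype.card G ≤ 1) : IsCayleySparsifier 1000000 S ν ε ν := by
  have h0 : ((supp ν).card : ℝ) ≤ 1 / ε ^ 2 := by
    rw [le_div_iff₀ (by positivity)]
    have : ((supp ν).card : ℝ) ≤ Fintype.card G := by exact_mod_cast Finset.card_le_univ _
    nlinarith [mul_pos hε hε]
  have hN1 := one_le_logPlus (Fintype.card G)
  have hS1 := one_le_logPlus S.card
  have hW1 := one_le_logPlus (weightRatio ν)
  have key : ∀ A : ℝ, 1 ≤ A → ((supp ν).card : ℝ) ≤ 1000000 * (A / ε ^ 2) := fun A hA => by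
    refine h0.trans ?_
    rw [← mul_div_assoc]
    gcongr
    linarith
  have hL : (cayleyLaplacian S ν).PosSemidef := by
    rw [cayleyLaplacian_eq_lap hν.eq_zero_of_notMem]; exact lap_posSemidef hν.nonneg
  refine ⟨hν, key _ ?_, key _ ?_, ?_, ?_⟩
  · exact one_le_mul_of_one_le_of_one_le (one_le_mul_of_one_le_of_one_le
      (one_le_pow₀ hN1) hS1) hW1
  · exact one_le_mul_of_one_le_of_one_le (one_le_pow₀ hN1) hW1
  · have : cayleyLaplacian S ν - (1 - ε) • cayleyLaplacian S ν = ε • cayleyLaplacian S ν := by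
      module
    rw [this]; exact hL.smul hε.le
  · have : (1 + ε) • cayleyLaplacian S ν - cayleyLaplacian S ν = ε • cayleyLaplacian S ν := by
      module
    rw [this]; exact hL.smul hε.le

end Algorithm

end CayleySparsification

namespace CayleySparsification

/-! ## A calculus for programs on matrices indexed by the group -/

section Calculus

/-- Group elements: loop variables, the element number zero, products. -/
inductive Idx : Type
  | var (a : ℕ)
  | zero
  | mul (x y : Idx)

/-- Natural numbers: scalar variables, constants, sums. -/
inductive NatTerm : Type
  | var (a : ℕ)
  | const (n : ℕ)
  | add (x y : NatTerm)

/-- Real numbers: entries of matrices, scalar variables, constants, indicators of equality. -/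
inductive Term : Type
  | mat (a : ℕ) (i j : Idx)
  | nat (x : NatTerm)
  | ind (i j : Idx)
  | add (x y : Term)
  | sub (x y : Term)
  | mul (x y : Term)
  | div (x y : Term)

def Idx.compile : Idx → NExp
  | .var a => .get 3 (.const a) (.const 0)
  | .zero => .const 0
  | .mul x y => .get 1 x.compile y.compile

def NatTerm.compile : NatTerm → NExp
  | .var a => .get 4 (.const a) (.const 0)
  | .const n => .const n
  | .add x y => .add x.compile y.compile

def Term.compile : Term → RExp
  | .mat a i j => .get a i.compile j.compile
  | .nat x => .cast x.compile
  -- With truncated subtraction, (i - j) + (j - i) vanishes exactly when i = j.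
  | .ind i j => .cast (.sub (.const 1)
      (.add (.sub i.compile j.compile) (.sub j.compile i.compile)))
  | .add x y => .add x.compile y.compile
  | .sub x y => .sub x.compile y.compile
  | .mul x y => .mul x.compile y.compile
  | .div x y => .div x.compile y.compile

/-- Whether a term reads the matrix `c`. -/
def Term.reads (c : ℕ) : Term → Bool
  | .mat a _ _ => a == c
  | .nat _ => false
  | .ind _ _ => false
  | .add x y => x.reads c || y.reads c
  | .sub x y => x.reads c || y.reads c
  | .mul x y => x.reads c || y.reads c
  | .div x y => x.reads c || y.reads c

/-- Tests. -/
inductive Test : Type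
  | natLt (x y : NatTerm)
  | realLt (x y : Term)

def Test.compile : Test → BExp
  | .natLt x y => .natLt x.compile y.compile
  | .realLt x y => .realLt x.compile y.compile

variable {G : Type*} [Group G] [Fintype G] [DecidableEq G]

/-- The values of the matrix variables and of the scalar variables. -/
structure Env (G : Type*) where
  mat : ℕ → G → G → ℝ
  nat : ℕ → ℕ

/-- Overwriting a matrix variable. -/
def Env.setMat (ρ : Env G) (c : ℕ) (M : G → G → ℝ) : Env G :=
  { ρ with mat := Function.update ρ.mat c M }

/-- Overwriting a scalar variable. -/
def Env.setNat (ρ : Env G) (a v : ℕ) : Env G := { ρ with nat := Function.update ρ.nat a v }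

@[simp] theorem Env.setMat_nat (ρ : Env G) (c : ℕ) (M : G → G → ℝ) :
    (ρ.setMat c M).nat = ρ.nat := rfl

@[simp] theorem Env.setNat_mat (ρ : Env G) (a v : ℕ) : (ρ.setNat a v).mat = ρ.mat := rfl

@[simp] theorem Env.setMat_mat (ρ : Env G) (c : ℕ) (M : G → G → ℝ) (a : ℕ) :
    (ρ.setMat c M).mat a = if a = c then M else ρ.mat a := by
  simp [Env.setMat, Function.update_apply]

@[simp] theorem Env.setNat_nat (ρ : Env G) (a v b : ℕ) :
    (ρ.setNat a v).nat b = if b = a then v else ρ.nat b := by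
  simp [Env.setNat, Function.update_apply]

variable (e : G ≃ Fin (Fintype.card G))

/-- The group element number zero. -/
def base : G := e.symm ⟨0, Fintype.card_pos⟩

theorem coe_base : (e (base e) : ℕ) = 0 := by simp [base]

def Idx.eval (θ : ℕ → G) : Idx → G
  | .var a => θ a
  | .zero => base e
  | .mul x y => x.eval θ * y.eval θ

def NatTerm.eval (ρ : Env G) : NatTerm → ℕ
  | .var a => ρ.nat a
  | .const n => n
  | .add x y => x.eval ρ + y.eval ρ

noncomputable def Term.eval (ρ : Env G) (θ : ℕ → G) : Term → ℝ
  | .mat a i j => ρ.mat a (i.eval e θ) (j.eval e θ)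
  | .nat x => x.eval ρ
  | .ind i j => if i.eval e θ = j.eval e θ then 1 else 0
  | .add x y => x.eval ρ θ + y.eval ρ θ
  | .sub x y => x.eval ρ θ - y.eval ρ θ
  | .mul x y => x.eval ρ θ * y.eval ρ θ
  | .div x y => x.eval ρ θ / y.eval ρ θ

def Test.holds (ρ : Env G) (θ : ℕ → G) : Test → Prop
  | .natLt x y => x.eval ρ < y.eval ρ
  | .realLt x y => x.eval e ρ θ < y.eval e ρ θ

/-- The store `σ` represents the environment `ρ` and the loop variables `θ`. -/
structure Rep (σ : Store) (ρ : Env G) (θ : ℕ → G) : Prop where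
  card : σ.nat 0 0 0 = Fintype.card G
  mul : ∀ g h, σ.nat 1 (e g) (e h) = e (g * h)
  elt : ∀ a, σ.nat 3 a 0 = e (θ a)
  nat : ∀ a, σ.nat 4 a 0 = ρ.nat a
  mat : ∀ a g h, σ.real a (e g) (e h) = ρ.mat a g h

variable {e} {σ : Store} {ρ : Env G} {θ : ℕ → G}

theorem Rep.idx_eval (h : Rep e σ ρ θ) (i : Idx) : i.compile.eval σ = e (i.eval e θ) := by
  induction i with
  | var a => simp [Idx.compile, NExp.eval, Idx.eval, h.elt]
  | zero => simp [Idx.compile, NExp.eval, Idx.eval, coe_base]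
  | mul x y hx hy => simp [Idx.compile, NExp.eval, Idx.eval, hx, hy, h.mul]

theorem Rep.natTerm_eval (h : Rep e σ ρ θ) (x : NatTerm) : x.compile.eval σ = x.eval ρ := by
  induction x with
  | var a => simp [NatTerm.compile, NExp.eval, NatTerm.eval, h.nat]
  | const n => simp [NatTerm.compile, NExp.eval, NatTerm.eval]
  | add x y hx hy => simp [NatTerm.compile, NExp.eval, NatTerm.eval, hx, hy]

theorem Rep.term_eval (h : Rep e σ ρ θ) (x : Term) : x.compile.eval σ = x.eval e ρ θ := by
  induction x with
  | mat a i j => simp [Term.compile, RExp.eval, Term.eval, h.idx_eval, h.mat]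
  | nat x => simp [Term.compile, RExp.eval, Term.eval, h.natTerm_eval]
  | ind i j =>
    simp only [Term.compile, RExp.eval, NExp.eval, Term.eval, h.idx_eval]
    split_ifs with hij
    · simp [hij]
    · have : (e (i.eval e θ) : ℕ) ≠ e (j.eval e θ) := fun h' => hij (e.injective (Fin.ext h'))
      rw [show 1 - ((e (i.eval e θ) : ℕ) - e (j.eval e θ) +
        ((e (j.eval e θ) : ℕ) - e (i.eval e θ))) = 0 by omega]
      simp
  | add x y hx hy => simp [Term.compile, RExp.eval, Term.eval, hx, hy]
  | sub x y hx hy => simp [Term.compile, RExp.eval, Term.eval, hx, hy]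
  | mul x y hx hy => simp [Term.compile, RExp.eval, Term.eval, hx, hy]
  | div x y hx hy => simp [Term.compile, RExp.eval, Term.eval, hx, hy]

theorem Rep.test_holds (h : Rep e σ ρ θ) (b : Test) : b.compile.holds σ ↔ b.holds e ρ θ := by
  cases b <;> simp [Test.compile, BExp.holds, Test.holds, h.natTerm_eval, h.term_eval]

theorem Term.eval_setMat {c : ℕ} {x : Term} (h : x.reads c = false) (M : G → G → ℝ) :
    x.eval e (ρ.setMat c M) θ = x.eval e ρ θ := by
  have hn : ∀ x : NatTerm, x.eval (ρ.setMat c M) = x.eval ρ := fun x => by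
    induction x with
    | var a => rfl
    | const n => rfl
    | add x y hx hy => simp [NatTerm.eval, hx, hy]
  induction x with
  | mat a i j =>
    have : a ≠ c := by simpa [Term.reads] using h
    simp [Term.eval, this]
  | nat x => simp [Term.eval, hn]
  | ind i j => rfl
  | add x y hx hy =>
    simp only [Term.reads, Bool.or_eq_false_iff] at h
    simp [Term.eval, hx h.1, hy h.2]
  | sub x y hx hy =>
    simp only [Term.reads, Bool.or_eq_false_iff] at h
    simp [Term.eval, hx h.1, hy h.2]
  | mul x y hx hy =>
    simp only [Term.reads, Bool.or_eq_false_iff] at h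
    simp [Term.eval, hx h.1, hy h.2]
  | div x y hx hy =>
    simp only [Term.reads, Bool.or_eq_false_iff] at h
    simp [Term.eval, hx h.1, hy h.2]

variable (e θ)

/-- From a store that represents `ρ`, the command `c` halts within `T` steps in a store that
represents `ρ'`, whatever the random bits are. -/
def Runs (c : Cmd) (ρ ρ' : Env G) (T : ℕ) : Prop :=
  ∀ coin σ, Rep e σ ρ θ → ∃ τ t, Exec coin c σ τ t ∧ t ≤ T ∧ Rep e τ ρ' θ

variable {e θ} {ρ₁ ρ₂ : Env G} {c d : Cmd} {S T : ℕ}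

theorem Runs.mono (h : Runs e θ c ρ ρ₁ S) (hST : S ≤ T) : Runs e θ c ρ ρ₁ T := fun coin σ hσ => by
  obtain ⟨τ, t, h1, h2, h3⟩ := h coin σ hσ
  exact ⟨τ, t, h1, h2.trans hST, h3⟩

theorem Runs.seq (h : Runs e θ c ρ ρ₁ S) (h' : Runs e θ d ρ₁ ρ₂ T) :
    Runs e θ (.seq c d) ρ ρ₂ (S + T) := fun coin σ hσ => by
  obtain ⟨τ, t, h1, h2, h3⟩ := h coin σ hσ
  obtain ⟨τ', t', h1', h2', h3'⟩ := h' coin τ h3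
  exact ⟨τ', t + t', h1.seq h1', by omega, h3'⟩

theorem runs_skip : Runs e θ .skip ρ ρ 1 := fun _ σ hσ => ⟨σ, 1, .skip σ, le_rfl, hσ⟩

/-- The command `c[i, j] := x`. -/
def setEntry (c : ℕ) (i j : Idx) (x : Term) : Cmd := .setReal c i.compile j.compile x.compile

theorem runs_setEntry (c : ℕ) (i j : Idx) (x : Term) :
    Runs e θ (setEntry c i j x) ρ
      (ρ.setMat c fun g h => if g = i.eval e θ ∧ h = j.eval e θ then x.eval e ρ θ
        else ρ.mat c g h) 1 := fun coin σ hσ => by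
  refine ⟨_, 1, .setReal σ c _ _ _, le_rfl, ⟨hσ.card, hσ.mul, hσ.elt, hσ.nat, fun a g h => ?_⟩⟩
  rw [hσ.idx_eval, hσ.idx_eval, hσ.term_eval]
  simp only [write, Env.setMat_mat, Fin.val_inj, e.injective.eq_iff]
  by_cases ha : a = c
  · subst ha
    by_cases hg : g = i.eval e θ ∧ h = j.eval e θ
    · simp [hg]
    · simp [hg, hσ.mat]
  · simp [ha, hσ.mat]

/-- The command `a := x` for a scalar variable `a`. -/
def setScalar (a : ℕ) (x : NatTerm) : Cmd := .setNat 4 (.const a) (.const 0) x.compile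

theorem runs_setScalar (a : ℕ) (x : NatTerm) :
    Runs e θ (setScalar a x) ρ (ρ.setNat a (x.eval ρ)) 1 := fun coin σ hσ => by
  refine ⟨_, 1, .setNat σ 4 _ _ _, le_rfl, ⟨?_, fun g h => ?_, fun b => ?_, fun b => ?_, hσ.mat⟩⟩
  · simp [write, hσ.card]
  · simp [write, hσ.mul]
  · simp [write, hσ.elt]
  · simp only [write, NExp.eval, hσ.natTerm_eval, Env.setNat_nat]
    by_cases hb : b = a
    · simp [hb]
    · simp [hb, hσ.nat]

theorem runs_ite_true {b : Test} (hb : b.holds e ρ θ) (h : Runs e θ c ρ ρ₁ T) (d : Cmd) :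
    Runs e θ (.ite b.compile c d) ρ ρ₁ (T + 1) := fun coin σ hσ => by
  obtain ⟨τ, t, h1, h2, h3⟩ := h coin σ hσ
  exact ⟨τ, t + 1, .iteTrue ((hσ.test_holds b).2 hb) h1, by omega, h3⟩

theorem runs_ite_false {b : Test} (hb : ¬ b.holds e ρ θ) (h : Runs e θ d ρ ρ₁ T) (c : Cmd) :
    Runs e θ (.ite b.compile c d) ρ ρ₁ (T + 1) := fun coin σ hσ => by
  obtain ⟨τ, t, h1, h2, h3⟩ := h coin σ hσ
  exact ⟨τ, t + 1, .iteFalse (fun h' => hb ((hσ.test_holds b).1 h')) h1, by omega, h3⟩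

/-- A loop that runs exactly `K` times. -/
theorem exists_runs_loop {b : Test} (I : ℕ → Env G → Prop) {K : ℕ}
    (hstep : ∀ k < K, ∀ ρ, I k ρ → b.holds e ρ θ ∧ ∃ ρ', Runs e θ c ρ ρ' T ∧ I (k + 1) ρ')
    (hend : ∀ ρ, I K ρ → ¬ b.holds e ρ θ) (h0 : I 0 ρ) :
    ∃ ρ', Runs e θ (.loop b.compile c) ρ ρ' (K * (T + 1) + 1) ∧ I K ρ' := by
  have key : ∀ d k, k + d = K → ∀ ρ, I k ρ →
      ∃ ρ', Runs e θ (.loop b.compile c) ρ ρ' (d * (T + 1) + 1) ∧ I K ρ' := by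
    intro d
    induction d with
    | zero =>
      rintro k rfl ρ h
      refine ⟨ρ, fun coin σ hσ => ?_, h⟩
      exact ⟨σ, 1, .loopDone fun h' => hend ρ h ((hσ.test_holds b).1 h'), by omega, hσ⟩
    | succ d ih =>
      intro k hk ρ h
      obtain ⟨hb, ρ₁, h1, h2⟩ := hstep k (by omega) ρ h
      obtain ⟨ρ₂, h3, h4⟩ := ih (k + 1) (by omega) ρ₁ h2
      refine ⟨ρ₂, fun coin σ hσ => ?_, h4⟩
      obtain ⟨τ, t, e1, e2, e3⟩ := h1 coin σ hσ
      obtain ⟨τ', t', e1', e2', e3'⟩ := h3 coin τ e3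
      exact ⟨τ', t + t' + 1, .loopStep ((hσ.test_holds b).2 hb) e1 e1', by rw [add_mul]; omega, e3'⟩
  exact key K 0 (by omega) ρ h0

/-- Execution of `c` with the loop variable `a` running through all group elements. -/
def forAll (a : ℕ) (c : Cmd) : Cmd :=
  .seq (.setNat 3 (.const a) (.const 0) (.const 0))
    (.seq (.loop (.natLt (.get 3 (.const a) (.const 0)) (.get 0 (.const 0) (.const 0)))
        (.seq c (.setNat 3 (.const a) (.const 0)
          (.add (.get 3 (.const a) (.const 0)) (.const 1)))))
      (.setNat 3 (.const a) (.const 0) (.const 0)))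

/-- The running time of `forAll` for a group of order `n` and a body with running time `t`. -/
def forTime {R : Type*} [CommSemiring R] (n t : R) : R := n * (t + 2) + 3

theorem Rep.of_update {a : ℕ} {g : G} (h : Rep e σ ρ (Function.update θ a g)) {v : ℕ} {g' : G}
    (hg' : (e g' : ℕ) = v) {σ' : Store} (hn : σ'.nat = write σ.nat 3 a 0 v)
    (hr : σ'.real = σ.real) : Rep e σ' ρ (Function.update θ a g') := by
  refine ⟨?_, fun g h' => ?_, fun b => ?_, fun b => ?_, fun b g h' => ?_⟩
  · simp [hn, write, h.card]
  · simp [hn, write, h.mul]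
  · by_cases hb : b = a
    · subst hb; simp [hn, write, hg']
    · simp [hn, write, hb, h.elt]
  · simp [hn, write, h.nat]
  · rw [hr, h.mat]

/-- The store represents `ρ` and `θ` except for the loop variable `a`, whose cell holds `k`. -/
def RepAt (e : G ≃ Fin (Fintype.card G)) (a : ℕ) (σ : Store) (ρ : Env G) (θ : ℕ → G) (k : ℕ) :
    Prop :=
  Rep e { σ with nat := write σ.nat 3 a 0 0 } ρ (Function.update θ a (base e)) ∧ σ.nat 3 a 0 = k

theorem Rep.repAt {a : ℕ} {g : G} (h : Rep e σ ρ (Function.update θ a g)) {σ' : Store} {v : ℕ}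
    (hn : σ'.nat = write σ.nat 3 a 0 v) (hr : σ'.real = σ.real) : RepAt e a σ' ρ θ v := by
  refine ⟨h.of_update (coe_base e) ?_ hr, by simp [hn, write]⟩
  funext x y z
  simp only [hn, write]
  split_ifs <;> rfl

theorem RepAt.rep {a k : ℕ} (h : RepAt e a σ ρ θ k) {g : G} (hg : (e g : ℕ) = k) :
    Rep e σ ρ (Function.update θ a g) := by
  refine h.1.of_update hg ?_ rfl
  funext x y z
  simp only [write, ← h.2]
  split_ifs with h1
  · obtain ⟨rfl, rfl, rfl⟩ := h1; rfl
  · rfl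

theorem RepAt.card {a k : ℕ} (h : RepAt e a σ ρ θ k) : σ.nat 0 0 0 = Fintype.card G := by
  have := h.1.card
  simpa [write] using this

/-- The invariant is indexed by the set of visited elements, so it does not mention the numbering.
The proof counts with `RepAt`, since after the last round the cell of the loop variable holds N, the
number of no element; the final reset to 0 restores a represented state. -/
theorem exists_runs_forAll {a : ℕ} (hθ : θ a = base e) (I : Finset G → Env G → Prop)
    (hstep : ∀ P : Finset G, ∀ g ∉ P, ∀ ρ, I P ρ →
      ∃ ρ', Runs e (Function.update θ a g) c ρ ρ' T ∧ I (insert g P) ρ') (h0 : I ∅ ρ) :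
    ∃ ρ', Runs e θ (forAll a c) ρ ρ' (forTime (Fintype.card G) T) ∧ I Finset.univ ρ' := by
  obtain ⟨N, hN⟩ : ∃ N, N = Fintype.card G := ⟨_, rfl⟩
  have hθ' : Function.update θ a (base e) = θ := by rw [← hθ, Function.update_eq_self]
  let B : BExp := .natLt (.get 3 (.const a) (.const 0)) (.get 0 (.const 0) (.const 0))
  let D : Cmd := .seq c (.setNat 3 (.const a) (.const 0)
    (.add (.get 3 (.const a) (.const 0)) (.const 1)))
  have key : ∀ d k, k + d = N → ∀ ρ, I (Finset.univ.filter fun g => (e g : ℕ) < k) ρ →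
      ∃ ρ', (∀ coin σ, RepAt e a σ ρ θ k → ∃ τ t, Exec coin (.loop B D) σ τ t ∧
        t ≤ d * (T + 2) + 1 ∧ RepAt e a τ ρ' θ N) ∧ I Finset.univ ρ' := by
    intro d
    induction d with
    | zero =>
      rintro k rfl ρ h
      refine ⟨ρ, fun coin σ hσ => ⟨σ, 1, .loopDone ?_, by omega, ?_⟩, ?_⟩
      · simp only [B, BExp.holds, NExp.eval, hσ.2, hσ.card]; omega
      · exact hσ
      · convert h using 1
        ext g
        have := (e g).isLt
        simp only [Finset.mem_univ, Finset.mem_filter, true_and, true_iff]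
        omega
    | succ d ih =>
      intro k hk ρ h
      have hkN : k < Fintype.card G := by omega
      obtain ⟨g, hg⟩ : ∃ g, (e g : ℕ) = k := ⟨e.symm ⟨k, hkN⟩, by simp⟩
      obtain ⟨ρ₁, h1, h2⟩ := hstep _ g (by simp [hg]) ρ h
      obtain ⟨ρ₂, h3, h4⟩ := ih (k + 1) (by omega) ρ₁ (by
        convert h2 using 1
        ext g'
        simp only [Finset.mem_filter, Finset.mem_univ, true_and, Finset.mem_insert]
        rw [Nat.lt_succ_iff_lt_or_eq, or_comm]
        refine or_congr_left ⟨fun h => e.injective (Fin.ext (h.trans hg.symm)), ?_⟩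
        rintro rfl; exact hg)
      refine ⟨ρ₂, fun coin σ hσ => ?_, h4⟩
      obtain ⟨τ, t, e1, e2, e3⟩ := h1 coin σ (hσ.rep hg)
      have hτ : τ.nat 3 a 0 = k := by rw [e3.elt]; simp [hg]
      obtain ⟨τ', t', e1', e2', e3'⟩ := h3 coin
        { τ with nat := write τ.nat 3 a 0 (k + 1) } (e3.repAt rfl rfl)
      refine ⟨τ', (t + 1) + t' + 1, .loopStep ?_ (e1.seq ?_) e1', by rw [add_mul]; omega, e3'⟩
      · simp only [B, BExp.holds, NExp.eval, hσ.2, hσ.card]; omega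
      · have := Exec.setNat (coin := coin) τ 3 (.const a) (.const 0)
          (.add (.get 3 (.const a) (.const 0)) (.const 1))
        simpa [NExp.eval, hτ] using this
  obtain ⟨ρ', h1, h2⟩ := key N 0 (by omega) ρ (by simpa using h0)
  refine ⟨ρ', fun coin σ hσ => ?_, h2⟩
  rw [← hθ'] at hσ
  obtain ⟨τ, t, e1, e2, e3⟩ := h1 coin { σ with nat := write σ.nat 3 a 0 0 } (hσ.repAt rfl rfl)
  refine ⟨{ τ with nat := write τ.nat 3 a 0 0 }, 1 + (t + 1), ?_, ?_, ?_⟩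
  · refine .seq ?_ (.seq e1 ?_)
    · exact Exec.setNat (coin := coin) σ 3 (.const a) (.const 0) (.const 0)
    · exact Exec.setNat (coin := coin) τ 3 (.const a) (.const 0) (.const 0)
  · rw [forTime, ← hN]; omega
  · have := e3.1
    rwa [hθ'] at this

end Calculus

end CayleySparsification

namespace CayleySparsification

/-! ## The program -/

section Commands

/-- `c[i, j] := ∑ k, x i j k`, where `i`, `j`, `k` are the loop variables `0`, `1`, `2`. -/
def sumCmd (c : ℕ) (x : Term) : Cmd :=
  forAll 0 (forAll 1 (.seq (setEntry c (.var 0) (.var 1) (.nat (.const 0)))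
    (forAll 2 (setEntry c (.var 0) (.var 1) (.add (.mat c (.var 0) (.var 1)) x)))))

def sumTime {R : Type*} [CommSemiring R] (n : R) : R :=
  forTime n (forTime n (1 + forTime n 1))

/-- `c[i, j] := x i j`. -/
def assignCmd (c : ℕ) (x : Term) : Cmd := sumCmd c (.mul (.ind (.var 2) .zero) x)

variable {G : Type*} [Group G] [Fintype G] [DecidableEq G]

/-- The loop variables `θ` with the first three of them replaced. -/
def setIdx (θ : ℕ → G) (g h k : G) : ℕ → G :=
  Function.update (Function.update (Function.update θ 0 g) 1 h) 2 k

@[simp] theorem setIdx_zero (θ : ℕ → G) (g h k : G) : setIdx θ g h k 0 = g := by simp [setIdx]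

@[simp] theorem setIdx_one (θ : ℕ → G) (g h k : G) : setIdx θ g h k 1 = h := by simp [setIdx]

@[simp] theorem setIdx_two (θ : ℕ → G) (g h k : G) : setIdx θ g h k 2 = k := by simp [setIdx]

@[simp] theorem setIdx_three (θ : ℕ → G) (g h k : G) : setIdx θ g h k 3 = θ 3 := by simp [setIdx]

/-- The loop variables of `sumCmd` have their default value. -/
def Idle (e : G ≃ Fin (Fintype.card G)) (θ : ℕ → G) : Prop := ∀ a < 3, θ a = base e

variable {e : G ≃ Fin (Fintype.card G)} {θ : ℕ → G} {ρ : Env G}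

theorem Idle.update (h : Idle e θ) (g : G) : Idle e (Function.update θ 3 g) := fun a ha => by
  rw [Function.update_of_ne (by omega), h a ha]

theorem Env.setMat_setMat (ρ : Env G) (c : ℕ) (M M' : G → G → ℝ) :
    (ρ.setMat c M).setMat c M' = ρ.setMat c M' := by
  simp [Env.setMat]

theorem Env.setMat_self (ρ : Env G) (c : ℕ) : ρ.setMat c (ρ.mat c) = ρ := by
  simp [Env.setMat]

/-- Three nested loop invariants: partial sums in one entry, finished entries of one row, finished
rows. As x does not read c, the partial results do not affect the summands. -/
theorem runs_sumCmd {c : ℕ} {x : Term} (hx : x.reads c = false) (hθ : Idle e θ) :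
    Runs e θ (sumCmd c x) ρ (ρ.setMat c fun g h => ∑ k, x.eval e ρ (setIdx θ g h k))
      (sumTime (Fintype.card G)) := by
  let val : G → G → ℝ := fun g h => ∑ k, x.eval e ρ (setIdx θ g h k)
  have h0 : θ 0 = base e := hθ 0 (by norm_num)
  have h1 : θ 1 = base e := hθ 1 (by norm_num)
  have h2 : θ 2 = base e := hθ 2 (by norm_num)
  have inner : ∀ (g h : G) (M : G → G → ℝ),
      Runs e (Function.update (Function.update θ 0 g) 1 h)
        (.seq (setEntry c (.var 0) (.var 1) (.nat (.const 0)))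
          (forAll 2 (setEntry c (.var 0) (.var 1) (.add (.mat c (.var 0) (.var 1)) x))))
        (ρ.setMat c M)
        (ρ.setMat c fun g' h' => if g' = g ∧ h' = h then val g h else M g' h')
        (1 + forTime (Fintype.card G) 1) := by
    intro g h M
    obtain ⟨ρ', h3, h4⟩ := exists_runs_forAll (e := e) (a := 2)
      (θ := Function.update (Function.update θ 0 g) 1 h)
      (c := setEntry c (.var 0) (.var 1) (.add (.mat c (.var 0) (.var 1)) x)) (T := 1)
      (ρ := ρ.setMat c fun g' h' => if g' = g ∧ h' = h then 0 else M g' h')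
      (by simpa using h2)
      (fun P ρ' => ρ' = ρ.setMat c fun g' h' => if g' = g ∧ h' = h then
        ∑ k ∈ P, x.eval e ρ (setIdx θ g h k) else M g' h')
      (fun P k hk ρ' hρ' => ⟨_, runs_setEntry c _ _ _, by
        subst hρ'
        rw [Env.setMat_setMat]
        congr 1
        funext g' h'
        simp only [Idx.eval, Term.eval, Env.setMat_mat, Term.eval_setMat hx]
        simp only [Function.update_self, ne_eq, zero_ne_one, not_false_eq_true,
          Function.update_of_ne, show (0 : ℕ) ≠ 2 by norm_num, show (1 : ℕ) ≠ 2 by norm_num,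
          if_true, and_self]
        rw [Finset.sum_insert hk, add_comm]
        split_ifs <;> rfl⟩)
      (by simp)
    subst h4
    refine Runs.seq ?_ h3
    have := runs_setEntry (e := e) (θ := Function.update (Function.update θ 0 g) 1 h)
      (ρ := ρ.setMat c M) c (.var 0) (.var 1) (.nat (.const 0))
    convert this using 1
    rw [Env.setMat_setMat]
    congr 1
    funext g' h'
    simp [Idx.eval, Term.eval, NatTerm.eval]
  have middle : ∀ (g : G) (M : G → G → ℝ),
      Runs e (Function.update θ 0 g)
        (forAll 1 (.seq (setEntry c (.var 0) (.var 1) (.nat (.const 0)))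
          (forAll 2 (setEntry c (.var 0) (.var 1) (.add (.mat c (.var 0) (.var 1)) x)))))
        (ρ.setMat c M)
        (ρ.setMat c fun g' h' => if g' = g then val g h' else M g' h')
        (forTime (Fintype.card G) (1 + forTime (Fintype.card G) 1)) := by
    intro g M
    obtain ⟨ρ', h3, h4⟩ := exists_runs_forAll (e := e) (a := 1) (θ := Function.update θ 0 g)
      (ρ := ρ.setMat c M) (by simpa using h1)
      (fun P ρ' => ρ' = ρ.setMat c fun g' h' => if g' = g ∧ h' ∈ P then val g h' else M g' h')
      (fun P h hk ρ' hρ' => ⟨_, hρ' ▸ inner g h _, by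
        congr 1
        funext g' h'
        simp only [Finset.mem_insert]
        by_cases h5 : g' = g <;> by_cases h6 : h' = h <;> simp [h5, h6]⟩)
      (by simp)
    subst h4
    simpa using h3
  obtain ⟨ρ', h3, h4⟩ := exists_runs_forAll (e := e) (a := 0) (θ := θ) (ρ := ρ) h0
    (fun P ρ' => ρ' = ρ.setMat c fun g' h' => if g' ∈ P then val g' h' else ρ.mat c g' h')
    (fun P g hg ρ' hρ' => ⟨_, hρ' ▸ middle g _, by
      congr 1
      funext g' h'
      simp only [Finset.mem_insert]
      by_cases h5 : g' = g <;> simp [h5]⟩)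
    (by simp [Env.setMat_self])
  subst h4
  simp only [Finset.mem_univ, if_true] at h3
  exact h3

/-- The indicator keeps only the summand where k is element number zero, so assignment is a special
case of summation. -/
theorem runs_assignCmd {c : ℕ} {x : Term} (hx : x.reads c = false) (hθ : Idle e θ) :
    Runs e θ (assignCmd c x) ρ (ρ.setMat c fun g h => x.eval e ρ (setIdx θ g h (base e)))
      (sumTime (Fintype.card G)) := by
  have := runs_sumCmd (ρ := ρ) (c := c) (x := .mul (.ind (.var 2) .zero) x)
    (by simpa [Term.reads] using hx) hθ
  simp only [Term.eval, Idx.eval, setIdx_two, ite_mul, one_mul, zero_mul, Finset.sum_ite_eq',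
    Finset.mem_univ, if_true] at this
  exact this

/-- The entries of `Id - (R(k) + R(k)ᵀ) / 2`, weighted by the column vector `w`. -/
def lapTerm (w : ℕ) : Term :=
  .mul (.mat w (.var 2) .zero) (.sub (.ind (.var 0) (.var 1))
    (.div (.add (.ind (.var 0) (.mul (.var 1) (.var 2))) (.ind (.var 1) (.mul (.var 0) (.var 2))))
      (.nat (.const 2))))

theorem sum_lapTerm (w : ℕ) (g h : G) :
    ∑ k, (lapTerm w).eval e ρ (setIdx θ g h k) = lap (fun g => ρ.mat w g (base e)) g h := by
  simp only [lapTerm, Term.eval, Idx.eval, setIdx_zero, setIdx_one, setIdx_two, NatTerm.eval,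
    lap, Matrix.sum_apply, Matrix.smul_apply, generatorLaplacian, Matrix.sub_apply,
    Matrix.add_apply, Matrix.transpose_apply, rightRegular, Matrix.of_apply, smul_eq_mul,
    Matrix.one_apply]
  refine Finset.sum_congr rfl fun k _ => ?_
  push_cast
  ring

/-- The matrix `15 := Tr (B L_w) ^ q` for the matrix `B` in `4`, the vector `w` in `10` and the scalar
`q` in `1`. -/
def traceCmd : Cmd :=
  .seq (.seq (sumCmd 11 (lapTerm 10)) <|
    .seq (sumCmd 12 (.mul (.mat 4 (.var 0) (.var 2)) (.mat 11 (.var 2) (.var 1)))) <|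
    .seq (assignCmd 13 (.ind (.var 0) (.var 1))) (setScalar 3 (.const 0))) <|
  .seq (.loop (Test.natLt (.var 3) (.var 1)).compile
    (.seq (sumCmd 14 (.mul (.mat 13 (.var 0) (.var 2)) (.mat 12 (.var 2) (.var 1)))) <|
      .seq (assignCmd 13 (.mat 14 (.var 0) (.var 1)))
      (setScalar 3 (.add (.var 3) (.const 1))))) <|
  sumCmd 15 (.mat 13 (.var 2) (.var 2))

def traceTime {R : Type*} [CommSemiring R] (n q : R) : R :=
  sumTime n + (sumTime n + (sumTime n + 1)) +
    (q * (sumTime n + (sumTime n + 1) + 1) + 1 + sumTime n)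

/-- Only the matrices 11 to 15 and the scalar 3 serve as scratch space; the frame conditions let
callers keep everything else. The bound Q makes the running time independent of the exponent. -/
theorem runs_traceCmd (hθ : Idle e θ) {Q : ℕ} (hQ : ρ.nat 1 ≤ Q) :
    ∃ ρ', Runs e θ traceCmd ρ ρ' (traceTime (Fintype.card G) Q) ∧
      (∀ a, a < 11 ∨ 15 < a → ρ'.mat a = ρ.mat a) ∧ (∀ a, a ≠ 3 → ρ'.nat a = ρ.nat a) ∧
      ∀ g h, ρ'.mat 15 g h =
        tracePower (Matrix.of (ρ.mat 4)) (ρ.nat 1) fun g => ρ.mat 10 g (base e) := by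
  set L := lap fun g => ρ.mat 10 g (base e) with hL
  set D : Matrix G G ℝ := Matrix.of (ρ.mat 4) * L with hD
  obtain ⟨ρ₁, r1, i1⟩ : ∃ ρ₁, Runs e θ (.seq (sumCmd 11 (lapTerm 10)) <|
      .seq (sumCmd 12 (.mul (.mat 4 (.var 0) (.var 2)) (.mat 11 (.var 2) (.var 1)))) <|
      .seq (assignCmd 13 (.ind (.var 0) (.var 1))) (setScalar 3 (.const 0))) ρ ρ₁
      (sumTime (Fintype.card G) + (sumTime (Fintype.card G) + (sumTime (Fintype.card G) + 1))) ∧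
      (∀ a, a < 11 ∨ 15 < a → ρ₁.mat a = ρ.mat a) ∧ (∀ a, a ≠ 3 → ρ₁.nat a = ρ.nat a) ∧
      ρ₁.mat 12 = D ∧ ρ₁.mat 13 = (D ^ 0 : Matrix G G ℝ) ∧ ρ₁.nat 3 = 0 := by
    refine ⟨_, (runs_sumCmd rfl hθ).seq ((runs_sumCmd rfl hθ).seq
      ((runs_assignCmd rfl hθ).seq (runs_setScalar _ _))), fun a ha => ?_, fun a ha => ?_, ?_, ?_,
      ?_⟩
    · have : a ≠ 11 ∧ a ≠ 12 ∧ a ≠ 13 := by omega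
      simp [this]
    · simp [ha]
    · funext g h
      simp only [Env.setNat_mat, Env.setMat_mat, Term.eval, Idx.eval, sum_lapTerm]
      simp [hD, Matrix.mul_apply, hL]
    · funext g h
      simp [Term.eval, Idx.eval, Matrix.one_apply]
    · simp [NatTerm.eval]
  obtain ⟨ρ₂, r2, i2⟩ := exists_runs_loop (e := e) (θ := θ) (ρ := ρ₁)
    (b := .natLt (.var 3) (.var 1)) (K := ρ.nat 1)
    (c := .seq (sumCmd 14 (.mul (.mat 13 (.var 0) (.var 2)) (.mat 12 (.var 2) (.var 1)))) <|
      .seq (assignCmd 13 (.mat 14 (.var 0) (.var 1)))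
      (setScalar 3 (.add (.var 3) (.const 1))))
    (T := sumTime (Fintype.card G) + (sumTime (Fintype.card G) + 1))
    -- After k rounds the matrix 13 holds the k-th power of D = B L_w.
    (fun k ρ' => (∀ a, a < 11 ∨ 15 < a → ρ'.mat a = ρ.mat a) ∧
      (∀ a, a ≠ 3 → ρ'.nat a = ρ.nat a) ∧
      ρ'.mat 12 = D ∧ ρ'.mat 13 = (D ^ k : Matrix G G ℝ) ∧ ρ'.nat 3 = k)
    (fun k hk ρ' ⟨h1, h2, h3, h4, h5⟩ => by
      refine ⟨?_, _, (runs_sumCmd rfl hθ).seq ((runs_assignCmd rfl hθ).seq (runs_setScalar _ _)),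
        fun a ha => ?_, fun a ha => ?_, ?_, ?_, ?_⟩
      · simpa [Test.holds, NatTerm.eval, h5, h2 1 (by norm_num)] using hk
      · have : a ≠ 13 ∧ a ≠ 14 := by omega
        simp [this, h1 a ha]
      · simp [ha, h2 a ha]
      · simpa using h3
      · funext g h
        simp only [Env.setNat_mat, Env.setMat_mat, Term.eval, Idx.eval]
        simp [h3, h4, pow_succ, Matrix.mul_apply]
      · simp [NatTerm.eval, h5])
    (fun ρ' ⟨h1, h2, h3, h4, h5⟩ => by
      simp [Test.holds, NatTerm.eval, h5, h2 1 (by norm_num)]) i1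
  obtain ⟨h1, h2, h3, h4, h5⟩ := i2
  refine ⟨_, (r1.seq (r2.seq (runs_sumCmd rfl hθ))).mono ?_, fun a ha => ?_, fun a ha => ?_,
    fun g h => ?_⟩
  · unfold traceTime
    gcongr
  · have : a ≠ 15 := by omega
    simp [this, h1 a ha]
  · simp [h2 a ha]
  · simp only [Env.setMat_mat, Term.eval, Idx.eval]
    simp [h4, tracePower, Matrix.trace, hD, hL]

/-- The matrix `4 :=` a generalized inverse of the matrix `3`, by Gram–Schmidt orthogonalization. -/
def inverseCmd : Cmd :=
  .seq (assignCmd 4 (.nat (.const 0))) <|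
  forAll 3 <|
    .seq (sumCmd 5 (.mul (.mat 4 (.var 0) (.var 2)) (.mat 3 (.var 2) (.var 1)))) <|
    .seq (assignCmd 6 (.sub (.ind (.var 0) (.var 3)) (.mat 5 (.var 0) (.var 3)))) <|
    .seq (sumCmd 7 (.mul (.mat 3 (.var 0) (.var 2)) (.mat 6 (.var 2) .zero))) <|
    .seq (sumCmd 8 (.mul (.mat 6 (.var 2) .zero) (.mat 7 (.var 2) .zero))) <|
    .seq (assignCmd 9 (.add (.mat 4 (.var 0) (.var 1))
      (.div (.mul (.mat 6 (.var 0) .zero) (.mat 6 (.var 1) .zero)) (.mat 8 .zero .zero))))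
    (assignCmd 4 (.mat 9 (.var 0) (.var 1)))

def inverseTime {R : Type*} [CommSemiring R] (n : R) : R :=
  sumTime n + forTime n (sumTime n + (sumTime n + (sumTime n + (sumTime n + (sumTime n +
    sumTime n)))))

/-- Each round is `gramSchmidtStep`, with `IsPartialInverse.step` as the loop invariant. Once all
basis vectors are treated, L B L = L. -/
theorem runs_inverseCmd (hθ : Idle e θ) (h3 : θ 3 = base e)
    (hL : (Matrix.of (ρ.mat 3)).PosSemidef) :
    ∃ ρ', Runs e θ inverseCmd ρ ρ' (inverseTime (Fintype.card G)) ∧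
      (∀ a, a < 4 ∨ 9 < a → ρ'.mat a = ρ.mat a) ∧ ρ'.nat = ρ.nat ∧
      IsPartialInverse (Matrix.of (ρ.mat 3)) (Matrix.of (ρ'.mat 4)) ∧
      Matrix.of (ρ.mat 3) * Matrix.of (ρ'.mat 4) * Matrix.of (ρ.mat 3) = Matrix.of (ρ.mat 3) := by
  set L : Matrix G G ℝ := Matrix.of (ρ.mat 3) with hLdef
  obtain ⟨ρ', r, h1, h2, h4, h5⟩ := exists_runs_forAll (e := e) (θ := θ) (a := 3)
    (ρ := ρ.setMat 4 fun g h => (Term.nat (.const 0)).eval e ρ (setIdx θ g h (base e)))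
    (T := sumTime (Fintype.card G) + (sumTime (Fintype.card G) + (sumTime (Fintype.card G) +
      (sumTime (Fintype.card G) + (sumTime (Fintype.card G) + sumTime (Fintype.card G))))))
    (c := .seq (sumCmd 5 (.mul (.mat 4 (.var 0) (.var 2)) (.mat 3 (.var 2) (.var 1)))) <|
      .seq (assignCmd 6 (.sub (.ind (.var 0) (.var 3)) (.mat 5 (.var 0) (.var 3)))) <|
      .seq (sumCmd 7 (.mul (.mat 3 (.var 0) (.var 2)) (.mat 6 (.var 2) .zero))) <|
      .seq (sumCmd 8 (.mul (.mat 6 (.var 2) .zero) (.mat 7 (.var 2) .zero))) <|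
      .seq (assignCmd 9 (.add (.mat 4 (.var 0) (.var 1))
        (.div (.mul (.mat 6 (.var 0) .zero) (.mat 6 (.var 1) .zero)) (.mat 8 .zero .zero))))
      (assignCmd 4 (.mat 9 (.var 0) (.var 1))))
    h3
    (fun P ρ' => (∀ a, a < 4 ∨ 9 < a → ρ'.mat a = ρ.mat a) ∧ ρ'.nat = ρ.nat ∧
      IsPartialInverse L (Matrix.of (ρ'.mat 4)) ∧ ∀ j ∈ P,
        L.mulVec ((Matrix.of (ρ'.mat 4)).mulVec (L.mulVec (Pi.single j 1))) =
          L.mulVec (Pi.single j 1))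
    (fun P k hk ρ' ⟨h1, h2, h4, h5⟩ => by
      have hθ' := hθ.update k
      have hs := h4.step hL h5 k
      refine ⟨_, (runs_sumCmd rfl hθ').seq <| (runs_assignCmd rfl hθ').seq <|
        (runs_sumCmd rfl hθ').seq <| (runs_sumCmd rfl hθ').seq <|
        (runs_assignCmd rfl hθ').seq (runs_assignCmd rfl hθ'), fun a ha => ?_, ?_, ?_⟩
      · have : a ≠ 4 ∧ a ≠ 5 ∧ a ≠ 6 ∧ a ≠ 7 ∧ a ≠ 8 ∧ a ≠ 9 := by omega
        simp [this, h1 a ha]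
      · simp [h2]
      · have key : ∀ M : Matrix G G ℝ, M = gramSchmidtStep L (Matrix.of (ρ'.mat 4)) k →
            IsPartialInverse L M ∧ ∀ j ∈ insert k P,
              L.mulVec (M.mulVec (L.mulVec (Pi.single j 1))) = L.mulVec (Pi.single j 1) := by
          rintro _ rfl
          exact hs
        refine key _ ?_
        ext g h
        simp [Term.eval, Idx.eval, gramSchmidtStep, gramSchmidtVec, Matrix.mul_apply,
          h1 3 (by norm_num), hLdef])
    (by
      refine ⟨fun a ha => ?_, rfl, ?_, by simp⟩
      · have : a ≠ 4 := by omega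
        simp [this]
      · convert isPartialInverse_zero L using 1
        ext g h
        simp [Term.eval, NatTerm.eval])
  exact ⟨ρ', (runs_assignCmd rfl hθ).seq r, h1, h2, h4,
    mul_mul_eq_of_forall_single fun j => h5 j (Finset.mem_univ j)⟩

/-- The matrix `c :=` the number of group elements. -/
theorem runs_cardCmd (c : ℕ) (hθ : Idle e θ) :
    Runs e θ (sumCmd c (.nat (.const 1))) ρ (ρ.setMat c fun _ _ => Fintype.card G)
      (sumTime (Fintype.card G)) := by
  have := runs_sumCmd (ρ := ρ) (c := c) (x := .nat (.const 1)) rfl hθ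
  simpa [Term.eval, NatTerm.eval] using this

/-- `a := ⌈x⌉` for the entry `x` of the matrix `30`. -/
def ceilCmd (a : ℕ) : Cmd :=
  .seq (setScalar a (.const 0)) (.loop (Test.realLt (.nat (.var a)) (.mat 30 .zero .zero)).compile
    (setScalar a (.add (.var a) (.const 1))))

theorem runs_ceilCmd (a : ℕ) :
    Runs e θ (ceilCmd a) ρ (ρ.setNat a ⌈ρ.mat 30 (base e) (base e)⌉₊)
      (1 + (⌈ρ.mat 30 (base e) (base e)⌉₊ * (1 + 1) + 1)) := by
  obtain ⟨ρ', r, h⟩ := exists_runs_loop (e := e) (θ := θ) (ρ := ρ.setNat a 0)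
    (b := .realLt (.nat (.var a)) (.mat 30 .zero .zero)) (T := 1)
    (c := setScalar a (.add (.var a) (.const 1))) (K := ⌈ρ.mat 30 (base e) (base e)⌉₊)
    (fun k ρ' => ρ' = ρ.setNat a k)
    (fun k hk ρ' hρ' => by
      subst hρ'
      refine ⟨?_, _, runs_setScalar _ _, ?_⟩
      · simpa [Test.holds, Term.eval, NatTerm.eval, Idx.eval] using Nat.lt_ceil.1 hk
      · simp [Env.setNat, NatTerm.eval])
    (fun ρ' hρ' => by
      subst hρ'
      simpa [Test.holds, Term.eval, NatTerm.eval, Idx.eval] using Nat.le_ceil _) rfl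
  subst h
  exact (runs_setScalar _ _).seq r

/-- `K` is the largest multiple, at most `n`, of the weight of `s` that passes the trace test. -/
structure IsMultiple (B : Matrix G G ℝ) (q : ℕ) (ν : G → ℝ) (s : G) (n k : ℕ) : Prop where
  one_le : 1 ≤ k
  le : k ≤ n
  trace_le : tracePower B q (Pi.single s (k * ν s)) ≤ Fintype.card G
  max : ∀ j, 1 ≤ j → j ≤ n → tracePower B q (Pi.single s (j * ν s)) ≤ Fintype.card G → j ≤ k

/-- Column zero of the matrix `16 :=` the inverse importances. -/
def importanceCmd : Cmd :=
  forAll 3 <| .seq (setScalar 4 (.const 0)) <|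
    .loop (Test.realLt (.nat (.var 4)) (.mat 24 .zero .zero)).compile <|
      .seq (.seq (setScalar 4 (.add (.var 4) (.const 1))) <|
        assignCmd 10 (.mul (.mul (.nat (.var 4)) (.mat 0 (.var 3) .zero))
          (.ind (.var 0) (.var 3)))) <|
      .seq traceCmd <|
      .ite (Test.realLt (.mat 24 .zero .zero) (.mat 15 .zero .zero)).compile .skip
        (setEntry 16 (.var 3) .zero (.nat (.var 4)))

def importanceTime {R : Type*} [CommSemiring R] (n q : R) : R :=
  forTime n (1 + (n * ((1 + sumTime n) + (traceTime n q + (1 + 1)) + 1) + 1))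

/-- All multiples 1, …, N are tried in order and the last one that passes is kept, so it is maximal
without any appeal to monotonicity of the test. -/
theorem runs_importanceCmd (hθ : Idle e θ) (h3 : θ 3 = base e) {Q : ℕ} (hQ : ρ.nat 1 ≤ Q)
    (hn : ρ.mat 24 (base e) (base e) = Fintype.card G) {ν : G → ℝ}
    (hν : ∀ g, ρ.mat 0 g (base e) = ν g)
    (h1 : ∀ s, tracePower (Matrix.of (ρ.mat 4)) (ρ.nat 1) (Pi.single s (ν s)) ≤
      Fintype.card G) :
    ∃ ρ', Runs e θ importanceCmd ρ ρ' (importanceTime (Fintype.card G) Q) ∧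
      (∀ a, a < 10 ∨ 16 < a → ρ'.mat a = ρ.mat a) ∧
      (∀ a, a ≠ 3 → a ≠ 4 → ρ'.nat a = ρ.nat a) ∧
      ∀ s, ∃ k : ℕ, ρ'.mat 16 s (base e) = k ∧
        IsMultiple (Matrix.of (ρ.mat 4)) (ρ.nat 1) ν s (Fintype.card G) k := by
  set B : Matrix G G ℝ := Matrix.of (ρ.mat 4) with hB
  let Frame : Env G → Prop := fun ρ' => (∀ a, a < 10 ∨ 16 < a → ρ'.mat a = ρ.mat a) ∧
    (∀ a, a ≠ 3 → a ≠ 4 → ρ'.nat a = ρ.nat a)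
  let Good : G → ℕ → ℝ → Prop := fun s n x => ∃ k : ℕ, x = k ∧ IsMultiple B (ρ.nat 1) ν s n k
  obtain ⟨ρ', r, h4, h5⟩ := exists_runs_forAll (e := e) (θ := θ) (a := 3) (ρ := ρ)
    (T := 1 + (Fintype.card G * ((1 + sumTime (Fintype.card G)) +
      (traceTime (Fintype.card G) Q + (1 + 1)) + 1) + 1))
    (c := .seq (setScalar 4 (.const 0)) <|
      .loop (Test.realLt (.nat (.var 4)) (.mat 24 .zero .zero)).compile <|
        .seq (.seq (setScalar 4 (.add (.var 4) (.const 1))) <|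
          assignCmd 10 (.mul (.mul (.nat (.var 4)) (.mat 0 (.var 3) .zero))
            (.ind (.var 0) (.var 3)))) <|
        .seq traceCmd <|
        .ite (Test.realLt (.mat 24 .zero .zero) (.mat 15 .zero .zero)).compile .skip
          (setEntry 16 (.var 3) .zero (.nat (.var 4))))
    h3
    (fun P ρ' => Frame ρ' ∧ ∀ s ∈ P, Good s (Fintype.card G) (ρ'.mat 16 s (base e)))
    (fun P s hs ρ₁ ⟨hF, hP⟩ => by
      have hθ' := hθ.update s
      obtain ⟨ρ₂, r, h4, h5, h6, h7⟩ := exists_runs_loop (e := e) (θ := Function.update θ 3 s)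
        (ρ := ρ₁.setNat 4 0)
        (b := .realLt (.nat (.var 4)) (.mat 24 .zero .zero)) (K := Fintype.card G)
        (T := (1 + sumTime (Fintype.card G)) + (traceTime (Fintype.card G) Q + (1 + 1)))
        (c := .seq (.seq (setScalar 4 (.add (.var 4) (.const 1))) <|
          assignCmd 10 (.mul (.mul (.nat (.var 4)) (.mat 0 (.var 3) .zero))
            (.ind (.var 0) (.var 3)))) <|
          .seq traceCmd <|
          .ite (Test.realLt (.mat 24 .zero .zero) (.mat 15 .zero .zero)).compile .skip
            (setEntry 16 (.var 3) .zero (.nat (.var 4))))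
        (fun n ρ' => Frame ρ' ∧ ρ'.nat 4 = n ∧
          (∀ g, g ≠ s → ρ'.mat 16 g (base e) = ρ₁.mat 16 g (base e)) ∧
          (1 ≤ n → Good s n (ρ'.mat 16 s (base e))))
        (fun n hnN ρ₂ ⟨hF₂, hn2, hg2, hgood⟩ => by
          refine ⟨?_, ?_⟩
          · simpa [Test.holds, Term.eval, NatTerm.eval, Idx.eval, hn2, hF₂.1 24 (by norm_num), hn]
              using hnN
          obtain ⟨ρ₃, r₃, h4, h5, h6⟩ : ∃ ρ₃, Runs e (Function.update θ 3 s)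
              (.seq (setScalar 4 (.add (.var 4) (.const 1))) <|
                assignCmd 10 (.mul (.mul (.nat (.var 4)) (.mat 0 (.var 3) .zero))
                (.ind (.var 0) (.var 3)))) ρ₂ ρ₃ (1 + sumTime (Fintype.card G)) ∧
              (∀ a, a ≠ 10 → ρ₃.mat a = ρ₂.mat a) ∧ (∀ a, ρ₃.nat a = if a = 4 then n + 1 else
                ρ₂.nat a) ∧
              (fun g => ρ₃.mat 10 g (base e)) = Pi.single s ((n + 1 : ℕ) * ν s) := by
            refine ⟨_, (runs_setScalar _ _).seq (runs_assignCmd rfl hθ'), fun a ha => ?_,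
              fun a => ?_, ?_⟩
            · simp [ha]
            · simp [NatTerm.eval, hn2]
            · funext g
              have h0 : ρ₂.mat 0 s (base e) = ν s := by rw [hF₂.1 0 (by norm_num), hν]
              by_cases hg : g = s
              · subst hg
                simp [Term.eval, Idx.eval, NatTerm.eval, hn2, h0]
              · simp [Term.eval, Idx.eval, NatTerm.eval, hg]
          obtain ⟨ρ₄, r₄, h7, h8, h9⟩ := runs_traceCmd (ρ := ρ₃) hθ' (Q := Q)
            (by rw [h5, if_neg (by norm_num), hF₂.2 1 (by norm_num) (by norm_num)]; exact hQ)
          rw [h6, h4 4 (by norm_num), hF₂.1 4 (by norm_num), h5, if_neg (by norm_num),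
            hF₂.2 1 (by norm_num) (by norm_num), ← hB] at h9
          have hF₄ : Frame ρ₄ := by
            refine ⟨fun a ha => ?_, fun a ha ha' => ?_⟩
            · rw [h7 a (by omega), h4 a (by omega), hF₂.1 a ha]
            · rw [h8 a ha, h5, if_neg ha', hF₂.2 a ha ha']
          have hn4 : ρ₄.nat 4 = n + 1 := by rw [h8 4 (by norm_num), h5, if_pos rfl]
          have h16 : ρ₄.mat 16 = ρ₂.mat 16 := by rw [h7 16 (by norm_num), h4 16 (by norm_num)]
          have htest : (Test.realLt (.mat 24 .zero .zero) (.mat 15 .zero .zero)).holds e ρ₄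
              (Function.update θ 3 s) ↔ ¬ tracePower B (ρ.nat 1)
                (Pi.single s ((n + 1 : ℕ) * ν s)) ≤ Fintype.card G := by
            simp only [Test.holds, Term.eval, Idx.eval, hF₄.1 24 (by norm_num), hn, h9, not_le]
          by_cases hle : tracePower B (ρ.nat 1) (Pi.single s ((n + 1 : ℕ) * ν s)) ≤
              Fintype.card G
          · refine ⟨_, r₃.seq (r₄.seq (runs_ite_false (fun h => htest.1 h hle)
              (runs_setEntry _ _ _ _) _)), ⟨fun a ha => ?_, fun a ha ha' => ?_⟩, ?_, ?_, ?_⟩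
            · have : a ≠ 16 := by omega
              simp [this, hF₄.1 a ha]
            · simp [hF₄.2 a ha ha']
            · simp [hn4]
            · intro g hg
              simp [Idx.eval, hg, h16, hg2 g hg]
            · intro _
              refine ⟨n + 1, ?_, by omega, le_rfl, hle, fun j _ hj _ => hj⟩
              simp [Idx.eval, Term.eval, NatTerm.eval, hn4]
          · refine ⟨ρ₄, r₃.seq (r₄.seq (runs_ite_true (htest.2 hle) runs_skip _)), hF₄, hn4,
              fun g hg => by rw [h16, hg2 g hg], fun _ => ?_⟩
            -- The multiple 1 always passes, so a failed test has a recorded predecessor.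
            rcases Nat.eq_zero_or_pos n with rfl | hn0
            · exact absurd (by simpa using h1 s) hle
            · obtain ⟨k, hk, hk1, hk2, hk3, hk4⟩ := hgood hn0
              refine ⟨k, by rw [h16, hk], hk1, by omega, hk3, fun j hj1 hj2 hj3 => ?_⟩
              rcases hj2.eq_or_lt with rfl | hj2
              · exact absurd hj3 hle
              · exact hk4 j hj1 (by omega) hj3)
        (fun ρ₂ ⟨hF₂, hn2, _⟩ => by
          simp [Test.holds, Term.eval, NatTerm.eval, Idx.eval, hn2, hF₂.1 24 (by norm_num), hn])
        (by
          refine ⟨⟨fun a ha => ?_, fun a ha ha' => ?_⟩, ?_, fun g _ => ?_, fun h => ?_⟩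
          · simp [hF.1 a ha]
          · simp [ha', hF.2 a ha ha']
          · simp
          · simp
          · omega)
      refine ⟨ρ₂, (runs_setScalar _ _).seq r, h4, fun g hg => ?_⟩
      by_cases hgs : g = s
      · subst hgs; exact h7 Fintype.card_pos
      · rw [h6 g hgs]
        exact hP g ((Finset.mem_insert.1 hg).resolve_left hgs))
    ⟨⟨fun _ _ => rfl, fun _ _ _ => rfl⟩, by simp⟩
  exact ⟨ρ', r, h4.1, h4.2, fun s => h5 s (Finset.mem_univ s)⟩

end Commands

end CayleySparsification

namespace CayleySparsification

/-! ## Parameters -/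

section Parameters

/-- The number of steps of the greedy phase, up to the factor `Z` and rounding. -/
noncomputable def stepScale (n : ℕ) (η : ℝ) : ℝ := (Nat.clog 2 n + 1) / (η * η)

theorem stepScale_pos (n : ℕ) {η : ℝ} (hη : 0 < η) : 0 < stepScale n η := by
  unfold stepScale
  positivity

theorem le_two_pow_clog (n : ℕ) : n ≤ 2 ^ Nat.clog 2 n := Nat.le_pow_clog (by norm_num) n

/-- Rounding up gives m / Z between `stepScale` and `stepScale` + 1; hence the summand 8 in q, which
covers 4(m / Z) + 4. The + 1 in `stepScale` pays for the factor 2 in 2n ≤ 2^(⌈log₂ n⌉ + 1) ≤ exp(η²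
m / Z). -/
theorem greedyParams_of_eq {n q m : ℕ} {η Z : ℝ} (hη : 0 < η) (hη1 : η ≤ 1 / 10) (hZ : 1 ≤ Z)
    (hq : q = ⌈4 * stepScale n η + (8 + Nat.clog 2 n : ℕ)⌉₊) (hm : m = ⌈Z * stepScale n η⌉₊) :
    GreedyParams (2 * n) q η Z m := by
  have hM := stepScale_pos n hη
  have hZ0 : 0 < Z := by linarith
  have h1 : stepScale n η ≤ m / Z := by
    rw [le_div_iff₀ hZ0, hm, mul_comm]
    exact Nat.le_ceil _
  have h2 : (m : ℝ) / Z ≤ stepScale n η + 1 := by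
    rw [div_le_iff₀ hZ0, hm]
    have := (Nat.ceil_lt_add_one (mul_pos hZ0 hM).le).le
    nlinarith
  refine ⟨hη, hη1, hZ, ?_, hM.trans_le h1, ?_⟩
  · have h3 : ((Nat.clog 2 n : ℝ) + 1) ≤ η ^ 2 * (m / Z) := by
      calc ((Nat.clog 2 n : ℝ) + 1) = η ^ 2 * stepScale n η := by
            unfold stepScale; field_simp
        _ ≤ _ := by gcongr
    refine le_trans ?_ (Real.exp_le_exp.2 h3)
    have h4 : (n : ℝ) ≤ 2 ^ Nat.clog 2 n := by exact_mod_cast le_two_pow_clog n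
    calc (2 * n : ℝ) ≤ 2 ^ (Nat.clog 2 n + 1) := by rw [pow_succ]; linarith
      _ ≤ Real.exp 1 ^ (Nat.clog 2 n + 1) := by
        gcongr
        linarith [Real.add_one_le_exp 1]
      _ = _ := by rw [← Real.exp_nat_mul]; push_cast; ring_nf
  · have h3 := Nat.le_ceil (4 * stepScale n η + (8 + Nat.clog 2 n : ℕ))
    rw [← hq] at h3
    push_cast at h3
    have h4 : (0 : ℝ) ≤ Nat.clog 2 n := by positivity
    linarith

theorem card_le_two_pow {n q : ℕ} {η : ℝ} (hη : 0 < η)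
    (hq : q = ⌈4 * stepScale n η + (8 + Nat.clog 2 n : ℕ)⌉₊) : n ≤ 2 ^ q := by
  refine (le_two_pow_clog n).trans (Nat.pow_le_pow_right (by norm_num) ?_)
  have h3 := Nat.le_ceil (4 * stepScale n η + (8 + Nat.clog 2 n : ℕ))
  rw [← hq] at h3
  push_cast at h3
  have := stepScale_pos n hη
  have h5 : (Nat.clog 2 n : ℝ) ≤ q := by linarith
  exact_mod_cast h5

/-- An upper bound for `stepScale`. -/
def scaleBound {R : Type*} [CommSemiring R] (n : R) : R := 100 * ((n + 1) * n)

/-- An upper bound for the exponent `q`. -/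
def exponentBound {R : Type*} [CommSemiring R] (n : R) : R := 4 * scaleBound n + 9 + n

/-- An upper bound for the number of steps. -/
def stepBound {R : Type*} [CommSemiring R] (n : R) : R := n * scaleBound n

theorem clog_two_le (n : ℕ) : Nat.clog 2 n ≤ n :=
  Nat.clog_le_of_le_pow Nat.lt_two_pow_self.le

/-- Here ε² n ≥ 1 turns 1 / η² = 100 / ε² into at most 100 n, so all parameters become polynomial in
n. -/
theorem stepScale_le {n : ℕ} {ε : ℝ} (hε : 0 < ε) (h : 1 ≤ ε * ε * n) :
    stepScale n (ε / 10) ≤ scaleBound (n : ℝ) := by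
  have h1 : (Nat.clog 2 n : ℝ) ≤ n := by exact_mod_cast clog_two_le n
  rw [stepScale, scaleBound, div_le_iff₀ (by positivity)]
  have h2 : (0 : ℝ) ≤ (n : ℝ) + 1 := by positivity
  nlinarith

theorem exponent_le {n : ℕ} {ε : ℝ} (hε : 0 < ε) (h : 1 ≤ ε * ε * n) :
    ⌈4 * stepScale n (ε / 10) + (8 + Nat.clog 2 n : ℕ)⌉₊ ≤ exponentBound n := by
  refine Nat.ceil_le.2 ?_
  have h1 : (Nat.clog 2 n : ℝ) ≤ n := by exact_mod_cast clog_two_le n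
  have h2 := stepScale_le hε h
  simp only [exponentBound, scaleBound] at h2 ⊢
  push_cast
  linarith

theorem steps_le {n : ℕ} {ε Z : ℝ} (hε : 0 < ε) (h : 1 ≤ ε * ε * n) (hZ : Z ≤ n) :
    ⌈Z * stepScale n (ε / 10)⌉₊ ≤ stepBound n := by
  refine Nat.ceil_le.2 ?_
  have h2 := stepScale_le hε h
  have h3 := stepScale_pos n (η := ε / 10) (by positivity)
  calc Z * stepScale n (ε / 10) ≤ n * scaleBound (n : ℝ) := by gcongr
    _ = _ := by simp [stepBound, scaleBound]

end Parameters

/-! ### Computing the exponent and the step scale -/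

section Phases

/-- `c[0, 0] := x`. -/
def setReal (c : ℕ) (x : Term) : Cmd := setEntry c .zero .zero x

/-- The entry `[0, 0]` of the matrix `c`. -/
def Term.real (c : ℕ) : Term := .mat c .zero .zero

/-- The entry `[i, 0]` of the matrix `c` for the loop variable `i` number `a`. -/
def Term.col (c a : ℕ) : Term := .mat c (.var a) .zero

/-- Scalar `0 := ⌈log₂ n⌉`, scalar `1 := q`, for the order `n` of the group in the matrix `24`;
the matrix `29 :=` the value of `stepScale`. -/
def parameterCmd : Cmd :=
  .seq (.seq (setReal 28 (.nat (.const 1))) (setScalar 0 (.const 0))) <|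
  .seq (.loop (Test.realLt (.real 28) (.real 24)).compile
    (.seq (setReal 28 (.add (.real 28) (.real 28))) (setScalar 0 (.add (.var 0) (.const 1))))) <|
  .seq (.seq (setReal 31 (.div (.real 1) (.nat (.const 10)))) <|
    .seq (setReal 29 (.div (.nat (.add (.var 0) (.const 1))) (.mul (.real 31) (.real 31))))
    (setReal 30 (.add (.mul (.nat (.const 4)) (.real 29)) (.nat (.add (.const 8) (.var 0))))))
  (ceilCmd 1)

def parameterTime {R : Type*} [CommSemiring R] (l q : R) : R :=
  1 + 1 + ((l * (1 + 1 + 1) + 1) + ((1 + (1 + 1)) + (1 + (q * (1 + 1) + 1))))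

variable {G : Type*} [Group G] [Fintype G] [DecidableEq G]
  {e : G ≃ Fin (Fintype.card G)} {θ : ℕ → G} {ρ : Env G}

theorem runs_setReal (c : ℕ) (x : Term) :
    Runs e θ (setReal c x) ρ (ρ.setMat c fun g h => if g = base e ∧ h = base e then x.eval e ρ θ
      else ρ.mat c g h) 1 := runs_setEntry c .zero .zero x

@[simp] theorem Term.eval_real (c : ℕ) : (Term.real c).eval e ρ θ = ρ.mat c (base e) (base e) := rfl

@[simp] theorem Term.eval_col (c a : ℕ) : (Term.col c a).eval e ρ θ = ρ.mat c (θ a) (base e) := rfl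

/-- ⌈log₂ n⌉ is found by repeated doubling, and the rounding of q by counting upwards, since the
machine has no conversion of reals to indices. -/
theorem runs_parameterCmd {ε : ℝ} (hn : ρ.mat 24 (base e) (base e) = Fintype.card G)
    (hε : ρ.mat 1 (base e) (base e) = ε) :
    ∃ ρ', Runs e θ parameterCmd ρ ρ' (parameterTime (Nat.clog 2 (Fintype.card G)) (ρ'.nat 1)) ∧
      (∀ a < 28, ρ'.mat a = ρ.mat a) ∧
      ρ'.nat 1 = ⌈4 * stepScale (Fintype.card G) (ε / 10) +
        (8 + Nat.clog 2 (Fintype.card G) : ℕ)⌉₊ ∧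
      ρ'.mat 29 (base e) (base e) = stepScale (Fintype.card G) (ε / 10) ∧
      ρ'.mat 31 (base e) (base e) = ε / 10 := by
  obtain ⟨ρ₂, r₂, h1, h2, h3⟩ := exists_runs_loop (e := e) (θ := θ)
    (ρ := (ρ.setMat 28 fun g h => if g = base e ∧ h = base e then
      (Term.nat (.const 1)).eval e ρ θ else ρ.mat 28 g h).setNat 0 0)
    (b := .realLt (.real 28) (.real 24)) (T := 1 + 1)
    (c := .seq (setReal 28 (.add (.real 28) (.real 28))) (setScalar 0 (.add (.var 0) (.const 1))))
    (K := Nat.clog 2 (Fintype.card G))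
    (fun k ρ' => (∀ a < 28, ρ'.mat a = ρ.mat a) ∧ ρ'.nat 0 = k ∧
      ρ'.mat 28 (base e) (base e) = 2 ^ k)
    (fun k hk ρ' ⟨h1, h2, h3⟩ => by
      refine ⟨?_, _, (runs_setReal _ _).seq (runs_setScalar _ _), fun a ha => ?_, ?_, ?_⟩
      · have := (Nat.lt_clog_iff_pow_lt (by norm_num)).1 hk
        simp only [Test.holds, Term.eval_real, h3, h1 24 (by norm_num), hn]
        exact_mod_cast this
      · have : a ≠ 28 := by omega
        simp [this, h1 a ha]
      · simp [NatTerm.eval, h2]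
      · simp [Term.eval, h3, pow_succ, mul_two])
    (fun ρ' ⟨h1, h2, h3⟩ => by
      simp only [Test.holds, Term.eval_real, h3, h1 24 (by norm_num), hn, not_lt]
      exact_mod_cast le_two_pow_clog _)
    (by
      refine ⟨fun a ha => ?_, ?_, ?_⟩
      · have : a ≠ 28 := by omega
        simp [this]
      · simp
      · simp [Term.eval, NatTerm.eval])
  have h4 := h1 1 (by norm_num)
  refine ⟨_, (((runs_setReal _ _).seq (runs_setScalar _ _)).seq (r₂.seq
    (((runs_setReal _ _).seq ((runs_setReal _ _).seq (runs_setReal _ _))).seq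
    (runs_ceilCmd _)))).mono ?_, fun a ha => ?_, ?_, ?_, ?_⟩
  · simp [parameterTime]
  · have : a ≠ 29 ∧ a ≠ 30 ∧ a ≠ 31 := by omega
    simp [this, h1 a ha]
  · simp [Term.eval, NatTerm.eval, h2, h4, hε, stepScale]
  · simp [Term.eval, NatTerm.eval, h2, h4, hε, stepScale]
  · simp [Term.eval, NatTerm.eval, h4, hε]

end Phases

end CayleySparsification

namespace CayleySparsification

/-! ### Preparing the data of the greedy phase -/

section Phases

variable {G : Type*} [Group G] [Fintype G] [DecidableEq G]
  {e : G ≃ Fin (Fintype.card G)} {θ : ℕ → G} {ρ : Env G}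

/-- The memory cells that the greedy phase reads but does not change. -/
structure Prepared (e : G ≃ Fin (Fintype.card G)) (ρ : Env G) (ν : G → ℝ) (B : Matrix G G ℝ)
    (q : ℕ) (K : G → ℕ) (η : ℝ) (m : ℕ) : Prop where
  weight : ∀ g, ρ.mat 0 g (base e) = ν g
  inverse : Matrix.of (ρ.mat 4) = B
  importance : ∀ g, ρ.mat 16 g (base e) = K g
  total : ρ.mat 17 (base e) (base e) = ∑ s, (1 : ℝ) / K s
  card : ρ.mat 24 (base e) (base e) = Fintype.card G
  scale : ρ.mat 25 (base e) (base e) = η / q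
  upper : ρ.mat 26 (base e) (base e) = 1 + η * (1 + 4 * η) / ∑ s, (1 : ℝ) / K s
  lower : ρ.mat 27 (base e) (base e) = 1 - η * (1 - 4 * η) / ∑ s, (1 : ℝ) / K s
  exponent : ρ.nat 1 = q
  steps : ρ.nat 2 = m

variable {ν : G → ℝ} {B : Matrix G G ℝ} {q : ℕ} {K : G → ℕ} {η : ℝ} {m : ℕ}

theorem Prepared.congr (h : Prepared e ρ ν B q K η m) {ρ' : Env G}
    (h1 : ∀ a ∈ [0, 4, 16, 17, 24, 25, 26, 27], ρ'.mat a = ρ.mat a)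
    (h2 : ∀ a ∈ [1, 2], ρ'.nat a = ρ.nat a) : Prepared e ρ' ν B q K η m where
  weight g := by rw [h1 0 (by simp), h.weight]
  inverse := by rw [h1 4 (by simp), h.inverse]
  importance g := by rw [h1 16 (by simp), h.importance]
  total := by rw [h1 17 (by simp), h.total]
  card := by rw [h1 24 (by simp), h.card]
  scale := by rw [h1 25 (by simp), h.scale]
  upper := by rw [h1 26 (by simp), h.upper]
  lower := by rw [h1 27 (by simp), h.lower]
  exponent := by rw [h2 1 (by simp), h.exponent]
  steps := by rw [h2 2 (by simp), h.steps]

/-- The Laplacian, its inverse, the inverse importances and the remaining parameters. -/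
def prepareCmd : Cmd :=
  .seq parameterCmd <| .seq (sumCmd 3 (lapTerm 0)) <| .seq inverseCmd <| .seq importanceCmd <|
  .seq (.seq (sumCmd 17 (.div (.nat (.const 1)) (.col 16 2))) <|
    setReal 30 (.mul (.real 17) (.real 29))) <|
  .seq (ceilCmd 2) <|
  .seq (setReal 25 (.div (.real 31) (.nat (.var 1)))) <|
  .seq (setReal 26 (.add (.nat (.const 1)) (.div (.mul (.real 31)
    (.add (.nat (.const 1)) (.mul (.nat (.const 4)) (.real 31)))) (.real 17))))
  (setReal 27 (.sub (.nat (.const 1)) (.div (.mul (.real 31)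
    (.sub (.nat (.const 1)) (.mul (.nat (.const 4)) (.real 31)))) (.real 17))))

def prepareTime {R : Type*} [CommSemiring R] (n : R) : R :=
  parameterTime n (exponentBound n) + (sumTime n + (inverseTime n +
    (importanceTime n (exponentBound n) + ((sumTime n + 1) +
      ((1 + (stepBound n * (1 + 1) + 1)) + (1 + (1 + 1)))))))

/-- Besides the memory contents this provides `GreedySetup` and the maximality of K, the two inputs
of the correctness proof, together with polynomial bounds on q and m. -/
theorem runs_prepareCmd (hθ : Idle e θ) (h3 : θ 3 = base e) {ε : ℝ} (hε : 0 < ε) (hε1 : ε ≤ 1)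
    (hεn : 1 ≤ ε * ε * Fintype.card G)
    (hn : ρ.mat 24 (base e) (base e) = Fintype.card G) (hρε : ρ.mat 1 (base e) (base e) = ε)
    (hν : ∀ g, 0 ≤ ν g) (hρν : ∀ g, ρ.mat 0 g (base e) = ν g) :
    ∃ ρ' B q K m, Runs e θ prepareCmd ρ ρ' (prepareTime (Fintype.card G)) ∧
      Prepared e ρ' ν B q K (ε / 10) m ∧ GreedySetup ν B q K (ε / 10) m ∧
      (∀ s, ∀ j, 1 ≤ j → j ≤ Fintype.card G →
        tracePower B q (Pi.single s (j * ν s)) ≤ Fintype.card G → j ≤ K s) ∧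
      m = ⌈(∑ s, (1 : ℝ) / K s) * stepScale (Fintype.card G) (ε / 10)⌉₊ ∧
      q ≤ exponentBound (Fintype.card G) ∧ m ≤ stepBound (Fintype.card G) := by
  obtain ⟨ρ₁, r₁, h4, h5, h6, h7⟩ := runs_parameterCmd (θ := θ) hn hρε
  obtain ⟨q, hq⟩ : ∃ q, q = ρ₁.nat 1 := ⟨_, rfl⟩
  rw [← hq] at r₁ h5
  have hqQ : q ≤ exponentBound (Fintype.card G) := h5 ▸ exponent_le hε hεn
  have hq0 : q ≠ 0 := by
    have h8 := Nat.le_ceil (4 * stepScale (Fintype.card G) (ε / 10) +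
      (8 + Nat.clog 2 (Fintype.card G) : ℕ))
    have := stepScale_pos (Fintype.card G) (η := ε / 10) (by positivity)
    rw [← h5] at h8
    push_cast at h8
    have h9 : (0 : ℝ) < q := by
      have : (0 : ℝ) ≤ Nat.clog 2 (Fintype.card G) := by positivity
      linarith
    exact_mod_cast h9.ne'
  obtain ⟨ρ₂, r₂, h8, h9, h10⟩ : ∃ ρ₂, Runs e θ (sumCmd 3 (lapTerm 0)) ρ₁ ρ₂
      (sumTime (Fintype.card G)) ∧ (∀ a, a ≠ 3 → ρ₂.mat a = ρ₁.mat a) ∧ ρ₂.nat = ρ₁.nat ∧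
      Matrix.of (ρ₂.mat 3) = lap ν := by
    refine ⟨_, runs_sumCmd rfl hθ, fun a ha => by simp [ha], rfl, ?_⟩
    ext g h
    simp only [Env.setMat_mat, if_true, Matrix.of_apply, sum_lapTerm, h4 0 (by norm_num), hρν]
  obtain ⟨ρ₃, r₃, h11, h12, h13, h14⟩ := runs_inverseCmd (ρ := ρ₂) hθ h3
    (by rw [h10]; exact lap_posSemidef hν)
  rw [h10] at h13 h14
  obtain ⟨B, hB⟩ : ∃ B, B = Matrix.of (ρ₃.mat 4) := ⟨_, rfl⟩
  rw [← hB] at h13 h14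
  have hq3 : ρ₃.nat 1 = q := by rw [h12, h9, hq]
  have hm3 : ∀ a < 28, a < 3 ∨ 9 < a → ρ₃.mat a = ρ.mat a := fun a ha ha' => by
    rw [h11 a (by omega), h8 a (by omega), h4 a ha]
  obtain ⟨ρ₄, r₄, h15, h16, h17⟩ := runs_importanceCmd (ρ := ρ₃) hθ h3 (ν := ν)
    (Q := exponentBound (Fintype.card G)) (hq3.trans_le hqQ)
    (by rw [hm3 24 (by norm_num) (by norm_num), hn])
    (fun g => by rw [hm3 0 (by norm_num) (by norm_num), hρν])
    (fun s => by
      rw [← hB, hq3]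
      exact tracePower_single_le h13 hq0 (hν s) fun x =>
        Finset.single_le_sum (f := fun t => ν t * ‖shiftDiff t x‖ ^ 2)
          (fun t _ => mul_nonneg (hν t) (by positivity)) (Finset.mem_univ s))
  rw [← hB, hq3] at h17
  choose K hK hmax using h17
  obtain ⟨Z, hZ⟩ : ∃ Z, Z = ∑ s, (1 : ℝ) / K s := ⟨_, rfl⟩
  -- The cap K ≤ N gives Z ≥ 1, and K ≥ 1 gives Z ≤ N.
  have hZ1 : 1 ≤ Z := by
    have hc : (0 : ℝ) < Fintype.card G := by exact_mod_cast Fintype.card_pos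
    calc (1 : ℝ) = ∑ s : G, (1 : ℝ) / Fintype.card G := by simp [hc.ne']
      _ ≤ Z := by
        rw [hZ]
        refine Finset.sum_le_sum fun s _ => ?_
        have h1 : (0 : ℝ) < K s := by exact_mod_cast (hmax s).one_le
        have h2 : (K s : ℝ) ≤ Fintype.card G := by exact_mod_cast (hmax s).le
        gcongr
  have hZn : Z ≤ Fintype.card G := by
    calc Z ≤ ∑ s : G, (1 : ℝ) := by
          rw [hZ]
          refine Finset.sum_le_sum fun s _ => ?_
          have h1 : (1 : ℝ) ≤ K s := by exact_mod_cast (hmax s).one_le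
          rw [div_le_one (by linarith)]
          exact h1
      _ = _ := by simp
  obtain ⟨m, hm⟩ : ∃ m, m = ⌈Z * stepScale (Fintype.card G) (ε / 10)⌉₊ := ⟨_, rfl⟩
  have hmM : m ≤ stepBound (Fintype.card G) := hm ▸ steps_le hε hεn hZn
  have hm4 : ∀ a, 16 < a → ρ₄.mat a = ρ₁.mat a := fun a ha => by
    rw [h15 a (by omega), h11 a (by omega), h8 a (by omega)]
  have hq4 : ρ₄.nat 1 = q := by rw [h16 1 (by norm_num) (by norm_num), hq3]
  have h29 : ρ₄.mat 29 (base e) (base e) = stepScale (Fintype.card G) (ε / 10) := by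
    rw [hm4 29 (by norm_num), h6]
  have h31 : ρ₄.mat 31 (base e) (base e) = ε / 10 := by rw [hm4 31 (by norm_num), h7]
  obtain ⟨ρ₅, r₅, h18, h19, h20, h21⟩ : ∃ ρ₅, Runs e θ
      (.seq (sumCmd 17 (.div (.nat (.const 1)) (.col 16 2))) <|
        setReal 30 (.mul (.real 17) (.real 29))) ρ₄ ρ₅ (sumTime (Fintype.card G) + 1) ∧
      (∀ a, a ≠ 17 → a ≠ 30 → ρ₅.mat a = ρ₄.mat a) ∧ ρ₅.nat = ρ₄.nat ∧
      ρ₅.mat 17 (base e) (base e) = Z ∧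
      ρ₅.mat 30 (base e) (base e) = Z * stepScale (Fintype.card G) (ε / 10) := by
    refine ⟨_, (runs_sumCmd rfl hθ).seq (runs_setReal _ _), fun a ha ha' => by simp [ha, ha'],
      rfl, ?_, ?_⟩
    · simp [Term.eval, NatTerm.eval, hK, hZ]
    · simp [Term.eval, NatTerm.eval, hK, hZ, h29]
  have r₆ := runs_ceilCmd (e := e) (θ := θ) (ρ := ρ₅) 2
  rw [h21, ← hm] at r₆
  have hmat5 : ∀ a, a ≠ 17 → a ≠ 30 → (ρ₅.setNat 2 m).mat a = ρ₄.mat a := fun a ha ha' =>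
    h18 a ha ha'
  refine ⟨_, B, q, K, m, (r₁.seq (r₂.seq (r₃.seq (r₄.seq (r₅.seq (r₆.seq ((runs_setReal _ _).seq
    ((runs_setReal _ _).seq (runs_setReal _ _))))))))).mono ?_, ⟨fun g => ?_, ?_, fun g => ?_, ?_,
    ?_, ?_, ?_, ?_, ?_, ?_⟩, ⟨hν, h13, h14, hq0, card_le_two_pow (by positivity) h5,
    fun s => (hmax s).one_le, fun s => (hmax s).trace_le, ?_⟩, fun s => (hmax s).max, ?_, hqQ, hmM⟩
  · simp only [prepareTime, parameterTime]
    have := clog_two_le (Fintype.card G)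
    gcongr
  · simp [h18, h15, hm3, hρν]
  · simp [h18, h15, hB]
  · simp [h18, hK]
  · simp [h20, hZ]
  · simp [h18, h15, hm3, hn]
  · simp [Term.eval, NatTerm.eval, h18, h31, h19, hq4]
  · simp [Term.eval, NatTerm.eval, h18, h31, h20, hZ]
  · simp [Term.eval, NatTerm.eval, h18, h31, h20, hZ]
  · simp [h19, hq4]
  · simp
  · rw [← hZ]
    exact greedyParams_of_eq (by positivity) (by linarith) hZ1 h5 hm
  · rw [hm, hZ]

end Phases

end CayleySparsification

namespace CayleySparsification

/-! ### The greedy phase as a program -/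

section Greedy

/-- One evaluation of the potential: the matrices `21` and `15` receive the traces at the weight
functions `ν + a y` and `ν - a y`, for `y` in the matrix `19` and `a` in the matrix `25`. -/
def potentialCmd : Cmd :=
  .seq (assignCmd 10 (.add (.col 0 0) (.mul (.real 25) (.col 19 0)))) <|
  .seq traceCmd <|
  .seq (.seq (setReal 21 (.real 15))
    (assignCmd 10 (.sub (.col 0 0) (.mul (.real 25) (.col 19 0))))) traceCmd

def potentialTime {R : Type*} [CommSemiring R] (n q : R) : R :=
  sumTime n + (traceTime n q + ((1 + sumTime n) + traceTime n q))

/-- The matrix `20 :=` the last candidate for which the potential is at most `2 n`. -/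
def chooseCmd : Cmd :=
  forAll 3 <|
    .seq (assignCmd 19 (.add (.col 18 0) (.mul (.mul (.col 16 3) (.col 0 3))
      (.ind (.var 0) (.var 3))))) <|
    .seq potentialCmd <|
    .ite (Test.realLt (.add (.real 24) (.real 24))
      (.add (.div (.real 21) (.real 22)) (.div (.real 15) (.real 23)))).compile .skip
      (assignCmd 20 (.mat 19 (.var 0) (.var 1)))

def chooseTime {R : Type*} [CommSemiring R] (n q : R) : R :=
  forTime n (sumTime n + (potentialTime n q + (sumTime n + 1)))

/-- The greedy phase, followed by the symmetrization of its result. -/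
def greedyCmd : Cmd :=
  .seq (.seq (assignCmd 18 (.nat (.const 0))) <| .seq (setReal 22 (.real 26)) <|
    .seq (setReal 23 (.real 27)) (setScalar 5 (.const 0))) <|
  .seq (.loop (Test.natLt (.var 5) (.var 2)).compile <|
    .seq chooseCmd <| .seq (assignCmd 18 (.mat 20 (.var 0) (.var 1))) <|
    .seq (setReal 22 (.mul (.real 22) (.real 26))) <|
    .seq (setReal 23 (.mul (.real 23) (.real 27))) (setScalar 5 (.add (.var 5) (.const 1)))) <|
  -- Inverses are not available as indices; the equation g k g = g singles out k = g⁻¹ without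
  -- naming the identity element.
  sumCmd 2 (.mul (.ind (.mul (.mul (.var 0) (.var 2)) (.var 0)) (.var 0))
    (.mul (.div (.add (.col 18 0) (.col 18 2)) (.nat (.const 2)))
      (.div (.real 17) (.nat (.var 2)))))

def greedyTime {R : Type*} [CommSemiring R] (n q m : R) : R :=
  (sumTime n + (1 + (1 + 1))) + ((m * (chooseTime n q + (sumTime n + (1 + (1 + 1))) + 1) + 1) +
    sumTime n)

variable {G : Type*} [Group G] [Fintype G] [DecidableEq G]
  {e : G ≃ Fin (Fintype.card G)} {θ : ℕ → G} {ρ : Env G}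
  {ν : G → ℝ} {B : Matrix G G ℝ} {q : ℕ} {K : G → ℕ} {η : ℝ} {m : ℕ}

theorem runs_potentialCmd (hθ : Idle e θ) {Q : ℕ} (hq : q ≤ Q) (h : Prepared e ρ ν B q K η m)
    {y : G → ℝ} (hy : ∀ g, ρ.mat 19 g (base e) = y g) :
    ∃ ρ', Runs e θ potentialCmd ρ ρ' (potentialTime (Fintype.card G) Q) ∧
      (∀ a, a < 10 ∨ 15 < a → a ≠ 21 → ρ'.mat a = ρ.mat a) ∧
      (∀ a, a ≠ 3 → ρ'.nat a = ρ.nat a) ∧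
      ρ'.mat 21 (base e) (base e) = tracePower B q (ν + (η / q) • y) ∧
      ρ'.mat 15 (base e) (base e) = tracePower B q (ν - (η / q) • y) := by
  obtain ⟨ρ₁, r₁, h1, h2, h3⟩ : ∃ ρ₁, Runs e θ
      (assignCmd 10 (.add (.col 0 0) (.mul (.real 25) (.col 19 0)))) ρ ρ₁
      (sumTime (Fintype.card G)) ∧ (∀ a, a ≠ 10 → ρ₁.mat a = ρ.mat a) ∧ ρ₁.nat = ρ.nat ∧
      (fun g => ρ₁.mat 10 g (base e)) = ν + (η / q) • y :=
    ⟨_, runs_assignCmd rfl hθ, fun a ha => by simp [ha], rfl, by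
      funext g
      simp [Term.eval, h.weight, h.scale, hy]⟩
  obtain ⟨ρ₂, r₂, h4, h5, h6⟩ := runs_traceCmd (ρ := ρ₁) hθ (Q := Q)
    (by rw [h2, h.exponent]; exact hq)
  rw [h3, h1 4 (by norm_num), h2, h.inverse, h.exponent] at h6
  have hm2 : ∀ a, a < 10 ∨ 15 < a → ρ₂.mat a = ρ.mat a := fun a ha => by
    rw [h4 a (by omega), h1 a (by omega)]
  have hn2 : ∀ a, a ≠ 3 → ρ₂.nat a = ρ.nat a := fun a ha => by rw [h5 a ha, h2]
  obtain ⟨ρ₃, r₃, h7, h8, h9, h10⟩ : ∃ ρ₃, Runs e θ (.seq (setReal 21 (.real 15))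
      (assignCmd 10 (.sub (.col 0 0) (.mul (.real 25) (.col 19 0))))) ρ₂ ρ₃
      (1 + sumTime (Fintype.card G)) ∧
      (∀ a, a < 10 ∨ 15 < a → a ≠ 21 → ρ₃.mat a = ρ.mat a) ∧ ρ₃.nat = ρ₂.nat ∧
      (fun g => ρ₃.mat 10 g (base e)) = ν - (η / q) • y ∧
      ρ₃.mat 21 (base e) (base e) = tracePower B q (ν + (η / q) • y) := by
    refine ⟨_, (runs_setReal _ _).seq (runs_assignCmd rfl hθ), fun a ha ha' => ?_, rfl, ?_, ?_⟩
    · have : a ≠ 10 := by omega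
      simp [this, ha', hm2 a ha]
    · funext g
      simp [Term.eval, hm2, h.weight, h.scale, hy]
    · simp [h6]
  have hm3 : ∀ a < 10, ρ₃.mat a = ρ.mat a := fun a ha => h7 a (by omega) (by omega)
  obtain ⟨ρ₄, r₄, h11, h12, h13⟩ := runs_traceCmd (ρ := ρ₃) hθ (Q := Q)
    (by rw [h8, hn2 1 (by norm_num), h.exponent]; exact hq)
  rw [h9, hm3 4 (by norm_num), h8, hn2 1 (by norm_num), h.inverse, h.exponent] at h13
  refine ⟨ρ₄, ?_, fun a ha ha' => ?_, fun a ha => ?_, ?_, h13 _ _⟩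
  · exact r₁.seq (r₂.seq (r₃.seq r₄))
  · rw [h11 a (by omega), h7 a ha ha']
  · rw [h12 a ha, h8, hn2 a ha]
  · rw [h11 21 (by norm_num), h10]

theorem runs_chooseCmd (hθ : Idle e θ) (hθ3 : θ 3 = base e) {Q : ℕ} (hq : q ≤ Q)
    (h : Prepared e ρ ν B q K η m) {x : G → ℝ} (hx : ∀ g, ρ.mat 18 g (base e) = x g) {t : ℕ}
    (hU : ρ.mat 22 (base e) (base e) = (1 + η * (1 + 4 * η) / ∑ s, (1 : ℝ) / K s) ^ t)
    (hV : ρ.mat 23 (base e) (base e) = (1 - η * (1 - 4 * η) / ∑ s, (1 : ℝ) / K s) ^ t)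
    (hs : ∃ s, weightPotential B q ν η (∑ s, (1 : ℝ) / K s) t (x + Pi.single s (K s * ν s)) ≤
      2 * Fintype.card G) :
    ∃ ρ', Runs e θ chooseCmd ρ ρ' (chooseTime (Fintype.card G) Q) ∧
      (∀ a, a < 10 ∨ 15 < a → a ∉ [19, 20, 21] → ρ'.mat a = ρ.mat a) ∧
      (∀ a, a ≠ 3 → ρ'.nat a = ρ.nat a) ∧
      ∃ s, weightPotential B q ν η (∑ s, (1 : ℝ) / K s) t (x + Pi.single s (K s * ν s)) ≤
        2 * Fintype.card G ∧ ∀ g, ρ'.mat 20 g (base e) = (x + Pi.single s (K s * ν s) : G → ℝ) g := by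
  obtain ⟨Good, hGood⟩ : ∃ Good : G → Prop, ∀ s, Good s ↔
    weightPotential B q ν η (∑ s, (1 : ℝ) / K s) t (x + Pi.single s (K s * ν s)) ≤
      2 * Fintype.card G := ⟨_, fun _ => Iff.rfl⟩
  simp only [← hGood] at hs ⊢
  obtain ⟨ρ', r, ⟨h1, h2⟩, h3⟩ := exists_runs_forAll (e := e) (θ := θ) (a := 3) (ρ := ρ)
    (T := sumTime (Fintype.card G) + (potentialTime (Fintype.card G) Q +
      (sumTime (Fintype.card G) + 1)))
    (c := .seq (assignCmd 19 (.add (.col 18 0) (.mul (.mul (.col 16 3) (.col 0 3))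
        (.ind (.var 0) (.var 3))))) <|
      .seq potentialCmd <|
      .ite (Test.realLt (.add (.real 24) (.real 24))
        (.add (.div (.real 21) (.real 22)) (.div (.real 15) (.real 23)))).compile .skip
        (assignCmd 20 (.mat 19 (.var 0) (.var 1))))
    hθ3
    -- The matrix 20 is meaningful only once an admissible candidate has been visited; the averaging
    -- argument guarantees one in the end.
    (fun P ρ' => ((∀ a, a < 10 ∨ 15 < a → a ∉ [19, 20, 21] → ρ'.mat a = ρ.mat a) ∧
      (∀ a, a ≠ 3 → ρ'.nat a = ρ.nat a)) ∧ ((∃ s ∈ P, Good s) →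
        ∃ s, Good s ∧ ∀ g, ρ'.mat 20 g (base e) = (x + Pi.single s (K s * ν s) : G → ℝ) g))
    (fun P s _ ρ₁ ⟨⟨h1, h2⟩, h3⟩ => by
      have hθ' := hθ.update s
      have hρ₁ : Prepared e ρ₁ ν B q K η m := h.congr
        (fun a ha => h1 a (by simp at ha; omega) (by simp at ha ⊢; omega))
        (fun a ha => h2 a (by simp at ha; omega))
      obtain ⟨ρ₂, r₂, h4, h5, h6⟩ : ∃ ρ₂, Runs e (Function.update θ 3 s)
          (assignCmd 19 (.add (.col 18 0) (.mul (.mul (.col 16 3) (.col 0 3))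
            (.ind (.var 0) (.var 3))))) ρ₁ ρ₂ (sumTime (Fintype.card G)) ∧
          (∀ a, a ≠ 19 → ρ₂.mat a = ρ₁.mat a) ∧ ρ₂.nat = ρ₁.nat ∧
          ∀ g, ρ₂.mat 19 g (base e) = (x + Pi.single s (K s * ν s) : G → ℝ) g := by
        refine ⟨_, runs_assignCmd rfl hθ', fun a ha => by simp [ha], rfl, fun g => ?_⟩
        have h18 : ρ₁.mat 18 g (base e) = x g := by rw [h1 18 (by norm_num) (by simp), hx]
        by_cases hg : g = s
        · subst hg
          simp [Term.eval, Idx.eval, h18, hρ₁.importance, hρ₁.weight]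
        · simp [Term.eval, Idx.eval, h18, hg]
      have hρ₂ : Prepared e ρ₂ ν B q K η m := hρ₁.congr
        (fun a ha => h4 a (by simp at ha; omega)) (fun a _ => by rw [h5])
      obtain ⟨ρ₃, r₃, h7, h8, h9, h10⟩ := runs_potentialCmd hθ' hq hρ₂ h6
      have hF : (∀ a, a < 10 ∨ 15 < a → a ∉ [19, 20, 21] → ρ₃.mat a = ρ.mat a) ∧
          (∀ a, a ≠ 3 → ρ₃.nat a = ρ.nat a) := by
        refine ⟨fun a ha ha' => ?_, fun a ha => ?_⟩
        · simp only [List.mem_cons, List.not_mem_nil, or_false, not_or] at ha'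
          rw [h7 a ha ha'.2.2, h4 a ha'.1, h1 a ha (by simpa using ha')]
        · rw [h8 a ha, h5, h2 a ha]
      have htest : (Test.realLt (.add (.real 24) (.real 24))
          (.add (.div (.real 21) (.real 22)) (.div (.real 15) (.real 23)))).holds e ρ₃
          (Function.update θ 3 s) ↔ ¬ Good s := by
        simp only [Test.holds, Term.eval, Term.eval_real, hF.1 24 (by norm_num) (by simp), h9, h10,
          hF.1 22 (by norm_num) (by simp), hF.1 23 (by norm_num) (by simp), h.card, hU, hV, hGood,
          weightPotential, not_le, two_mul]
      by_cases hgs : Good s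
      · refine ⟨_, r₂.seq (r₃.seq (runs_ite_false (fun h => htest.1 h hgs)
          (runs_assignCmd rfl hθ') _)), ⟨fun a ha ha' => ?_, fun a ha => ?_⟩,
          fun _ => ⟨s, hgs, fun g => ?_⟩⟩
        · have : a ≠ 20 := by rintro rfl; simp at ha'
          simp [this, hF.1 a ha ha']
        · simp [hF.2 a ha]
        · simp [Term.eval, Idx.eval, h7 19, h6]
      · refine ⟨ρ₃, r₂.seq (r₃.seq ((runs_ite_true (htest.2 hgs) runs_skip _).mono ?_)), hF, ?_⟩
        · simp only [sumTime, forTime]; omega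
        · rintro ⟨s', hs', hgs'⟩
          obtain ⟨s₁, h11, h12⟩ := h3
            ⟨s', (Finset.mem_insert.1 hs').resolve_left fun h => hgs (h ▸ hgs'), hgs'⟩
          exact ⟨s₁, h11, fun g => by
            rw [h7 20 (by norm_num) (by norm_num), h4 20 (by norm_num), h12]⟩)
    ⟨⟨fun _ _ _ => rfl, fun _ _ => rfl⟩, by simp⟩
  exact ⟨ρ', r, h1, h2, h3 (hs.imp fun s hs => ⟨Finset.mem_univ s, hs⟩)⟩

/-- `GreedyState` is the loop invariant: `GreedySetup.exists_step` supplies a candidate for the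
search, and `GreedySetup.state_succ` accepts whichever one it finds. -/
theorem runs_greedyCmd (hθ : Idle e θ) (hθ3 : θ 3 = base e) {Q : ℕ} (hq : q ≤ Q)
    (h : Prepared e ρ ν B q K η m) (hsetup : GreedySetup ν B q K η m) :
    ∃ ρ' x, Runs e θ greedyCmd ρ ρ' (greedyTime (Fintype.card G) Q m) ∧
      GreedyState ν B q K η m x ∧
      ∀ g, ρ'.mat 2 g (base e) = (x g + x g⁻¹) / 2 * ((∑ s, (1 : ℝ) / K s) / m) := by
  let Frame : Env G → Prop := fun ρ' =>
    (∀ a, a < 10 ∨ 15 < a → a ∉ [18, 19, 20, 21, 22, 23] → ρ'.mat a = ρ.mat a) ∧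
    (∀ a, a ≠ 3 → a ≠ 5 → ρ'.nat a = ρ.nat a)
  have hprep : ∀ ρ', Frame ρ' → Prepared e ρ' ν B q K η m := fun ρ' hF => h.congr
    (fun a ha => hF.1 a (by simp at ha; omega) (by simp at ha ⊢; omega))
    (fun a ha => hF.2 a (by simp at ha; omega) (by simp at ha; omega))
  obtain ⟨ρ₁, r₁, i1⟩ : ∃ ρ₁, Runs e θ
      (.seq (assignCmd 18 (.nat (.const 0))) <| .seq (setReal 22 (.real 26)) <|
        .seq (setReal 23 (.real 27)) (setScalar 5 (.const 0))) ρ ρ₁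
      (sumTime (Fintype.card G) + (1 + (1 + 1))) ∧ Frame ρ₁ ∧
      (∀ g, ρ₁.mat 18 g (base e) = (0 : G → ℝ) g) ∧ ρ₁.nat 5 = 0 ∧
      ρ₁.mat 22 (base e) (base e) = 1 + η * (1 + 4 * η) / ∑ s, (1 : ℝ) / K s ∧
      ρ₁.mat 23 (base e) (base e) = 1 - η * (1 - 4 * η) / ∑ s, (1 : ℝ) / K s := by
    refine ⟨_, (runs_assignCmd rfl hθ).seq ((runs_setReal _ _).seq ((runs_setReal _ _).seq
      (runs_setScalar _ _))), ⟨fun a ha ha' => ?_, fun a ha ha' => ?_⟩, fun g => ?_, ?_, ?_, ?_⟩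
    · simp only [List.mem_cons, List.not_mem_nil, or_false, not_or] at ha'
      simp [ha']
    · simp [ha']
    · simp [Term.eval, NatTerm.eval]
    · simp [NatTerm.eval]
    · simp [h.upper]
    · simp [h.lower]
  obtain ⟨ρ₂, r₂, x, hF, hx, -, -, -, hstate⟩ := exists_runs_loop (e := e) (θ := θ) (ρ := ρ₁)
    (b := .natLt (.var 5) (.var 2)) (K := m)
    (T := chooseTime (Fintype.card G) Q + (sumTime (Fintype.card G) + (1 + (1 + 1))))
    (c := .seq chooseCmd <| .seq (assignCmd 18 (.mat 20 (.var 0) (.var 1))) <|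
      .seq (setReal 22 (.mul (.real 22) (.real 26))) <|
      .seq (setReal 23 (.mul (.real 23) (.real 27))) (setScalar 5 (.add (.var 5) (.const 1))))
    -- The exponents are t + 1 because the candidates in round t are compared by their potential
    -- after that step.
    (fun t ρ' => ∃ x : G → ℝ, Frame ρ' ∧ (∀ g, ρ'.mat 18 g (base e) = x g) ∧ ρ'.nat 5 = t ∧
      ρ'.mat 22 (base e) (base e) = (1 + η * (1 + 4 * η) / ∑ s, (1 : ℝ) / K s) ^ (t + 1) ∧
      ρ'.mat 23 (base e) (base e) = (1 - η * (1 - 4 * η) / ∑ s, (1 : ℝ) / K s) ^ (t + 1) ∧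
      GreedyState ν B q K η t x)
    (fun t ht ρ₂ ⟨x, hF, hx, h5, hU, hV, hstate⟩ => by
      refine ⟨by simpa [Test.holds, NatTerm.eval, h5, (hprep ρ₂ hF).steps] using ht, ?_⟩
      obtain ⟨ρ₃, r₃, h6, h7, s, h8, h9⟩ := runs_chooseCmd hθ hθ3 hq (hprep ρ₂ hF) hx hU hV
        (hsetup.exists_step ht hstate)
      have hF₃ : Frame ρ₃ := by
        refine ⟨fun a ha ha' => ?_, fun a ha ha' => ?_⟩
        · rw [h6 a ha (by simp at ha' ⊢; omega), hF.1 a ha ha']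
        · rw [h7 a ha, hF.2 a ha ha']
      have hρ₃ := hprep ρ₃ hF₃
      refine ⟨_, r₃.seq ((runs_assignCmd rfl hθ).seq ((runs_setReal _ _).seq
        ((runs_setReal _ _).seq (runs_setScalar _ _)))), x + Pi.single s (K s * ν s),
        ⟨fun a ha ha' => ?_, fun a ha ha' => ?_⟩, fun g => ?_, ?_, ?_, ?_,
        hsetup.state_succ ht hstate h8⟩
      · rw [← hF₃.1 a ha ha']
        simp only [List.mem_cons, List.not_mem_nil, or_false, not_or] at ha'
        simp [ha']
      · simp [ha', hF₃.2 a ha ha']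
      · simp [Term.eval, Idx.eval, h9]
      · simp [NatTerm.eval, h7, h5]
      · simp [Term.eval, hρ₃.upper, h6 22, hU, pow_succ]
      · simp [Term.eval, hρ₃.lower, h6 23, hV, pow_succ])
    (fun ρ' ⟨x, hF, _, h5, _⟩ => by
      simp [Test.holds, NatTerm.eval, h5, (hprep ρ' hF).steps])
    ⟨0, i1.1, i1.2.1, i1.2.2.1, by rw [i1.2.2.2.1, zero_add, pow_one],
      by rw [i1.2.2.2.2, zero_add, pow_one], hsetup.state_zero⟩
  refine ⟨_, x, r₁.seq (r₂.seq (runs_sumCmd rfl hθ)), hstate, fun g => ?_⟩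
  have hinv : ∀ k : G, g * k = 1 ↔ k = g⁻¹ := fun k => mul_eq_one_iff_eq_inv'
  simp [Term.eval, Idx.eval, NatTerm.eval, hx, (hprep ρ₂ hF).total, (hprep ρ₂ hF).steps, hinv]

end Greedy

end CayleySparsification

namespace CayleySparsification

/-! ### The complete program -/

section Main

/-- The whole algorithm: the matrix `2 :=` the weights of the sparsifier. -/
def sparsifyCmd : Cmd :=
  .seq (sumCmd 24 (.nat (.const 1))) <|
  .ite (Test.realLt (.real 1) (.nat (.const 1))).compile
    (.ite (Test.realLt (.nat (.const 1)) (.mul (.mul (.real 1) (.real 1)) (.real 24))).compile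
      (.seq prepareCmd greedyCmd) (assignCmd 2 (.col 0 0)))
    (assignCmd 2 (.nat (.const 0)))

/-- Running times are written over an arbitrary commutative semiring, so the same expression is both
a step count and, at `Polynomial.X`, the required polynomial. -/
def sparsifyTime {R : Type*} [CommSemiring R] (n : R) : R :=
  sumTime n + (prepareTime n + greedyTime n (exponentBound n) (stepBound n) + sumTime n + 1 + 1)

theorem eval_sparsifyTime (n : ℕ) :
    (sparsifyTime (Polynomial.X : Polynomial ℕ)).eval n = sparsifyTime n := by
  simp [sparsifyTime, sumTime, forTime, prepareTime, greedyTime, exponentBound, stepBound,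
    scaleBound, parameterTime, inverseTime, importanceTime, traceTime, chooseTime, potentialTime]

variable {G : Type*} [Group G] [Fintype G] [DecidableEq G]
  {e : G ≃ Fin (Fintype.card G)} {θ : ℕ → G} {ρ : Env G}

/-- The two tests separate the trivial ranges ε ≥ 1 and ε² N ≤ 1. In the remaining range N ≥ 2, and
the greedy phase runs with η = ε / 10, small enough that 8η and 6η are at most ε. -/
theorem runs_sparsifyCmd (hθ : ∀ a, θ a = base e) {S : Finset G} {ν : G → ℝ} {ε : ℝ}
    (hS : IsSymmetricSet S) (hν : IsSymmetricWeight S ν) (hν0 : ν ≠ 0) (hε : 0 < ε)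
    (hρν : ∀ g, ρ.mat 0 g (base e) = ν g) (hρε : ρ.mat 1 (base e) (base e) = ε) :
    ∃ ρ', Runs e θ sparsifyCmd ρ ρ' (sparsifyTime (Fintype.card G)) ∧
      IsCayleySparsifier 1000000 S ν ε fun g => ρ'.mat 2 g (base e) := by
  have hi : Idle e θ := fun a _ => hθ a
  obtain ⟨ρ₁, r₁, h1, h2⟩ : ∃ ρ₁, Runs e θ (sumCmd 24 (.nat (.const 1))) ρ ρ₁
      (sumTime (Fintype.card G)) ∧ (∀ a, a ≠ 24 → ρ₁.mat a = ρ.mat a) ∧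
      ρ₁.mat 24 (base e) (base e) = Fintype.card G :=
    ⟨_, runs_cardCmd 24 hi, fun a ha => by simp [ha], by simp⟩
  have h0 := h1 0 (by norm_num)
  have h3 := h1 1 (by norm_num)
  by_cases hε1 : ε < 1
  · have t1 : (Test.realLt (.real 1) (.nat (.const 1))).holds e ρ₁ θ := by
      simpa [Test.holds, Term.eval, NatTerm.eval, h3, hρε] using hε1
    by_cases hεn : 1 < ε * ε * Fintype.card G
    · have t2 : (Test.realLt (.nat (.const 1))
          (.mul (.mul (.real 1) (.real 1)) (.real 24))).holds e ρ₁ θ := by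
        simpa [Test.holds, Term.eval, NatTerm.eval, h3, hρε, h2] using hεn
      have hN : 2 ≤ Fintype.card G := by
        have : (1 : ℝ) < Fintype.card G := by
          have : ε * ε ≤ 1 := by nlinarith
          nlinarith [Nat.cast_nonneg (α := ℝ) (Fintype.card G)]
        exact_mod_cast this
      obtain ⟨ρ₂, B, q, K, m, r₂, hprep, hsetup, hK, hm, hq, hmM⟩ := runs_prepareCmd (ρ := ρ₁) hi
        (hθ 3) hε hε1.le hεn.le h2 (by rw [h3, hρε]) hν.nonneg (fun g => by rw [h0, hρν])
      obtain ⟨ρ₃, x, r₃, hx, hout⟩ := runs_greedyCmd hi (hθ 3) hq hprep hsetup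
      refine ⟨ρ₃, (r₁.seq (runs_ite_true t1 (runs_ite_true t2 (r₂.seq r₃) _) _)).mono ?_, ?_⟩
      · have : greedyTime (Fintype.card G) (exponentBound (Fintype.card G)) m ≤
            greedyTime (Fintype.card G) (exponentBound (Fintype.card G))
              (stepBound (Fintype.card G)) := by
          unfold greedyTime
          gcongr
        unfold sparsifyTime
        omega
      · simp only [hout]
        refine hx.isCayleySparsifier hν hν0 hε1.le hN hS hsetup hK ?_
        rw [hm]
        refine (Nat.ceil_lt_add_one ?_).le.trans (le_of_eq ?_)
        · exact mul_nonneg (by positivity) (stepScale_pos _ (by positivity)).le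
        · rw [stepScale]; ring
    · have t2 : ¬ (Test.realLt (.nat (.const 1))
          (.mul (.mul (.real 1) (.real 1)) (.real 24))).holds e ρ₁ θ := by
        simpa [Test.holds, Term.eval, NatTerm.eval, h3, hρε, h2] using hεn
      refine ⟨_, (r₁.seq (runs_ite_true t1 (runs_ite_false t2 (runs_assignCmd rfl hi) _) _)).mono
        ?_, ?_⟩
      · unfold sparsifyTime; omega
      · simpa [h0, hρν] using isCayleySparsifier_self hν hε (not_lt.1 hεn)
  · have t1 : ¬ (Test.realLt (.real 1) (.nat (.const 1))).holds e ρ₁ θ := by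
      simpa [Test.holds, Term.eval, NatTerm.eval, h3, hρε] using hε1
    refine ⟨_, (r₁.seq (runs_ite_false t1 (runs_assignCmd rfl hi) _)).mono ?_, ?_⟩
    · unfold sparsifyTime; omega
    · simpa [Term.eval, NatTerm.eval] using isCayleySparsifier_zero hν (not_lt.1 hε1)

theorem rep_inputStore (e : G ≃ Fin (Fintype.card G)) (S : Finset G) (ν : G → ℝ) (ε : ℝ) :
    Rep e (inputStore e S ν ε)
      ⟨fun a g h => (inputStore e S ν ε).real a (e g) (e h), fun _ => 0⟩ fun _ => base e where
  card := by simp [inputStore]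
  mul g h := by simp [inputStore]
  elt a := by simp [inputStore, coe_base]
  nat a := by simp [inputStore]
  mat _ _ _ := rfl

theorem exists_exec_sparsifyCmd (e : G ≃ Fin (Fintype.card G)) {S : Finset G} {ν : G → ℝ} {ε : ℝ}
    (hS : IsSymmetricSet S) (hν : IsSymmetricWeight S ν) (hν0 : ν ≠ 0) (hε : 0 < ε)
    (coin : ℕ → Bool) :
    ∃ τ t, Exec coin sparsifyCmd (inputStore e S ν ε) τ t ∧ t ≤ sparsifyTime (Fintype.card G) ∧
      IsCayleySparsifier 1000000 S ν ε (outputWeight e τ) := by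
  obtain ⟨ρ', r, h⟩ := runs_sparsifyCmd (e := e) (θ := fun _ => base e)
    (ρ := ⟨fun a g h => (inputStore e S ν ε).real a (e g) (e h), fun _ => 0⟩)
    (fun _ => rfl) hS hν hν0 hε (fun g => by simp [inputStore, coe_base])
    (by simp [inputStore, coe_base])
  obtain ⟨τ, t, h1, h2, h3⟩ := r coin _ (rep_inputStore e S ν ε)
  refine ⟨τ, t, h1, h2, ?_⟩
  convert h using 1
  funext g
  rw [← h3.mat, coe_base, outputWeight]

theorem coinProb_of_forall {T : ℕ} {E : Set (ℕ → Bool)} (h : ∀ coin, coin ∈ E) :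
    coinProb T E = 1 := by
  simp [coinProb, h]

end Main

end CayleySparsification

theorem mainTheorem6 :
    ∃ C : ℝ, 0 < C ∧
      (∀ (G : Type u) [Group G] [Fintype G] [DecidableEq G] (S : Finset G) (ν : G → ℝ) (ε : ℝ),
        IsSymmetricSet S → Subgroup.closure (S : Set G) = ⊤ →
        IsSymmetricWeight S ν → ν ≠ 0 → 0 < ε →
        ∃ μ : G → ℝ, IsCayleySparsifier C S ν ε μ) ∧
      (∀ k : ℕ, ∃ (prog : Cmd) (p : Polynomial ℕ),
        ∀ (G : Type u) [Group G] [Fintype G] [DecidableEq G] (S : Finset G) (ν : G → ℝ) (ε : ℝ)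
          (e : G ≃ Fin (Fintype.card G)),
          IsSymmetricSet S → Subgroup.closure (S : Set G) = ⊤ →
          IsSymmetricWeight S ν → ν ≠ 0 → 0 < ε →
          (∀ coin : ℕ → Bool, ∃ (τ : Store) (t : ℕ),
            Exec coin prog (inputStore e S ν ε) τ t ∧ t ≤ p.eval (Fintype.card G)) ∧
          1 - 1 / (Fintype.card G : ℝ) ^ k ≤
            coinProb (p.eval (Fintype.card G))
              {coin | ∃ (τ : Store) (t : ℕ), Exec coin prog (inputStore e S ν ε) τ t ∧
                IsCayleySparsifier C S ν ε (outputWeight e τ)}) := by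
  refine ⟨1000000, by norm_num, fun G _ _ _ S ν ε hS _ hν hν0 hε => ?_,
    fun k => ⟨sparsifyCmd, sparsifyTime Polynomial.X, fun G _ _ _ S ν ε e hS _ hν hν0 hε =>
      ⟨fun coin => ?_, ?_⟩⟩⟩
  · obtain ⟨τ, -, -, -, h⟩ := exists_exec_sparsifyCmd (Fintype.equivFin G) hS hν hν0 hε
      fun _ => false
    exact ⟨_, h⟩
  · obtain ⟨τ, t, h1, h2, -⟩ := exists_exec_sparsifyCmd e hS hν hν0 hε coin
    exact ⟨τ, t, h1, by rwa [eval_sparsifyTime]⟩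
  -- The program succeeds for every coin sequence, so one program serves all k.
  · rw [coinProb_of_forall fun coin => ?_]
    · exact sub_le_self _ (by positivity)
    · obtain ⟨τ, t, h1, -, h2⟩ := exists_exec_sparsifyCmd e hS hν hν0 hε coin
      exact ⟨τ, t, h1, h2⟩
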